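/- Let $\Bbbk$ be an integral domain in which $2$ is invertible. Let $\mathfrak{p}\text{-}\mathbf{Web}$ be the strict monoidal $\Bbbk$-linear supercategory (with super-interchange law $(f\otimes g)\circ(h\otimes k)=(-1)^{|g||h|}(f\circ h)\otimes(g\circ k)$ for homogeneous $g,h$) presented as follows. Objects are finite sequences of positive integers, the tensor product of objects is concatenation, and a label $0$ stands for the unit object (the empty sequence). The generating morphisms are the even splits $a+b\to(a,b)$ and merges $(a,b)\to a+b$ for $a,b\in\mathbb{Z}_{\ge 0}$ (strands labelled $0$ are deleted, so a split or merge with $a=0$ or $b=0$ is an identity), an odd cap $\cap:(1,1)\to\varnothing$ and an odd cup $\cup:\varnothing\to(1,1)$. Notation. The antenna is $\mathrm{ant}:=\tfrac12\,\cap\circ\mathrm{split}_{1,1}:(2)\to\varnothing$. On two strands write $F^{(s)}:(a,b)\to(a-s,b+s)$ for the rung of label $s$ from left to right (split $a$ into $(a-s,s)$, then merge $s$ with $b$), $E^{(r)}:(a,b)\to(a+r,b-r)$ for the rung of label $r$ from right to left, $C:(a,b)\to(a-1,b-1)$ for splitting off a strand $1$ on the inner side of each strand and capping the two, $D:(a,b)\to(a+1,b+1)$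 for inserting a cup between the strands and merging its two ends with them, and $A_R:(a,b)\to(a-2,b)$, $A_L:(a,b)\to(a,b-2)$ for splitting off, on the inner side of the left, respectively right, strand, a strand $2$ ending in an antenna. A diagram with a negatively labelled strand is zero. The binomial coefficients are the generalized ones, $\binom{n}{t}=n(n-1)\cdots(n-t+1)/t!$ for $n\in\mathbb{Z}$. The defining relations, for all $a,b,c,r,s\in\mathbb{Z}_{\ge0}$ and on the strands $(a,b)$ where two strands are involved, are: associativity of merges and coassociativity of splits; $E^{(r)}F^{(s)}=\sum_{t\ge0}\binom{a-b+r-s}{t}F^{(s-t)}E^{(r-t)}$; $(\mathrm{id}_1\otimes\cap)\circ(\cup\otimes\mathrm{id}_1)=\mathrm{id}_1=-(\cap\otimes\mathrm{id}_1)\circ(\mathrm{id}_1\otimes\cup)$; $\mathrm{ant}\circ\mathrm{merge}_{1,1}=\cap$; $C F^{(r)}=F^{(r)}C+2F^{(r-1)}A_R$; $C E^{(r)}=E^{(r)}C+2E^{(r-1)}A_L$; $F^{(r)}D=DF^{(r)}$; $E^{(r)}D=DE^{(r)}$. For $a,b\in\mathbb{Z}_{\ge0}$ let the crossing $(a,b)\to(b,a)$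 be $$\sum_{r,s\ge0,\ s-r=a-b}(-1)^{a-s}\,E^{(r)}F^{(s)},$$ and for general objects $\boldsymbol a,\boldsymbol b$ let $\beta_{\boldsymbol a,\boldsymbol b}:\boldsymbol a\otimes\boldsymbol b\to\boldsymbol b\otimes\boldsymbol a$ be the diagram in which each strand of $\boldsymbol a$ crosses each strand of $\boldsymbol b$ once. Then the morphisms $\beta_{\boldsymbol a,\boldsymbol b}$ form a symmetric braiding on $\mathfrak{p}\text{-}\mathbf{Web}$. That is, they are even isomorphisms; they are natural, in the sense that $\beta_{\boldsymbol a',\boldsymbol b'}\circ(f\otimes g)=(-1)^{|f||g|}(g\otimes f)\circ\beta_{\boldsymbol a,\boldsymbol b}$ for all homogeneous $f:\boldsymbol a\to\boldsymbol a'$ and $g:\boldsymbol b\to\boldsymbol b'$; they satisfy both hexagon identities, $\beta_{\boldsymbol a,\boldsymbol b\otimes\boldsymbol c}=(\mathrm{id}_{\boldsymbol b}\otimes\beta_{\boldsymbol a,\boldsymbol c})\circ(\beta_{\boldsymbol a,\boldsymbol b}\otimes\mathrm{id}_{\boldsymbol c})$ and $\beta_{\boldsymbol a\otimes\boldsymbol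 b,\boldsymbol c}=(\beta_{\boldsymbol a,\boldsymbol c}\otimes\mathrm{id}_{\boldsymbol b})\circ(\mathrm{id}_{\boldsymbol a}\otimes\beta_{\boldsymbol b,\boldsymbol c})$; and $\beta_{\boldsymbol b,\boldsymbol a}\circ\beta_{\boldsymbol a,\boldsymbol b}=\mathrm{id}$. -/

import Mathlib

open CategoryTheory

universe u v w

/-! ## Strict monoidal supercategories and symmetric braidings -/

/-- The sign `(-1)^{pq}` attached to two parities. -/
def koszulSign (k : Type u) [CommRing k] (p q : ZMod 2) : k := (-1) ^ (p.val * q.val)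

/-- A strict monoidal `k`-linear supercategory: every morphism module is a `k`-supermodule (it is the
direct sum of its even and odd parts), composition and the tensor product of morphisms are bilinear
and add parities, the tensor product is strictly associative and unital, and the super-interchange
law holds.  Recall that `f ≫ g` is first `f`, then `g`. -/
class StrictMonoidalSupercategory (k : Type u) [CommRing k] (C : Type v) [Category.{w} C]
    [Preadditive C] [Linear k C] where
  /-- `parity X Y p` is the submodule of morphisms `X ⟶ Y` of parity `p`. -/
  parity (X Y : C) : ZMod 2 → Submodule k (X ⟶ Y)
  parity_isInternal (X Y : C) : DirectSum.IsInternal (parity X Y)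
  id_mem (X : C) : 𝟙 X ∈ parity X X 0
  comp_mem {X Y Z : C} {p q : ZMod 2} {f : X ⟶ Y} {g : Y ⟶ Z} :
    f ∈ parity X Y p → g ∈ parity Y Z q → f ≫ g ∈ parity X Z (p + q)
  /-- The unit object. -/
  unitObj : C
  /-- The tensor product of objects. -/
  tensorObj : C → C → C
  /-- The tensor product of morphisms. -/
  tensorHom {X X' Y Y' : C} :
    (X ⟶ X') →ₗ[k] (Y ⟶ Y') →ₗ[k] (tensorObj X Y ⟶ tensorObj X' Y')
  tensorHom_mem {X X' Y Y' : C} {p q : ZMod 2} {f : X ⟶ X'} {g : Y ⟶ Y'} :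
    f ∈ parity X X' p → g ∈ parity Y Y' q → tensorHom f g ∈ parity _ _ (p + q)
  id_tensorHom_id (X Y : C) : tensorHom (𝟙 X) (𝟙 Y) = 𝟙 (tensorObj X Y)
  super_interchange {X X' X'' Y Y' Y'' : C} {p q : ZMod 2}
    (h : X ⟶ X') (e : Y ⟶ Y') (f : X' ⟶ X'') (g : Y' ⟶ Y'') :
    h ∈ parity X X' p → g ∈ parity Y' Y'' q →
      tensorHom h e ≫ tensorHom f g = koszulSign k p q • tensorHom (h ≫ f) (e ≫ g)
  assoc_obj (X Y Z : C) : tensorObj (tensorObj X Y) Z = tensorObj X (tensorObj Y Z)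
  unit_tensorObj (X : C) : tensorObj unitObj X = X
  tensorObj_unit (X : C) : tensorObj X unitObj = X
  assoc_hom {X X' Y Y' Z Z' : C} (f : X ⟶ X') (g : Y ⟶ Y') (h : Z ⟶ Z') :
    tensorHom (tensorHom f g) h =
      eqToHom (assoc_obj X Y Z) ≫ tensorHom f (tensorHom g h) ≫ eqToHom (assoc_obj X' Y' Z').symm
  unit_tensorHom {X X' : C} (f : X ⟶ X') :
    tensorHom (𝟙 unitObj) f = eqToHom (unit_tensorObj X) ≫ f ≫ eqToHom (unit_tensorObj X').symm
  tensorHom_unit {X X' : C} (f : X ⟶ X') :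
    tensorHom f (𝟙 unitObj) = eqToHom (tensorObj_unit X) ≫ f ≫ eqToHom (tensorObj_unit X').symm

open StrictMonoidalSupercategory in
/-- A family `β X Y : X ⊗ Y ⟶ Y ⊗ X` of morphisms of a strict monoidal supercategory is a symmetric
braiding when it consists of even morphisms, is natural (with the sign `(-1)^{pq}` for
morphisms of parities `p` and `q`), satisfies both hexagon identities, and squares to the identity
(so that, in particular, every `β X Y` is an isomorphism). -/
structure IsSymmetricBraiding (k : Type u) [CommRing k] (C : Type v) [Category.{w} C]
    [Preadditive C] [Linear k C] [StrictMonoidalSupercategory k C]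
    (β : ∀ X Y : C, tensorObj k X Y ⟶ tensorObj k Y X) : Prop where
  even (X Y : C) : β X Y ∈ parity (k := k) (tensorObj k X Y) (tensorObj k Y X) 0
  naturality {X X' Y Y' : C} {p q : ZMod 2} (f : X ⟶ X') (g : Y ⟶ Y') :
    f ∈ parity (k := k) X X' p → g ∈ parity (k := k) Y Y' q →
      tensorHom (k := k) f g ≫ β X' Y' =
        koszulSign k p q • (β X Y ≫ tensorHom (k := k) g f)
  hexagon_right (X Y Z : C) :
    β X (tensorObj k Y Z) =
      eqToHom (assoc_obj X Y Z).symm ≫ tensorHom (k := k) (β X Y) (𝟙 Z) ≫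
        eqToHom (assoc_obj Y X Z) ≫ tensorHom (k := k) (𝟙 Y) (β X Z) ≫
          eqToHom (assoc_obj Y Z X).symm
  hexagon_left (X Y Z : C) :
    β (tensorObj k X Y) Z =
      eqToHom (assoc_obj X Y Z) ≫ tensorHom (k := k) (𝟙 X) (β Y Z) ≫
        eqToHom (assoc_obj X Z Y).symm ≫ tensorHom (k := k) (β X Z) (𝟙 Y) ≫
          eqToHom (assoc_obj Z X Y)
  symmetric (X Y : C) : β X Y ≫ β Y X = 𝟙 (tensorObj k X Y)

/-! ## Web diagrams -/

/-- The object attached to one strand with a nonnegative integer label: the label `0` stands for the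
unit object (the empty sequence). -/
def strand : ℕ → List ℕ+
  | 0 => []
  | n + 1 => [n.succPNat]

/-- Formal expressions in the generating morphisms (splits, merges, cap, cup), built with
identities, composition, tensor product and `k`-linear combinations.  Objects are sequences of
positive integers.  `comp f g` is first `f` (at the bottom), then `g`. -/
inductive PreWeb (k : Type u) : List ℕ+ → List ℕ+ → Type u
  | id (a : List ℕ+) : PreWeb k a a
  | comp {a b c : List ℕ+} (f : PreWeb k a b) (g : PreWeb k b c) : PreWeb k a c
  | tensor {a a' b b' : List ℕ+} (f : PreWeb k a a') (g : PreWeb k b b') :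
      PreWeb k (a ++ b) (a' ++ b')
  | split (a b : ℕ) : PreWeb k (strand (a + b)) (strand a ++ strand b)
  | merge (a b : ℕ) : PreWeb k (strand a ++ strand b) (strand (a + b))
  | cap : PreWeb k (strand 1 ++ strand 1) []
  | cup : PreWeb k [] (strand 1 ++ strand 1)
  | zero (a b : List ℕ+) : PreWeb k a b
  | add {a b : List ℕ+} (f g : PreWeb k a b) : PreWeb k a b
  | smul {a b : List ℕ+} (x : k) (f : PreWeb k a b) : PreWeb k a b

namespace PreWeb

variable {k : Type u}

/-- Transport along equalities of objects. -/
def cast {a a' b b' : List ℕ+} (ha : a = a') (hb : b = b') (f : PreWeb k a b) : PreWeb k a' b' :=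
  ha ▸ hb ▸ f

/-- `sum n f = f 0 + ⋯ + f (n - 1)`. -/
def sum {a b : List ℕ+} : ℕ → (ℕ → PreWeb k a b) → PreWeb k a b
  | 0, _ => zero a b
  | n + 1, f => add (sum n f) (f n)

/-- The expression `f` is homogeneous of the given parity: splits and merges are even, the cap and
the cup are odd. -/
inductive HasParity : ∀ {a b : List ℕ+}, PreWeb k a b → ZMod 2 → Prop
  | id (a : List ℕ+) : HasParity (id a) 0
  | comp {a b c : List ℕ+} {f : PreWeb k a b} {g : PreWeb k b c} {p q : ZMod 2} :
      HasParity f p → HasParity g q → HasParity (comp f g) (p + q)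
  | tensor {a a' b b' : List ℕ+} {f : PreWeb k a a'} {g : PreWeb k b b'} {p q : ZMod 2} :
      HasParity f p → HasParity g q → HasParity (tensor f g) (p + q)
  | split (a b : ℕ) : HasParity (split a b) 0
  | merge (a b : ℕ) : HasParity (merge a b) 0
  | cap : HasParity cap 1
  | cup : HasParity cup 1
  | zero (a b : List ℕ+) (p : ZMod 2) : HasParity (zero a b) p
  | add {a b : List ℕ+} {f g : PreWeb k a b} {p : ZMod 2} :
      HasParity f p → HasParity g p → HasParity (add f g) p
  | smul {a b : List ℕ+} (x : k) {f : PreWeb k a b} {p : ZMod 2} :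
      HasParity f p → HasParity (smul x f) p

/-- A rung labelled `s` from the left strand up to the right strand, leading from `(a, b)` to
`(c, d)` with `c = a - s` and `d = b + s`.  If there is no such diagram (in particular if `a - s` is
negative), this is zero. -/
def rungRight (s a b c d : ℕ) : PreWeb k (strand a ++ strand b) (strand c ++ strand d) :=
  if h : c + s = a ∧ s + b = d then
    comp
      (cast (by rw [h.1]) (List.append_assoc _ _ _) (tensor (split c s) (id (strand b))))
      (cast rfl (by rw [h.2]) (tensor (id (strand c)) (merge s b)))
  else zero _ _

/-- A rung labelled `r` from the right strand up to the left strand, leading from `(a, b)` to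
`(c, d)` with `c = a + r` and `d = b - r`.  If there is no such diagram (in particular if `b - r` is
negative), this is zero. -/
def rungLeft (r a b c d : ℕ) : PreWeb k (strand a ++ strand b) (strand c ++ strand d) :=
  if h : a + r = c ∧ r + d = b then
    comp
      (cast (by rw [h.2]) (List.append_assoc _ _ _).symm (tensor (id (strand a)) (split r d)))
      (cast rfl (by rw [h.1]) (tensor (merge a r) (id (strand d))))
  else zero _ _

/-- A cap between two strands, leading from `(a, b)` to `(c, d)` with `c = a - 1` and `d = b - 1`
(zero if one of these is negative). -/
def capBetween (a b c d : ℕ) : PreWeb k (strand a ++ strand b) (strand c ++ strand d) :=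
  if h : c + 1 = a ∧ 1 + d = b then
    comp
      (cast (by rw [h.1, h.2]) (by simp only [List.append_assoc])
        (tensor (split c 1) (split 1 d)) :
          PreWeb k _ (strand c ++ ((strand 1 ++ strand 1) ++ strand d)))
      (tensor (id (strand c)) (tensor cap (id (strand d))))
  else zero _ _

/-- A cup between two strands, leading from `(a, b)` to `(c, d)` with `c = a + 1` and `d = b + 1`
(zero if the labels do not match). -/
def cupBetween (a b c d : ℕ) : PreWeb k (strand a ++ strand b) (strand c ++ strand d) :=
  if h : a + 1 = c ∧ 1 + b = d then
    comp
      (tensor (id (strand a)) (tensor cup (id (strand b))))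
      (cast (by simp only [List.append_assoc]) (by rw [h.1, h.2])
        (tensor (merge a 1) (merge 1 b)))
  else zero _ _

/-- The antenna, one half of the cap after the split of the strand `2`. -/
def antenna [CommRing k] [Invertible (2 : k)] : PreWeb k (strand 2) [] :=
  smul (⅟2) (comp (split 1 1) cap)

/-- The left strand `a` emits to its right a strand `2` ending in an antenna, leading from `(a, b)`
to `(c, b)` with `c = a - 2` (zero if this is negative). -/
def antennaRight [CommRing k] [Invertible (2 : k)] (a b c : ℕ) :
    PreWeb k (strand a ++ strand b) (strand c ++ strand b) :=
  if h : c + 2 = a then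
    comp
      (cast (by rw [h]) (List.append_assoc _ _ _) (tensor (split c 2) (id (strand b))))
      (tensor (id (strand c)) (tensor antenna (id (strand b))))
  else zero _ _

/-- The right strand `b` emits to its left a strand `2` ending in an antenna, leading from `(a, b)`
to `(a, d)` with `d = b - 2` (zero if this is negative). -/
def antennaLeft [CommRing k] [Invertible (2 : k)] (a b d : ℕ) :
    PreWeb k (strand a ++ strand b) (strand a ++ strand d) :=
  if h : 2 + d = b then
    comp
      (cast (by rw [h]) rfl (tensor (id (strand a)) (split 2 d)))
      (tensor (id (strand a)) (tensor antenna (id (strand d))))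
  else zero _ _

/-- The defining relations of the type P web category: strands labelled `0` are deleted,
web-associativity, rung swap, straightening, antenna retraction, cap/rung swap, cup/rung swap.  Where
`c` and `d` occur in a relation between ladders, they are the labels at the top. -/
inductive WebRel (k : Type u) [CommRing k] [Invertible (2 : k)] :
    ∀ {a b : List ℕ+}, PreWeb k a b → PreWeb k a b → Prop
  | zero_split (b : ℕ) :
      WebRel k (split 0 b) (cast (by rw [Nat.zero_add]) rfl (id (strand b)))
  | split_zero (a : ℕ) :
      WebRel k (split a 0) (cast rfl (List.append_nil _).symm (id (strand a)))
  | zero_merge (b : ℕ) :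
      WebRel k (merge 0 b) (cast rfl (by rw [Nat.zero_add]) (id (strand b)))
  | merge_zero (a : ℕ) :
      WebRel k (merge a 0) (cast (List.append_nil _).symm rfl (id (strand a)))
  | assoc_split (a b c : ℕ) :
      WebRel k
        (cast (by rw [Nat.add_assoc]) (List.append_assoc _ _ _)
          (comp (split (a + b) c) (tensor (split a b) (id (strand c)))))
        (comp (split a (b + c)) (tensor (id (strand a)) (split b c)))
  | assoc_merge (a b c : ℕ) :
      WebRel k
        (cast (List.append_assoc _ _ _) (by rw [Nat.add_assoc])
          (comp (tensor (merge a b) (id (strand c))) (merge (a + b) c)))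
        (comp (tensor (id (strand a)) (merge b c)) (merge a (b + c)))
  | rung_swap (a b r s c d : ℕ) (hc : c + s = a + r) (hd : d + r = b + s) :
      WebRel k
        (comp (rungRight s a b (a - s) (b + s)) (rungLeft r (a - s) (b + s) c d))
        (sum (min r s + 1) fun t =>
          smul ((Ring.choose ((a : ℤ) - b + r - s) t : ℤ) : k)
            (comp (rungLeft (r - t) a b (a + (r - t)) (b - (r - t)))
              (rungRight (s - t) (a + (r - t)) (b - (r - t)) c d)))
  | straighten_left :
      WebRel k
        (comp
          (cast rfl (List.append_assoc _ _ _) (tensor cup (id (strand 1))) :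
            PreWeb k (strand 1) (strand 1 ++ (strand 1 ++ strand 1)))
          (tensor (id (strand 1)) cap))
        (id (strand 1))
  | straighten_right :
      WebRel k
        (smul (-1)
          (comp
            (cast rfl (List.append_assoc _ _ _).symm (tensor (id (strand 1)) cup) :
              PreWeb k (strand 1) ((strand 1 ++ strand 1) ++ strand 1))
            (tensor cap (id (strand 1)))))
        (id (strand 1))
  | antenna_retraction : WebRel k (comp (merge 1 1) antenna) cap
  | cap_rungRight (a b r c d : ℕ) (hc : c + r + 1 = a) (hd : d + 1 = b + r) :
      WebRel k
        (comp (rungRight r a b (a - r) (b + r)) (capBetween (a - r) (b + r) c d))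
        (add
          (comp (capBetween a b (a - 1) (b - 1)) (rungRight r (a - 1) (b - 1) c d))
          (smul 2 (if r = 0 then zero _ _ else
            comp (antennaRight a b (a - 2)) (rungRight (r - 1) (a - 2) b c d))))
  | cap_rungLeft (a b r c d : ℕ) (hc : c + 1 = a + r) (hd : d + r + 1 = b) :
      WebRel k
        (comp (rungLeft r a b (a + r) (b - r)) (capBetween (a + r) (b - r) c d))
        (add
          (comp (capBetween a b (a - 1) (b - 1)) (rungLeft r (a - 1) (b - 1) c d))
          (smul 2 (if r = 0 then zero _ _ else
            comp (antennaLeft a b (b - 2)) (rungLeft (r - 1) a (b - 2) c d))))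
  | cup_rungRight (a b r c d : ℕ) (hc : c + r = a + 1) (hd : d = b + r + 1) :
      WebRel k
        (comp (cupBetween a b (a + 1) (b + 1)) (rungRight r (a + 1) (b + 1) c d))
        (comp (rungRight r a b (a - r) (b + r)) (cupBetween (a - r) (b + r) c d))
  | cup_rungLeft (a b r c d : ℕ) (hc : c = a + r + 1) (hd : d + r = b + 1) :
      WebRel k
        (comp (cupBetween a b (a + 1) (b + 1)) (rungLeft r (a + 1) (b + 1) c d))
        (comp (rungLeft r a b (a + r) (b - r)) (cupBetween (a + r) (b - r) c d))

/-- Equality of formal expressions in the strict monoidal `k`-linear supercategory generated by the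
generating morphisms subject to `WebRel`: the smallest congruence that contains `WebRel` and the
axioms of a strict monoidal `k`-linear supercategory. -/
inductive Equal {k : Type u} [CommRing k] [Invertible (2 : k)] :
    ∀ {a b : List ℕ+}, PreWeb k a b → PreWeb k a b → Prop
  | rel {a b} {f g : PreWeb k a b} : WebRel k f g → Equal f g
  | refl {a b} (f : PreWeb k a b) : Equal f f
  | symm {a b} {f g : PreWeb k a b} : Equal f g → Equal g f
  | trans {a b} {f g h : PreWeb k a b} : Equal f g → Equal g h → Equal f h
  | comp {a b c} {f f' : PreWeb k a b} {g g' : PreWeb k b c} :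
      Equal f f' → Equal g g' → Equal (comp f g) (comp f' g')
  | tensor {a a' b b'} {f f' : PreWeb k a a'} {g g' : PreWeb k b b'} :
      Equal f f' → Equal g g' → Equal (tensor f g) (tensor f' g')
  | add {a b} {f f' g g' : PreWeb k a b} :
      Equal f f' → Equal g g' → Equal (add f g) (add f' g')
  | smul {a b} (x : k) {f f' : PreWeb k a b} : Equal f f' → Equal (smul x f) (smul x f')
  | add_assoc {a b} (f g h : PreWeb k a b) : Equal ((f.add g).add h) (f.add (g.add h))
  | add_comm {a b} (f g : PreWeb k a b) : Equal (f.add g) (g.add f)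
  | add_zero {a b} (f : PreWeb k a b) : Equal (f.add (zero a b)) f
  | smul_add {a b} (x : k) (f g : PreWeb k a b) :
      Equal (PreWeb.smul x (f.add g)) ((PreWeb.smul x f).add (PreWeb.smul x g))
  | add_smul {a b} (x y : k) (f : PreWeb k a b) :
      Equal (PreWeb.smul (x + y) f) ((PreWeb.smul x f).add (PreWeb.smul y f))
  | mul_smul {a b} (x y : k) (f : PreWeb k a b) :
      Equal (PreWeb.smul (x * y) f) (PreWeb.smul x (PreWeb.smul y f))
  | one_smul {a b} (f : PreWeb k a b) : Equal (PreWeb.smul 1 f) f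
  | zero_smul {a b} (f : PreWeb k a b) : Equal (PreWeb.smul 0 f) (zero a b)
  | id_comp {a b} (f : PreWeb k a b) : Equal ((id a).comp f) f
  | comp_id {a b} (f : PreWeb k a b) : Equal (f.comp (id b)) f
  | comp_assoc {a b c d} (f : PreWeb k a b) (g : PreWeb k b c) (h : PreWeb k c d) :
      Equal ((f.comp g).comp h) (f.comp (g.comp h))
  | add_comp {a b c} (f f' : PreWeb k a b) (g : PreWeb k b c) :
      Equal ((f.add f').comp g) ((f.comp g).add (f'.comp g))
  | comp_add {a b c} (f : PreWeb k a b) (g g' : PreWeb k b c) :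
      Equal (f.comp (g.add g')) ((f.comp g).add (f.comp g'))
  | smul_comp {a b c} (x : k) (f : PreWeb k a b) (g : PreWeb k b c) :
      Equal ((PreWeb.smul x f).comp g) (PreWeb.smul x (f.comp g))
  | comp_smul {a b c} (x : k) (f : PreWeb k a b) (g : PreWeb k b c) :
      Equal (f.comp (PreWeb.smul x g)) (PreWeb.smul x (f.comp g))
  | add_tensor {a a' b b'} (f f' : PreWeb k a a') (g : PreWeb k b b') :
      Equal ((f.add f').tensor g) ((f.tensor g).add (f'.tensor g))
  | tensor_add {a a' b b'} (f : PreWeb k a a') (g g' : PreWeb k b b') :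
      Equal (f.tensor (g.add g')) ((f.tensor g).add (f.tensor g'))
  | smul_tensor {a a' b b'} (x : k) (f : PreWeb k a a') (g : PreWeb k b b') :
      Equal ((PreWeb.smul x f).tensor g) (PreWeb.smul x (f.tensor g))
  | tensor_smul {a a' b b'} (x : k) (f : PreWeb k a a') (g : PreWeb k b b') :
      Equal (f.tensor (PreWeb.smul x g)) (PreWeb.smul x (f.tensor g))
  | id_tensor_id (a b : List ℕ+) : Equal ((id a).tensor (id b)) (id (a ++ b))
  | super_interchange {a a' a'' b b' b''} {p q : ZMod 2}
      (h : PreWeb k a a') (e : PreWeb k b b') (f : PreWeb k a' a'') (g : PreWeb k b' b'') :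
      HasParity h p → HasParity g q →
        Equal ((h.tensor e).comp (f.tensor g))
          (PreWeb.smul (koszulSign k p q) ((h.comp f).tensor (e.comp g)))
  | tensor_assoc {a a' b b' c c'}
      (f : PreWeb k a a') (g : PreWeb k b b') (h : PreWeb k c c') :
      Equal (cast (List.append_assoc a b c) (List.append_assoc a' b' c') ((f.tensor g).tensor h))
        (f.tensor (g.tensor h))
  | unit_tensor {a a'} (f : PreWeb k a a') : Equal ((id []).tensor f) f
  | tensor_unit {a a'} (f : PreWeb k a a') :
      Equal (cast (List.append_nil a) (List.append_nil a') (f.tensor (id []))) f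

/-! ### The parity involution

The automorphism that negates the odd generators; it shows that the even and the odd parts of
the morphism spaces are independent. -/

/-- The parity involution: caps and cups are negated. -/
def bar [CommRing k] : ∀ {a b : List ℕ+}, PreWeb k a b → PreWeb k a b
  | _, _, id a => id a
  | _, _, comp f g => comp (bar f) (bar g)
  | _, _, tensor f g => tensor (bar f) (bar g)
  | _, _, split a b => split a b
  | _, _, merge a b => merge a b
  | _, _, cap => smul (-1) cap
  | _, _, cup => smul (-1) cup
  | _, _, zero a b => zero a b
  | _, _, add f g => add (bar f) (bar g)
  | _, _, smul x f => smul x (bar f)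

theorem HasParity.cast {a a' b b' : List ℕ+} (ha : a = a') (hb : b = b') {f : PreWeb k a b}
    {p : ZMod 2} (hf : HasParity f p) : HasParity (f.cast ha hb) p := by
  subst ha hb; exact hf

theorem bar_cast [CommRing k] {a a' b b' : List ℕ+} (ha : a = a') (hb : b = b')
    (f : PreWeb k a b) : bar (f.cast ha hb) = (bar f).cast ha hb := by
  subst ha hb; rfl

theorem HasParity.sum {a b : List ℕ+} {p : ZMod 2} (n : ℕ) {f : ℕ → PreWeb k a b}
    (hf : ∀ i, HasParity (f i) p) : HasParity (PreWeb.sum n f) p := by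
  induction n with
  | zero => exact .zero _ _ _
  | succ n ih => exact .add ih (hf n)

theorem HasParity.bar [CommRing k] {a b : List ℕ+} {f : PreWeb k a b} {p : ZMod 2}
    (hf : HasParity f p) : HasParity (PreWeb.bar f) p := by
  induction hf with
  | id a => exact .id a
  | comp _ _ h1 h2 => exact .comp h1 h2
  | tensor _ _ h1 h2 => exact .tensor h1 h2
  | split a b => exact .split a b
  | merge a b => exact .merge a b
  | cap => exact .smul _ .cap
  | cup => exact .smul _ .cup
  | zero a b p => exact .zero a b p
  | add _ _ h1 h2 => exact .add h1 h2
  | smul x _ h => exact .smul x h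

theorem hasParity_rungRight (s a b c d : ℕ) :
    HasParity (rungRight s a b c d : PreWeb k _ _) 0 := by
  unfold rungRight
  split_ifs
  · exact .comp (p := 0) (q := 0) (.cast _ _ (.tensor (p := 0) (q := 0) (.split _ _) (.id _)))
      (.cast _ _ (.tensor (p := 0) (q := 0) (.id _) (.merge _ _)))
  · exact .zero _ _ _

theorem hasParity_rungLeft (s a b c d : ℕ) :
    HasParity (rungLeft s a b c d : PreWeb k _ _) 0 := by
  unfold rungLeft
  split_ifs
  · exact .comp (p := 0) (q := 0) (.cast _ _ (.tensor (p := 0) (q := 0) (.id _) (.split _ _)))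
      (.cast _ _ (.tensor (p := 0) (q := 0) (.merge _ _) (.id _)))
  · exact .zero _ _ _

theorem hasParity_capBetween (a b c d : ℕ) :
    HasParity (capBetween a b c d : PreWeb k _ _) 1 := by
  unfold capBetween
  split_ifs
  · exact .comp (p := 0) (q := 1)
      (.cast _ _ (.tensor (p := 0) (q := 0) (.split _ _) (.split _ _)))
      (.tensor (p := 0) (q := 1) (.id _) (.tensor (p := 1) (q := 0) .cap (.id _)))
  · exact .zero _ _ _

theorem hasParity_cupBetween (a b c d : ℕ) :
    HasParity (cupBetween a b c d : PreWeb k _ _) 1 := by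
  unfold cupBetween
  split_ifs
  · exact .comp (p := 1) (q := 0)
      (.tensor (p := 0) (q := 1) (.id _) (.tensor (p := 1) (q := 0) .cup (.id _)))
      (.cast _ _ (.tensor (p := 0) (q := 0) (.merge _ _) (.merge _ _)))
  · exact .zero _ _ _

theorem hasParity_antenna [CommRing k] [Invertible (2 : k)] :
    HasParity (antenna : PreWeb k _ _) 1 :=
  .smul _ (.comp (p := 0) (q := 1) (.split _ _) .cap)

theorem hasParity_antennaRight [CommRing k] [Invertible (2 : k)] (a b c : ℕ) :
    HasParity (antennaRight a b c : PreWeb k _ _) 1 := by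
  unfold antennaRight
  split_ifs
  · exact .comp (p := 0) (q := 1)
      (.cast _ _ (.tensor (p := 0) (q := 0) (.split _ _) (.id _)))
      (.tensor (p := 0) (q := 1) (.id _) (.tensor (p := 1) (q := 0) hasParity_antenna (.id _)))
  · exact .zero _ _ _

theorem hasParity_antennaLeft [CommRing k] [Invertible (2 : k)] (a b c : ℕ) :
    HasParity (antennaLeft a b c : PreWeb k _ _) 1 := by
  unfold antennaLeft
  split_ifs
  · exact .comp (p := 0) (q := 1)
      (.cast _ _ (.tensor (p := 0) (q := 0) (.id _) (.split _ _)))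
      (.tensor (p := 0) (q := 1) (.id _) (.tensor (p := 1) (q := 0) hasParity_antenna (.id _)))
  · exact .zero _ _ _

theorem WebRel.hasParity [CommRing k] [Invertible (2 : k)] {a b : List ℕ+} {f g : PreWeb k a b}
    (h : WebRel k f g) : ∃ p, HasParity f p ∧ HasParity g p := by
  cases h with
  | zero_split b => exact ⟨0, .split _ _, .cast _ _ (.id _)⟩
  | split_zero a => exact ⟨0, .split _ _, .cast _ _ (.id _)⟩
  | zero_merge b => exact ⟨0, .merge _ _, .cast _ _ (.id _)⟩
  | merge_zero a => exact ⟨0, .merge _ _, .cast _ _ (.id _)⟩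
  | assoc_split a b c =>
    exact ⟨0, .cast _ _ (.comp (p := 0) (q := 0) (.split _ _)
      (.tensor (p := 0) (q := 0) (.split _ _) (.id _))),
      .comp (p := 0) (q := 0) (.split _ _) (.tensor (p := 0) (q := 0) (.id _) (.split _ _))⟩
  | assoc_merge a b c =>
    exact ⟨0, .cast _ _ (.comp (p := 0) (q := 0)
      (.tensor (p := 0) (q := 0) (.merge _ _) (.id _)) (.merge _ _)),
      .comp (p := 0) (q := 0) (.tensor (p := 0) (q := 0) (.id _) (.merge _ _)) (.merge _ _)⟩
  | rung_swap a b r s c d hc hd =>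
    exact ⟨0, .comp (p := 0) (q := 0) (hasParity_rungRight ..) (hasParity_rungLeft ..),
      .sum _ fun t => .smul _
        (.comp (p := 0) (q := 0) (hasParity_rungLeft ..) (hasParity_rungRight ..))⟩
  | straighten_left =>
    exact ⟨0, .comp (p := 1) (q := 1) (.cast _ _ (.tensor (p := 1) (q := 0) .cup (.id _)))
      (.tensor (p := 0) (q := 1) (.id _) .cap), .id _⟩
  | straighten_right =>
    exact ⟨0, .smul _ (.comp (p := 1) (q := 1)
      (.cast _ _ (.tensor (p := 0) (q := 1) (.id _) .cup))
      (.tensor (p := 1) (q := 0) .cap (.id _))), .id _⟩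
  | antenna_retraction =>
    exact ⟨1, .comp (p := 0) (q := 1) (.merge _ _) hasParity_antenna, .cap⟩
  | cap_rungRight a b r c d hc hd =>
    refine ⟨1, .comp (p := 0) (q := 1) (hasParity_rungRight ..) (hasParity_capBetween ..),
      .add (.comp (p := 1) (q := 0) (hasParity_capBetween ..) (hasParity_rungRight ..))
        (.smul _ ?_)⟩
    split_ifs
    · exact .zero _ _ _
    · exact .comp (p := 1) (q := 0) (hasParity_antennaRight ..) (hasParity_rungRight ..)
  | cap_rungLeft a b r c d hc hd =>
    refine ⟨1, .comp (p := 0) (q := 1) (hasParity_rungLeft ..) (hasParity_capBetween ..),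
      .add (.comp (p := 1) (q := 0) (hasParity_capBetween ..) (hasParity_rungLeft ..))
        (.smul _ ?_)⟩
    split_ifs
    · exact .zero _ _ _
    · exact .comp (p := 1) (q := 0) (hasParity_antennaLeft ..) (hasParity_rungLeft ..)
  | cup_rungRight a b r c d hc hd =>
    exact ⟨1, .comp (p := 1) (q := 0) (hasParity_cupBetween ..) (hasParity_rungRight ..),
      .comp (p := 0) (q := 1) (hasParity_rungRight ..) (hasParity_cupBetween ..)⟩
  | cup_rungLeft a b r c d hc hd =>
    exact ⟨1, .comp (p := 1) (q := 0) (hasParity_cupBetween ..) (hasParity_rungLeft ..),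
      .comp (p := 0) (q := 1) (hasParity_rungLeft ..) (hasParity_cupBetween ..)⟩

end PreWeb

/-! ## The supercategory of type P webs -/

/-- The type P web category over `k`: its objects are the finite sequences of positive integers. -/
structure PWeb (k : Type u) where
  /-- The underlying sequence of strand labels. -/
  word : List ℕ+

namespace PWeb

section

variable (k : Type u) [CommRing k] [Invertible (2 : k)]

/-- Equality of formal expressions as an equivalence relation. -/
def homSetoid (a b : List ℕ+) : Setoid (PreWeb k a b) where
  r f g := PreWeb.Equal f g
  iseqv := ⟨.refl, .symm, .trans⟩

/-- Morphisms `a ⟶ b` of the type P web category: formal expressions modulo the defining relations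
and the axioms of a strict monoidal `k`-linear supercategory. -/
def Hom (a b : List ℕ+) : Type u := Quotient (homSetoid k a b)

end

variable {k : Type u} [CommRing k] [Invertible (2 : k)]

/-- The morphism represented by a formal expression. -/
def Hom.mk {a b : List ℕ+} (f : PreWeb k a b) : Hom k a b := Quotient.mk (homSetoid k a b) f

theorem Hom.sound {a b : List ℕ+} {f g : PreWeb k a b} (h : PreWeb.Equal f g) :
    Hom.mk f = Hom.mk g := Quotient.sound (s := homSetoid k a b) h

theorem Hom.exact {a b : List ℕ+} {f g : PreWeb k a b} (h : Hom.mk f = Hom.mk g) :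
    PreWeb.Equal f g := Quotient.exact (s := homSetoid k a b) h

theorem Hom.exists_rep {a b : List ℕ+} (f : Hom k a b) : ∃ f' : PreWeb k a b, Hom.mk f' = f :=
  Quotient.exists_rep f

instance (a b : List ℕ+) : Zero (Hom k a b) := ⟨.mk (.zero a b)⟩

instance (a b : List ℕ+) : Add (Hom k a b) :=
  ⟨Quotient.map₂ PreWeb.add fun _ _ h _ _ h' => PreWeb.Equal.add h h'⟩

instance (a b : List ℕ+) : SMul k (Hom k a b) :=
  ⟨fun x => Quotient.map (PreWeb.smul x) fun _ _ h => PreWeb.Equal.smul x h⟩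

instance (a b : List ℕ+) : Neg (Hom k a b) := ⟨fun f => (-1 : k) • f⟩

/-- Composition of morphisms (first `f`, then `g`). -/
def Hom.comp {a b c : List ℕ+} (f : Hom k a b) (g : Hom k b c) : Hom k a c :=
  Quotient.map₂ PreWeb.comp (fun _ _ h _ _ h' => PreWeb.Equal.comp h h') f g

/-- Tensor product (horizontal concatenation) of morphisms. -/
def Hom.tensor {a a' b b' : List ℕ+} (f : Hom k a a') (g : Hom k b b') :
    Hom k (a ++ b) (a' ++ b') :=
  Quotient.map₂ PreWeb.tensor (fun _ _ h _ _ h' => PreWeb.Equal.tensor h h') f g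

theorem Hom.add_zero' {a b : List ℕ+} (f : Hom k a b) : f + 0 = f := by
  obtain ⟨f, rfl⟩ := f.exists_rep
  exact Hom.sound (.add_zero f)

theorem Hom.add_comm' {a b : List ℕ+} (f g : Hom k a b) : f + g = g + f := by
  obtain ⟨f, rfl⟩ := f.exists_rep
  obtain ⟨g, rfl⟩ := g.exists_rep
  exact Hom.sound (.add_comm f g)

theorem Hom.zero_smul' {a b : List ℕ+} (f : Hom k a b) : (0 : k) • f = 0 := by
  obtain ⟨f, rfl⟩ := f.exists_rep
  exact Hom.sound (.zero_smul f)

theorem Hom.one_smul' {a b : List ℕ+} (f : Hom k a b) : (1 : k) • f = f := by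
  obtain ⟨f, rfl⟩ := f.exists_rep
  exact Hom.sound (.one_smul f)

theorem Hom.add_smul' {a b : List ℕ+} (x y : k) (f : Hom k a b) :
    (x + y) • f = x • f + y • f := by
  obtain ⟨f, rfl⟩ := f.exists_rep
  exact Hom.sound (.add_smul x y f)

theorem Hom.mul_smul' {a b : List ℕ+} (x y : k) (f : Hom k a b) :
    (x * y) • f = x • y • f := by
  obtain ⟨f, rfl⟩ := f.exists_rep
  exact Hom.sound (.mul_smul x y f)

instance (a b : List ℕ+) : AddCommGroup (Hom k a b) where
  add_assoc f g h := by
    obtain ⟨f, rfl⟩ := f.exists_rep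
    obtain ⟨g, rfl⟩ := g.exists_rep
    obtain ⟨h, rfl⟩ := h.exists_rep
    exact Hom.sound (.add_assoc f g h)
  zero_add f := by rw [Hom.add_comm', Hom.add_zero']
  add_zero := Hom.add_zero'
  add_comm := Hom.add_comm'
  neg_add_cancel f := by
    have h := Hom.add_smul' (-1) 1 f
    rw [Hom.one_smul', neg_add_cancel, Hom.zero_smul'] at h
    exact h.symm
  nsmul := nsmulRec
  zsmul := zsmulRec

instance (a b : List ℕ+) : Module k (Hom k a b) where
  one_smul := Hom.one_smul'
  mul_smul := Hom.mul_smul'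
  smul_zero x := by
    have h := Hom.mul_smul' x 0 (0 : Hom k a b)
    rw [mul_zero, Hom.zero_smul'] at h
    exact h.symm
  smul_add x f g := by
    obtain ⟨f, rfl⟩ := f.exists_rep
    obtain ⟨g, rfl⟩ := g.exists_rep
    exact Hom.sound (.smul_add x f g)
  add_smul := Hom.add_smul'
  zero_smul := Hom.zero_smul'

instance : Category (PWeb k) where
  Hom a b := Hom k a.word b.word
  id a := Hom.mk (.id a.word)
  comp f g := Hom.comp f g
  id_comp f := by
    obtain ⟨f, rfl⟩ := Hom.exists_rep f
    exact Hom.sound (.id_comp f)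
  comp_id f := by
    obtain ⟨f, rfl⟩ := Hom.exists_rep f
    exact Hom.sound (.comp_id f)
  assoc f g h := by
    obtain ⟨f, rfl⟩ := Hom.exists_rep f
    obtain ⟨g, rfl⟩ := Hom.exists_rep g
    obtain ⟨h, rfl⟩ := Hom.exists_rep h
    exact Hom.sound (.comp_assoc f g h)

instance (a b : PWeb k) : AddCommGroup (a ⟶ b) := inferInstanceAs (AddCommGroup (Hom k a.word b.word))

instance (a b : PWeb k) : Module k (a ⟶ b) := 
  inferInstanceAs (Module k (Hom k a.word b.word))

instance : Preadditive (PWeb k) where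
  add_comp _ _ _ f f' g := by
    obtain ⟨f, rfl⟩ := Hom.exists_rep f
    obtain ⟨f', rfl⟩ := Hom.exists_rep f'
    obtain ⟨g, rfl⟩ := Hom.exists_rep g
    exact Hom.sound (.add_comp f f' g)
  comp_add _ _ _ f g g' := by
    obtain ⟨f, rfl⟩ := Hom.exists_rep f
    obtain ⟨g, rfl⟩ := Hom.exists_rep g
    obtain ⟨g', rfl⟩ := Hom.exists_rep g'
    exact Hom.sound (.comp_add f g g')

instance : Linear k (PWeb k) where
  smul_comp _ _ _ x f g := by
    obtain ⟨f, rfl⟩ := Hom.exists_rep f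
    obtain ⟨g, rfl⟩ := Hom.exists_rep g
    exact Hom.sound (.smul_comp x f g)
  comp_smul _ _ _ f x g := by
    obtain ⟨f, rfl⟩ := Hom.exists_rep f
    obtain ⟨g, rfl⟩ := Hom.exists_rep g
    exact Hom.sound (.comp_smul x f g)

/-- The morphism of `PWeb k` represented by a formal expression. -/
def ofPreWeb {a b : List ℕ+} (f : PreWeb k a b) : (⟨a⟩ : PWeb k) ⟶ ⟨b⟩ := Hom.mk f

theorem ofPreWeb_cast {a a' b b' : List ℕ+} (ha : a = a') (hb : b = b') (f : PreWeb k a b) :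
    ofPreWeb (f.cast ha hb) =
      eqToHom (congrArg PWeb.mk ha.symm) ≫ ofPreWeb f ≫ eqToHom (congrArg PWeb.mk hb) := by
  subst ha hb
  simp [PreWeb.cast]

theorem ofPreWeb_of_equal_cast {a a' b b' : List ℕ+} (ha : a = a') (hb : b = b')
    {f : PreWeb k a b} {g : PreWeb k a' b'} (h : PreWeb.Equal (f.cast ha hb) g) :
    ofPreWeb f =
      eqToHom (congrArg PWeb.mk ha) ≫ ofPreWeb g ≫ eqToHom (congrArg PWeb.mk hb.symm) := by
  subst ha hb
  simp only [eqToHom_refl, Category.comp_id, Category.id_comp]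
  exact Hom.sound h

/-- The concatenation of objects. -/
def tensorObj (a b : PWeb k) : PWeb k := ⟨a.word ++ b.word⟩

/-- The tensor product of morphisms, as a bilinear map. -/
def tensorHom {a a' b b' : PWeb k} :
    (a ⟶ a') →ₗ[k] (b ⟶ b') →ₗ[k] (tensorObj a b ⟶ tensorObj a' b') :=
  LinearMap.mk₂ k (fun f g => Hom.tensor f g)
    (fun f f' g => by
      obtain ⟨f, rfl⟩ := Hom.exists_rep f
      obtain ⟨f', rfl⟩ := Hom.exists_rep f'
      obtain ⟨g, rfl⟩ := Hom.exists_rep g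
      exact Hom.sound (.add_tensor f f' g))
    (fun x f g => by
      obtain ⟨f, rfl⟩ := Hom.exists_rep f
      obtain ⟨g, rfl⟩ := Hom.exists_rep g
      exact Hom.sound (.smul_tensor x f g))
    (fun f g g' => by
      obtain ⟨f, rfl⟩ := Hom.exists_rep f
      obtain ⟨g, rfl⟩ := Hom.exists_rep g
      obtain ⟨g', rfl⟩ := Hom.exists_rep g'
      exact Hom.sound (.tensor_add f g g'))
    (fun x f g => by
      obtain ⟨f, rfl⟩ := Hom.exists_rep f
      obtain ⟨g, rfl⟩ := Hom.exists_rep g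
      exact Hom.sound (.tensor_smul x f g))

/-- The submodule of morphisms of the given parity: those represented by an expression of that
parity. -/
def parity (a b : PWeb k) (p : ZMod 2) : Submodule k (a ⟶ b) where
  carrier := {f | ∃ f' : PreWeb k a.word b.word, f'.HasParity p ∧ Hom.mk f' = f}
  add_mem' := by
    rintro _ _ ⟨f, hf, rfl⟩ ⟨g, hg, rfl⟩
    exact ⟨f.add g, .add hf hg, rfl⟩
  zero_mem' := ⟨.zero _ _, .zero _ _ p, rfl⟩
  smul_mem' := by
    rintro x _ ⟨f, hf, rfl⟩
    exact ⟨.smul x f, .smul x hf, rfl⟩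

theorem mk_bar_of_hasParity {a b : List ℕ+} {f : PreWeb k a b} {p : ZMod 2}
    (hf : f.HasParity p) : Hom.mk f.bar = koszulSign k 1 p • Hom.mk f := by
  have key : ∀ p q : ZMod 2, koszulSign k 1 p * koszulSign k 1 q = koszulSign k 1 (p + q) := by
    have h : ∀ p q : ZMod 2, (p = 0 ∨ p = 1) ∧ (q = 0 ∨ q = 1) := by decide
    intro p q
    obtain ⟨rfl | rfl, rfl | rfl⟩ := h p q <;>
      simp [koszulSign, ZMod.val_one, show (1 + 1 : ZMod 2) = 0 from by decide]
  have h0 : koszulSign k 1 0 = 1 := by simp [koszulSign]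
  have h1 : koszulSign k 1 1 = -1 := by simp [koszulSign, ZMod.val_one]
  induction hf with
  | id a => rw [h0, one_smul]; rfl
  | @comp a b c f g p q _ _ ihf ihg =>
    rw [← key, mul_smul]
    refine (congrArg₂ Hom.comp ihf ihg).trans ?_
    refine (Hom.sound (.smul_comp _ f (.smul _ g))).trans ?_
    exact congrArg (koszulSign k 1 p • ·) (Hom.sound (.comp_smul _ f g))
  | @tensor a a' b b' f g p q _ _ ihf ihg =>
    rw [← key, mul_smul]
    refine (congrArg₂ Hom.tensor ihf ihg).trans ?_
    refine (Hom.sound (.smul_tensor _ f (.smul _ g))).trans ?_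
    exact congrArg (koszulSign k 1 p • ·) (Hom.sound (.tensor_smul _ f g))
  | split a b => rw [h0, one_smul]; rfl
  | merge a b => rw [h0, one_smul]; rfl
  | cap => rw [h1]; rfl
  | cup => rw [h1]; rfl
  | zero a b p => exact (smul_zero _).symm
  | add _ _ ihf ihg => exact (congrArg₂ (· + ·) ihf ihg).trans (smul_add _ _ _).symm
  | @smul a b x f p _ ih => exact (congrArg (x • ·) ih).trans (smul_comm _ _ _)

theorem equal_bar {a b : List ℕ+} {f g : PreWeb k a b} (h : PreWeb.Equal f g) :
    PreWeb.Equal f.bar g.bar := by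
  induction h with
  | rel h =>
    obtain ⟨p, hf, hg⟩ := h.hasParity
    apply Hom.exact
    rw [mk_bar_of_hasParity hf, mk_bar_of_hasParity hg, Hom.sound (.rel h)]
  | refl f => exact .refl _
  | symm _ h => exact .symm h
  | trans _ _ h h' => exact .trans h h'
  | comp _ _ h h' => exact .comp h h'
  | tensor _ _ h h' => exact .tensor h h'
  | add _ _ h h' => exact .add h h'
  | smul x _ h => exact .smul x h
  | add_assoc f g h => exact .add_assoc _ _ _
  | add_comm f g => exact .add_comm _ _
  | add_zero f => exact .add_zero _
  | smul_add x f g => exact .smul_add _ _ _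
  | add_smul x y f => exact .add_smul _ _ _
  | mul_smul x y f => exact .mul_smul _ _ _
  | one_smul f => exact .one_smul _
  | zero_smul f => exact .zero_smul _
  | id_comp f => exact .id_comp _
  | comp_id f => exact .comp_id _
  | comp_assoc f g h => exact .comp_assoc _ _ _
  | add_comp f f' g => exact .add_comp _ _ _
  | comp_add f g g' => exact .comp_add _ _ _
  | smul_comp x f g => exact .smul_comp _ _ _
  | comp_smul x f g => exact .comp_smul _ _ _
  | add_tensor f f' g => exact .add_tensor _ _ _
  | tensor_add f g g' => exact .tensor_add _ _ _
  | smul_tensor x f g => exact .smul_tensor _ _ _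
  | tensor_smul x f g => exact .tensor_smul _ _ _
  | id_tensor_id a b => exact .id_tensor_id _ _
  | super_interchange h e f g hh hg => exact .super_interchange _ _ _ _ hh.bar hg.bar
  | tensor_assoc f g h => rw [PreWeb.bar_cast]; exact .tensor_assoc _ _ _
  | unit_tensor f => exact .unit_tensor _
  | tensor_unit f => rw [PreWeb.bar_cast]; exact .tensor_unit _

/-- The parity involution on morphisms. -/
def Hom.bar {a b : List ℕ+} (f : Hom k a b) : Hom k a b :=
  Quotient.map PreWeb.bar (fun _ _ h => equal_bar h) f

theorem eq_zero_of_mem_parity {a b : PWeb k} {f : a ⟶ b}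
    (h0 : f ∈ parity a b 0) (h1 : f ∈ parity a b 1) : f = 0 := by
  obtain ⟨g, hg, hgf⟩ := h0
  obtain ⟨g', hg', hgf'⟩ := h1
  have e0 : Hom.bar f = f := by
    rw [← hgf]
    refine (mk_bar_of_hasParity hg).trans ?_
    simp [koszulSign]
  have e1 : Hom.bar f = -f := by
    rw [← hgf']
    refine (mk_bar_of_hasParity hg').trans ?_
    simp [koszulSign, ZMod.val_one]
  have e2 : (2 : k) • f = 0 := by
    rw [two_smul]
    nth_rewrite 1 [← e0]
    rw [e1, neg_add_cancel]
  calc f = (⅟2 : k) • (2 : k) • f := by rw [smul_smul, invOf_mul_self, one_smul]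
    _ = 0 := by rw [e2, smul_zero]

theorem exists_add_parity {a b : List ℕ+} (f : PreWeb k a b) :
    ∃ f₀ f₁ : PreWeb k a b, f₀.HasParity 0 ∧ f₁.HasParity 1 ∧
      PreWeb.Equal f (f₀.add f₁) := by
  have even : ∀ {a b : List ℕ+} {g : PreWeb k a b}, g.HasParity 0 →
      ∃ f₀ f₁ : PreWeb k a b, f₀.HasParity 0 ∧ f₁.HasParity 1 ∧ PreWeb.Equal g (f₀.add f₁) :=
    fun {a b g} hg => ⟨g, .zero a b, hg, .zero _ _ _, .symm (.add_zero g)⟩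
  have odd : ∀ {a b : List ℕ+} {g : PreWeb k a b}, g.HasParity 1 →
      ∃ f₀ f₁ : PreWeb k a b, f₀.HasParity 0 ∧ f₁.HasParity 1 ∧ PreWeb.Equal g (f₀.add f₁) :=
    fun {a b g} hg => ⟨.zero a b, g, .zero _ _ _, hg,
      .symm (.trans (.add_comm _ _) (.add_zero g))⟩
  have four : ∀ {a b : List ℕ+} (w x y z : PreWeb k a b),
      PreWeb.Equal ((w.add x).add (y.add z)) ((w.add z).add (x.add y)) := fun w x y z => by
    apply Hom.exact
    change (Hom.mk w + Hom.mk x) + (Hom.mk y + Hom.mk z)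
      = (Hom.mk w + Hom.mk z) + (Hom.mk x + Hom.mk y)
    abel
  induction f with
  | id a => exact even (.id a)
  | split a b => exact even (.split a b)
  | merge a b => exact even (.merge a b)
  | cap => exact odd .cap
  | cup => exact odd .cup
  | zero a b => exact even (.zero a b 0)
  | comp f g ihf ihg =>
    obtain ⟨f₀, f₁, hf₀, hf₁, hf⟩ := ihf
    obtain ⟨g₀, g₁, hg₀, hg₁, hg⟩ := ihg
    refine ⟨(f₀.comp g₀).add (f₁.comp g₁), (f₀.comp g₁).add (f₁.comp g₀),
      .add (.comp (p := 0) (q := 0) hf₀ hg₀) (.comp (p := 1) (q := 1) hf₁ hg₁),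
      .add (.comp (p := 0) (q := 1) hf₀ hg₁) (.comp (p := 1) (q := 0) hf₁ hg₀), ?_⟩
    refine .trans (.comp hf hg) (.trans (.add_comp _ _ _) ?_)
    exact .trans (.add (.comp_add _ _ _) (.comp_add _ _ _)) (four _ _ _ _)
  | tensor f g ihf ihg =>
    obtain ⟨f₀, f₁, hf₀, hf₁, hf⟩ := ihf
    obtain ⟨g₀, g₁, hg₀, hg₁, hg⟩ := ihg
    refine ⟨(f₀.tensor g₀).add (f₁.tensor g₁), (f₀.tensor g₁).add (f₁.tensor g₀),
      .add (.tensor (p := 0) (q := 0) hf₀ hg₀) (.tensor (p := 1) (q := 1) hf₁ hg₁),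
      .add (.tensor (p := 0) (q := 1) hf₀ hg₁) (.tensor (p := 1) (q := 0) hf₁ hg₀), ?_⟩
    refine .trans (.tensor hf hg) (.trans (.add_tensor _ _ _) ?_)
    exact .trans (.add (.tensor_add _ _ _) (.tensor_add _ _ _)) (four _ _ _ _)
  | add f g ihf ihg =>
    obtain ⟨f₀, f₁, hf₀, hf₁, hf⟩ := ihf
    obtain ⟨g₀, g₁, hg₀, hg₁, hg⟩ := ihg
    refine ⟨f₀.add g₀, f₁.add g₁, .add hf₀ hg₀, .add hf₁ hg₁, .trans (.add hf hg) ?_⟩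
    exact .trans (.add (.refl _) (.add_comm _ _)) (.trans (four _ _ _ _) (.refl _))
  | smul x f ih =>
    obtain ⟨f₀, f₁, hf₀, hf₁, hf⟩ := ih
    exact ⟨.smul x f₀, .smul x f₁, .smul x hf₀, .smul x hf₁,
      .trans (.smul x hf) (.smul_add _ _ _)⟩

theorem parity_isInternal (a b : PWeb k) : DirectSum.IsInternal (parity a b) := by
  refine (DirectSum.isInternal_submodule_iff_isCompl (parity a b) (i := 0) (j := 1)
    (by decide) ?_).2 ⟨?_, ?_⟩
  · ext p
    have h : ∀ p : ZMod 2, p = 0 ∨ p = 1 := by decide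
    simpa using h p
  · rw [Submodule.disjoint_def]
    exact fun f h0 h1 => eq_zero_of_mem_parity h0 h1
  · rw [codisjoint_iff, eq_top_iff]
    rintro f -
    obtain ⟨f', rfl⟩ := Hom.exists_rep f
    obtain ⟨f₀, f₁, h₀, h₁, h⟩ := exists_add_parity f'
    exact Submodule.mem_sup.2 ⟨Hom.mk f₀, ⟨f₀, h₀, rfl⟩, Hom.mk f₁, ⟨f₁, h₁, rfl⟩,
      (Hom.sound h).symm⟩

instance : StrictMonoidalSupercategory k (PWeb k) where
  parity := parity
  parity_isInternal := parity_isInternal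
  id_mem a := ⟨.id _, .id _, rfl⟩
  comp_mem := by
    rintro _ _ _ _ _ _ _ ⟨f, hf, rfl⟩ ⟨g, hg, rfl⟩
    exact ⟨f.comp g, .comp hf hg, rfl⟩
  unitObj := ⟨[]⟩
  tensorObj := tensorObj
  tensorHom := tensorHom
  tensorHom_mem := by
    rintro _ _ _ _ _ _ _ _ ⟨f, hf, rfl⟩ ⟨g, hg, rfl⟩
    exact ⟨f.tensor g, .tensor hf hg, rfl⟩
  id_tensorHom_id a b := Hom.sound (.id_tensor_id _ _)
  super_interchange := by
    rintro _ _ _ _ _ _ _ _ _ e f _ ⟨h, hh, rfl⟩ ⟨g, hg, rfl⟩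
    obtain ⟨e, rfl⟩ := Hom.exists_rep e
    obtain ⟨f, rfl⟩ := Hom.exists_rep f
    exact Hom.sound (.super_interchange _ _ _ _ hh hg)
  assoc_obj a b c := congrArg PWeb.mk (List.append_assoc _ _ _)
  unit_tensorObj a := rfl
  tensorObj_unit a := congrArg PWeb.mk (List.append_nil _)
  assoc_hom := by
    intro a a' b b' c c' f g h
    obtain ⟨f, rfl⟩ := Hom.exists_rep f
    obtain ⟨g, rfl⟩ := Hom.exists_rep g
    obtain ⟨h, rfl⟩ := Hom.exists_rep h
    exact ofPreWeb_of_equal_cast _ _ (.tensor_assoc f g h)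
  unit_tensorHom f := by
    obtain ⟨f, rfl⟩ := Hom.exists_rep f
    exact ofPreWeb_of_equal_cast rfl rfl (.unit_tensor f)
  tensorHom_unit f := by
    obtain ⟨f, rfl⟩ := Hom.exists_rep f
    exact ofPreWeb_of_equal_cast _ _ (.tensor_unit f)

/-! ### The crossing morphisms -/

/-- The crossing of a strand labelled `a` with a strand labelled `b`, with strands `(a, b)` at the
bottom and `(b, a)` at the top: the sum over `s, r ≥ 0` with `s - r = a - b` of `(-1)^(a - s)` times
the ladder with a rung `s` from left to right followed by a rung `r` from right to left. -/
def strandCrossing (a b : ℕ) :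
    (⟨strand a ++ strand b⟩ : PWeb k) ⟶ ⟨strand b ++ strand a⟩ :=
  ∑ x ∈ Finset.range (a + 1) ×ˢ Finset.range (b + 1) with x.1 + b = x.2 + a,
    ((-1 : k) ^ (a - x.1)) •
      (ofPreWeb (PreWeb.rungRight x.1 a b (a - x.1) (b + x.1)) ≫
        ofPreWeb (PreWeb.rungLeft x.2 (a - x.1) (b + x.1) b a))

theorem strand_coe (a : ℕ+) : strand a = [a] := by
  obtain ⟨n, rfl⟩ := Nat.exists_eq_succ_of_ne_zero a.ne_zero |>.imp fun n (h : (a : ℕ) = n + 1) =>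
    (PNat.eq (by simp [h]) : a = n.succPNat)
  rfl

/-- The crossing of two strands with positive labels. -/
def pairCrossing (a b : ℕ+) : (⟨[a, b]⟩ : PWeb k) ⟶ ⟨[b, a]⟩ :=
  eqToHom (by rw [strand_coe, strand_coe]; rfl) ≫ strandCrossing (k := k) a b ≫
    eqToHom (by rw [strand_coe, strand_coe]; rfl)

/-- The crossing of one strand with the strands of `b`, from left to right. -/
def crossOne (a : ℕ+) : ∀ b : List ℕ+, (⟨a :: b⟩ : PWeb k) ⟶ ⟨b ++ [a]⟩
  | [] => 𝟙 _
  | b :: bs =>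
    (tensorHom (pairCrossing a b) (𝟙 (⟨bs⟩ : PWeb k)) : (⟨a :: b :: bs⟩ : PWeb k) ⟶ ⟨b :: a :: bs⟩) ≫
      (tensorHom (𝟙 (⟨[b]⟩ : PWeb k)) (crossOne a bs) : (⟨b :: a :: bs⟩ : PWeb k) ⟶ ⟨b :: (bs ++ [a])⟩)

/-- The strands of `a` cross the strands of `b`, the rightmost strand of `a` first. -/
def crossWords : ∀ a b : List ℕ+, (⟨a ++ b⟩ : PWeb k) ⟶ ⟨b ++ a⟩
  | [], b => eqToHom (by rw [List.append_nil, List.nil_append])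
  | a :: as, b =>
    (tensorHom (𝟙 (⟨[a]⟩ : PWeb k)) (crossWords as b) : (⟨a :: (as ++ b)⟩ : PWeb k) ⟶ ⟨a :: (b ++ as)⟩) ≫
      (tensorHom (crossOne a b) (𝟙 (⟨as⟩ : PWeb k)) : (⟨a :: (b ++ as)⟩ : PWeb k) ⟶ ⟨(b ++ [a]) ++ as⟩) ≫
        eqToHom (congrArg PWeb.mk (List.append_assoc b [a] as))

/-- The crossing morphism `a ⊗ b ⟶ b ⊗ a` of two general objects: every strand of `a` crosses every
strand of `b` once. -/
def crossing (a b : PWeb k) :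
    StrictMonoidalSupercategory.tensorObj k a b ⟶ StrictMonoidalSupercategory.tensorObj k b a :=
  crossWords a.word b.word

end PWeb

/-! On two neighbouring strands the rungs `E^(r)` and `F^(s)` behave like the divided powers of
`gl_2`, and the crossing is the corresponding Weyl group element. Write `e` and `f` for the sums of
all `E^(r)` and all `F^(r)`, and `h` for the sign of the left label. Then the crossing is `X = e h f
e⁻¹` (`ladderCrossing`). Since `h f h = f⁻¹`, the element `h f` is an involution, and so is its
conjugate `X` (`LadderPair.crossing_mul_self`). Binomial identities are needed only to identify this
product with the alternating sum of ladders that defines the crossing (`LadderPair.A_mul_crossing`,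
`LadderPair.crossing_weight`).

On three strands, naturality for merges amounts to `X₁ X₂ E₁^(r) = E₂^(r) X₁ X₂`, and naturality for
splits to its upside-down version, because merges and splits are rungs that move a whole strand into
or out of a neighbour. Summed over `r`, the claim becomes `X₂ e₁ X₂ = X₁ e₂ X₁`
(`LadderTriple.crossing_conj_exp`). Both sides preserve the label of the middle strand, so it
suffices to compare their diagonal blocks. The factors `e` and `f` are unipotent triangular for the
middle label, and the divided-power Serre relations say that `e₂⁻¹ e₁ e₂` and `e₁⁻¹ e₂ e₁` are
triangular too; the blocks can then be read off. The Serre relations follow from web associativity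
and the vanishing of certain alternating sums of two-strand ladders. To apply this algebra, webs
with three strands of total label `n` at the top are collected in `LadderSpace`, on which rungs act
by composition. Applying an operator identity to the identity web gives back an identity of webs.

For the cap, the crossing of a strand `c ≥ 1` with a strand `1` is a difference of two ladders, so
the relations between caps and rungs apply. The case of three strands `1` is a linear algebra
argument with the braid relation that ends with a division by `2` (`eq_of_braid`, `Xt_cap_one_one`).
In general the antenna terms cancel in pairs and the rest reduces to that case (`Xt_cap`). The cup
follows from the cap by straightening (`crossNatural_cup`).

Naturality past a single strand is stable under composition, tensor products and linear
combinations, hence holds for every morphism (`crossNatural`). The hexagons come from the order in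
which the crossings of words are performed. Naturality in the second factor follows by inverting the
crossing, and the sign in the joint naturality comes from the super-interchange law alone
(`tens_comp_crossWords`). -/

section

/-! ### Divided powers on two strands and the operator that exchanges them. -/

open Finset

/-- The sign `(-1)^a` of an integer. -/
def intSign (a : ℤ) : ℤ := (a.negOnePow : ℤ)

theorem intSign_add (a b : ℤ) : intSign (a + b) = intSign a * intSign b := by
  simp [intSign, Int.negOnePow_add]

theorem intSign_neg (a : ℤ) : intSign (-a) = intSign a := by simp [intSign]

theorem intSign_sub (a b : ℤ) : intSign (a - b) = intSign a * intSign b := by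
  rw [sub_eq_add_neg, intSign_add, intSign_neg]

theorem intSign_mul_self (a : ℤ) : intSign a * intSign a = 1 := by
  rw [← intSign_sub, sub_self]; simp [intSign]

theorem intSign_zero : intSign 0 = 1 := by simp [intSign]

theorem intSign_natCast (n : ℕ) : intSign n = (-1) ^ n := Int.coe_negOnePow_natCast n

theorem choose_neg_eq (x : ℤ) (t : ℕ) :
    Ring.choose (-(x + 1)) t = (-1) ^ t * Ring.choose (x + t) t := by
  rw [Ring.choose_neg, Int.negOnePow_def, Units.smul_def]
  congr 1
  congr 1; ring

/-- Vandermonde convolution of `-(x+1)` and `x`. -/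
theorem sum_choose_mul_choose (x : ℤ) (q : ℕ) :
    ∑ t ∈ range (q + 1), (-1) ^ t * (Ring.choose (x + t) t * Ring.choose x (q - t)) =
      (-1) ^ q := by
  have h := Ring.add_choose_eq q (Commute.all (-(x + 1)) x)
  rw [Finset.Nat.sum_antidiagonal_eq_sum_range_succ
    (fun i j => Ring.choose (-(x + 1)) i * Ring.choose x j)] at h
  have h1 : -(x + 1) + x = -(0 + 1) := by ring
  rw [h1, choose_neg_eq] at h
  rw [zero_add, Ring.choose_natCast, Nat.choose_self, Nat.cast_one, mul_one] at h
  rw [h]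
  exact Finset.sum_congr rfl fun t _ => by rw [choose_neg_eq, mul_assoc]

theorem sum_neg_one_pow_mul_choose (n : ℕ) (hn : n ≠ 0) :
    ∑ t ∈ range (n + 1), (-1 : ℤ) ^ t * Ring.choose (n : ℤ) t = 0 := by
  have := Int.alternating_sum_range_choose_of_ne hn
  rw [← this]
  exact Finset.sum_congr rfl fun t _ => by rw [Ring.choose_natCast]

section Shift

variable {R : Type*} [AddCommGroup R]

/-- Nothing is lost under the shift because `ψ` vanishes below `0` and above `M - t`. The rung swap
lowers the label of a rung by `t`, and this absorbs the change into the summation index. -/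
theorem sum_range_shift (M t : ℕ) : ∀ (ψ : ℤ → R), (∀ s < 0, ψ s = 0) →
    (∀ s : ℤ, M < s + t → ψ s = 0) →
      ∑ s ∈ range (M + 1), ψ (s - t) = ∑ s ∈ range (M + 1), ψ s := by
  induction t with
  | zero => intro ψ _ _; simp
  | succ t ih =>
    intro ψ hneg hbig
    have h := ih (fun s => ψ (s - 1)) (fun s hs => hneg _ (by omega))
      (fun s hs => hbig _ (by push_cast; omega))
    calc ∑ s ∈ range (M + 1), ψ (s - (t + 1 : ℕ))
        = ∑ s ∈ range (M + 1), ψ (s - t - 1) := by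
          refine Finset.sum_congr rfl fun s _ => ?_
          congr 1; push_cast; ring
      _ = ∑ s ∈ range (M + 1), ψ (s - 1) := h
      _ = ∑ s ∈ range (M + 1), ψ s := by
          rw [Finset.sum_range_succ', Finset.sum_range_succ]
          rw [hneg _ (by simp), hbig M (by push_cast; omega)]
          congr 1
          refine Finset.sum_congr rfl fun s _ => ?_
          congr 1; push_cast; ring

end Shift

/-- Divided powers `E`, `F` acting on two neighbouring strands; `A a` and `B b` are the projections
onto the parts where the labels of these strands are `a` and `b`. -/
structure LadderPair {R : Type*} [Ring R] (N : ℕ) (A B E F : ℤ → R) : Prop where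
  A_mul (a a' : ℤ) : A a * A a' = if a = a' then A a else 0
  B_mul (a a' : ℤ) : B a * B a' = if a = a' then B a else 0
  A_B (a b : ℤ) : A a * B b = B b * A a
  A_neg (a : ℤ) : a < 0 → A a = 0
  B_neg (a : ℤ) : a < 0 → B a = 0
  A_big (a : ℤ) : N < a → A a = 0
  B_big (a : ℤ) : N < a → B a = 0
  A_sum : ∑ a ∈ range (N + 1), A a = 1
  B_sum : ∑ a ∈ range (N + 1), B a = 1
  weight_big (a b : ℤ) : N < a + b → A a * B b = 0
  E_neg (r : ℤ) : r < 0 → E r = 0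
  F_neg (r : ℤ) : r < 0 → F r = 0
  E_zero : E 0 = 1
  F_zero : F 0 = 1
  E_A (r a : ℤ) : E r * A a = A (a + r) * E r
  E_B (r b : ℤ) : E r * B b = B (b - r) * E r
  F_A (r a : ℤ) : F r * A a = A (a - r) * F r
  F_B (r b : ℤ) : F r * B b = B (b + r) * F r
  E_mul (m : ℤ) (j : ℕ) : E (m - j) * E j = Ring.choose m j • E m
  F_mul (m : ℤ) (j : ℕ) : F (m - j) * F j = Ring.choose m j • F m
  swap (r s a b : ℤ) (M : ℕ) : r ≤ M ∨ s ≤ M → E r * F s * (A a * B b) =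
    ∑ t ∈ range (M + 1), Ring.choose (a - b + r - s) t • (F (s - t) * E (r - t) * (A a * B b))

namespace LadderPair

variable {R : Type*} [Ring R] {N : ℕ} {A B E F : ℤ → R} (H : LadderPair N A B E F)
include H

theorem ext_A {x y : R} (h : ∀ a, x * A a = y * A a) : x = y := by
  rw [← mul_one x, ← mul_one y, ← H.A_sum, Finset.mul_sum, Finset.mul_sum]
  exact Finset.sum_congr rfl fun a _ => h a

theorem ext_B {x y : R} (h : ∀ a, x * B a = y * B a) : x = y := by
  rw [← mul_one x, ← mul_one y, ← H.B_sum, Finset.mul_sum, Finset.mul_sum]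
  exact Finset.sum_congr rfl fun a _ => h a

theorem E_big (r : ℤ) (hr : N < r) : E r = 0 := by
  refine H.ext_A fun a => ?_
  rw [H.E_A, zero_mul]
  by_cases h : a < 0
  · rw [← H.E_A, H.A_neg a h, mul_zero]
  · rw [H.A_big _ (by omega), zero_mul]

theorem E_mul_weight_eq_zero (r a b : ℤ) (h : b < r ∨ a + r < 0) : E r * (A a * B b) = 0 := by
  rcases h with h | h
  · rw [H.A_B, ← mul_assoc, H.E_B, H.B_neg _ (by omega), zero_mul, zero_mul]
  · rw [← mul_assoc, H.E_A, H.A_neg _ (by omega), zero_mul, zero_mul]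

theorem F_mul_weight_eq_zero (r a b : ℤ) (h : a < r ∨ b + r < 0) : F r * (A a * B b) = 0 := by
  rcases h with h | h
  · rw [← mul_assoc, H.F_A, H.A_neg _ (by omega), zero_mul, zero_mul]
  · rw [H.A_B, ← mul_assoc, H.F_B, H.B_neg _ (by omega), zero_mul, zero_mul]

theorem E_weight (r a b : ℤ) : E r * (A a * B b) = A (a + r) * B (b - r) * E r := by
  rw [← mul_assoc, H.E_A, mul_assoc, H.E_B, mul_assoc]

theorem F_weight (r a b : ℤ) : F r * (A a * B b) = A (a - r) * B (b + r) * F r := by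
  rw [← mul_assoc, H.F_A, mul_assoc, H.F_B, mul_assoc]

/-- The reverse of the rung swap relation. -/
theorem swap_FE (r s a b : ℤ) (M : ℕ) (hM : r ≤ M ∨ s ≤ M) : F r * E s * (A b * B a) =
    ∑ t ∈ range (M + 1), Ring.choose (a - b + r - s) t • (E (s - t) * F (r - t) * (A b * B a)) := by
  set D := a - b + r - s with hD
  -- Each term on the right is expanded once more by `swap`, now with top entry `-D`. Collecting
  -- terms by `n = t + u`, Vandermonde turns the coefficients into `choose 0 n`, so only `n = 0`
  -- survives.
  have h1 : ∀ t ∈ range (M + 1), Ring.choose D t • (E (s - t) * F (r - t) * (A b * B a)) =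
      ∑ u ∈ range (M + 1 - t), (Ring.choose D t * Ring.choose (-D) u) •
        (F (r - (t + u : ℕ)) * E (s - (t + u : ℕ)) * (A b * B a)) := by
    intro t _
    rw [H.swap _ _ _ _ M (by omega), Finset.smul_sum]
    symm
    refine Finset.sum_subset_zero_on_sdiff (by simp) ?_ ?_
    · intro u hu
      simp only [mem_sdiff, mem_range] at hu
      rcases hM with hM | hM
      · rw [H.F_neg _ (by omega), zero_mul, zero_mul, smul_zero, smul_zero]
      · rw [H.E_neg (s - t - u) (by omega), mul_zero, zero_mul, smul_zero, smul_zero]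
    · intro u _
      rw [smul_smul]
      congr 2
      · congr 1; rw [hD]; ring_nf
      · congr 2 <;> (push_cast; ring)
  rw [Finset.sum_congr rfl h1, ← Finset.sum_range_diag_flip]
  have h2 : ∀ n ∈ range (M + 1), ∑ t ∈ range (n + 1), (Ring.choose D t * Ring.choose (-D) (n - t)) •
        (F (r - (t + (n - t) : ℕ)) * E (s - (t + (n - t) : ℕ)) * (A b * B a)) =
      Ring.choose (0 : ℤ) n • (F (r - n) * E (s - n) * (A b * B a)) := by
    intro n _
    have h3 := Ring.add_choose_eq n (Commute.all D (-D))
    rw [add_neg_cancel, Finset.Nat.sum_antidiagonal_eq_sum_range_succ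
      (fun i j => Ring.choose D i * Ring.choose (-D) j)] at h3
    rw [h3, Finset.sum_smul]
    refine Finset.sum_congr rfl fun t ht => ?_
    rw [mem_range] at ht
    rw [Nat.add_sub_cancel' (by omega)]
  rw [Finset.sum_congr rfl h2, Finset.sum_range_succ']
  simp [Ring.choose_zero_succ]

/-- Reflection in a vertical line exchanges the strands and the two kinds of rungs, and carries the
swap relation to its reverse. Statements about `E` thereby yield statements about `F`. -/
theorem mirror : LadderPair N B A F E where
  A_mul := H.B_mul
  B_mul := H.A_mul
  A_B a b := (H.A_B b a).symm
  A_neg := H.B_neg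
  B_neg := H.A_neg
  A_big := H.B_big
  B_big := H.A_big
  A_sum := H.B_sum
  weight_big a b h := by rw [← H.A_B]; exact H.weight_big b a (by omega)
  B_sum := H.A_sum
  E_neg := H.F_neg
  F_neg := H.E_neg
  E_zero := H.F_zero
  F_zero := H.E_zero
  E_A := H.F_B
  E_B := H.F_A
  F_A := H.E_B
  F_B := H.E_A
  E_mul := H.F_mul
  F_mul := H.E_mul
  swap r s a b M hM := by rw [← H.A_B]; exact H.swap_FE r s a b M hM

/-- The ladders with `s` and `s + k` rungs on the weight `(a, b)` cancel if `k > b - a`. -/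
theorem sum_ladder_eq_zero (a b k : ℤ) (hk : b - a < k) (M : ℕ) (hM : a ≤ M) :
    ∑ s ∈ range (M + 1), intSign s • (E (s + k) * F s * (A a * B b)) = 0 := by
  -- The rung swap has the same top entry `D = a - b + k` for every `s`, and `D > 0` by hypothesis.
  -- After the shift by `t` the ladders no longer involve `t`, and the factor `Σ (-1)^t choose D t =
  -- 0` splits off.
  obtain ⟨D, hD⟩ : ∃ D : ℕ, (D : ℤ) = a - b + k := ⟨(a - b + k).toNat, by omega⟩
  let ψ : ℕ → ℤ → R := fun t s =>
    (intSign (s + t) * Ring.choose (D : ℤ) t) • (F s * E (s + k) * (A a * B b))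
  have h1 : ∀ s ∈ range (M + 1), intSign s • (E (s + k) * F s * (A a * B b)) =
      ∑ t ∈ range (D + 1), ψ t (s - t) := by
    intro s _
    have h2 : ∀ T : ℕ, D ≤ T → ∑ t ∈ range (D + 1), ψ t (s - t) = ∑ t ∈ range (T + 1), ψ t (s - t) := by
      intro T hT
      refine Finset.sum_subset (by simpa using hT) fun t _ ht => ?_
      simp only [mem_range, not_lt] at ht
      simp only [ψ]
      rw [Ring.choose_natCast, Nat.choose_eq_zero_of_lt (by omega)]
      simp
    rw [h2 (max D s) (le_max_left _ _), H.swap _ _ _ _ (max D s) (by right; simp), Finset.smul_sum]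
    refine Finset.sum_congr rfl fun t _ => ?_
    simp only [ψ]
    rw [smul_smul, sub_add_cancel, show a - b + ((s : ℤ) + k) - s = D by omega,
      add_sub_right_comm]
  rw [Finset.sum_congr rfl h1, Finset.sum_comm]
  have h3 : ∀ t ∈ range (D + 1), ∑ s ∈ range (M + 1), ψ t (s - t) =
      ((-1 : ℤ) ^ t * Ring.choose (D : ℤ) t) • ∑ s ∈ range (M + 1),
        intSign s • (F s * E (s + k) * (A a * B b)) := by
    intro t ht
    rw [mem_range] at ht
    rw [sum_range_shift M t (ψ t), Finset.smul_sum]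
    · refine Finset.sum_congr rfl fun s _ => ?_
      simp only [ψ]
      rw [smul_smul, intSign_add, intSign_natCast t]
      congr 1; ring
    · intro s hs; simp only [ψ]; rw [H.F_neg s hs]; simp
    · intro s hs; simp only [ψ]
      rw [mul_assoc, H.E_mul_weight_eq_zero _ _ _ (by left; omega)]; simp
  rw [Finset.sum_congr rfl h3, ← Finset.sum_smul, sum_neg_one_pow_mul_choose D (by omega), zero_smul]

/-- Moving `E^(q)` to the left past `F^(s)` and fusing it with the other `E` gives the product of
binomials in `sum_choose_mul_choose` at `x = k + s`, whose alternating sum is `(-1)^q`. It covers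
the range `k ≤ b - a` that `sum_ladder_eq_zero` leaves out. -/
theorem sum_ladder_mul_E (a b k : ℤ) (q : ℕ) (hq : (q : ℤ) = b - a - k) (M : ℕ) (hM : a + q ≤ M) :
    ∑ s ∈ range (M + 1), intSign s • (E (s + k - q) * F s * E q * (A a * B b)) =
      intSign q • ∑ s ∈ range (M + 1), intSign s • (E (s + k) * F s * (A a * B b)) := by
  let ψ : ℕ → ℤ → R := fun t s =>
    (intSign (s + t) * (Ring.choose (k + s + t) t * Ring.choose (k + s) (q - t))) •
      (E (s + k) * F s * (A a * B b))
  have h1 : ∀ s ∈ range (M + 1), intSign s • (E (s + k - q) * F s * E q * (A a * B b)) =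
      ∑ t ∈ range (q + 1), ψ t (s - t) := by
    intro s _
    rw [mul_assoc (E _), mul_assoc (E _), H.swap_FE _ _ _ _ q (by right; simp), Finset.mul_sum,
      Finset.smul_sum]
    refine Finset.sum_congr rfl fun t ht => ?_
    rw [mem_range] at ht
    have h2 := H.E_mul (s + k - t) (q - t)
    rw [Nat.cast_sub (by omega)] at h2
    simp only [ψ]
    rw [mul_smul_comm, ← mul_assoc, ← mul_assoc (E _) (E _), show (s + k - q : ℤ) = s + k - t - (q - t) by ring,
      h2, smul_mul_assoc, smul_mul_assoc, smul_smul, smul_smul, sub_add_cancel,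
      show b - a + s - q = s + k by omega, show k + ((s : ℤ) - t) = s + k - t by ring,
      sub_add_cancel, add_sub_right_comm, mul_assoc]
  rw [Finset.sum_congr rfl h1, Finset.sum_comm]
  have h3 : ∀ t ∈ range (q + 1), ∑ s ∈ range (M + 1), ψ t (s - t) = ∑ s ∈ range (M + 1), ψ t s := by
    intro t ht
    rw [mem_range] at ht
    refine sum_range_shift M t (ψ t) ?_ ?_
    · intro s hs; simp only [ψ]; rw [H.F_neg s hs]; simp
    · intro s hs; simp only [ψ]
      rw [mul_assoc, H.F_mul_weight_eq_zero _ _ _ (by left; omega)]; simp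
  rw [Finset.sum_congr rfl h3, Finset.sum_comm, Finset.smul_sum]
  refine Finset.sum_congr rfl fun s _ => ?_
  simp only [ψ]
  rw [← Finset.sum_smul, smul_smul]
  congr 1
  rw [intSign_natCast q, ← sum_choose_mul_choose (k + s) q, Finset.sum_mul]
  refine Finset.sum_congr rfl fun t _ => ?_
  rw [intSign_add, intSign_natCast t]
  ring

variable (N) in
/-- The sum of all divided powers. -/
def _root_.dividedExp (E : ℤ → R) : R := ∑ r ∈ range (N + 1), E r

variable (N) in
/-- The alternating sum of all divided powers. -/
def _root_.dividedExpNeg (E : ℤ → R) : R := ∑ r ∈ range (N + 1), intSign r • E r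

variable (N) in
/-- The sign of the label. -/
def _root_.labelSign (A : ℤ → R) : R := ∑ a ∈ range (N + 1), intSign a • A a

theorem labelSign_mul (a : ℤ) : labelSign N A * A a = intSign a • A a := by
  rw [labelSign, Finset.sum_mul]
  simp only [smul_mul_assoc, H.A_mul]
  by_cases h : 0 ≤ a ∧ a ≤ N
  · obtain ⟨n, rfl⟩ := Int.eq_ofNat_of_zero_le h.1
    rw [Finset.sum_eq_single n]
    · simp
    · intro m _ hm; rw [if_neg (by simpa using hm), smul_zero]
    · intro hn; simp at hn; omega
  · have : A a = 0 := by
      rcases not_and_or.1 h with h | h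
      · exact H.A_neg _ (by omega)
      · exact H.A_big _ (by omega)
    rw [this, smul_zero]
    refine Finset.sum_eq_zero fun m _ => ?_
    split_ifs with h1
    · rw [h1, this, smul_zero]
    · rw [smul_zero]

theorem labelSign_mul_self : labelSign N A * labelSign N A = 1 := by
  refine H.ext_A fun a => ?_
  rw [mul_assoc, H.labelSign_mul, mul_smul_comm, H.labelSign_mul, smul_smul, intSign_mul_self,
    one_smul, one_mul]

theorem labelSign_mul_E (r : ℤ) : labelSign N A * E r = intSign r • (E r * labelSign N A) := by
  refine H.ext_A fun a => ?_
  rw [mul_assoc, H.E_A, ← mul_assoc, H.labelSign_mul, smul_mul_assoc, smul_mul_assoc, mul_assoc,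
    H.labelSign_mul, mul_smul_comm, smul_smul, H.E_A, intSign_add, mul_comm]

theorem labelSign_mul_F (r : ℤ) : labelSign N A * F r = intSign r • (F r * labelSign N A) := by
  refine H.ext_A fun a => ?_
  rw [mul_assoc, H.F_A, ← mul_assoc, H.labelSign_mul, smul_mul_assoc, smul_mul_assoc, mul_assoc,
    H.labelSign_mul, mul_smul_comm, smul_smul, H.F_A, intSign_sub, mul_comm]

theorem labelSign_conj_E :
    labelSign N A * dividedExp N E * labelSign N A = dividedExpNeg N E := by
  rw [dividedExp, dividedExpNeg, Finset.mul_sum, Finset.sum_mul]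
  refine Finset.sum_congr rfl fun r _ => ?_
  rw [H.labelSign_mul_E, smul_mul_assoc, mul_assoc, H.labelSign_mul_self, mul_one]

theorem labelSign_conj_F :
    labelSign N A * dividedExp N F * labelSign N A = dividedExpNeg N F := by
  rw [dividedExp, dividedExpNeg, Finset.mul_sum, Finset.sum_mul]
  refine Finset.sum_congr rfl fun r _ => ?_
  rw [H.labelSign_mul_F, smul_mul_assoc, mul_assoc, H.labelSign_mul_self, mul_one]

/-- Each product is `choose m j` times `E^(m)`, and alternating sums of binomials vanish unless `m =
0`. This is the homogeneous part of degree `m` of the statement that `dividedExpNeg` inverts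
`dividedExp`. -/
theorem sum_E_mul_E (m : ℤ) :
    ∑ j ∈ range (N + 1), intSign j • (E (m - j) * E j) = if m = 0 then 1 else 0 := by
  have h1 : ∀ j : ℕ, intSign j • (E (m - j) * E j) = (intSign j * Ring.choose m j) • E m :=
    fun j => by rw [H.E_mul, smul_smul]
  simp only [h1]
  by_cases h0 : m < 0
  · rw [if_neg (by omega), H.E_neg m h0]; simp
  by_cases hN : N < m
  · rw [if_neg (by omega), H.E_big m hN]; simp
  obtain ⟨n, rfl⟩ := Int.eq_ofNat_of_zero_le (not_lt.1 h0)
  rw [← Finset.sum_smul]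
  have h2 : ∑ j ∈ range (N + 1), intSign j * Ring.choose (n : ℤ) j =
      ∑ j ∈ range (n + 1), (-1) ^ j * Ring.choose (n : ℤ) j := by
    simp only [intSign_natCast]
    symm
    refine Finset.sum_subset (by intro x; simp; omega) fun t _ ht => ?_
    simp only [mem_range, not_lt] at ht
    rw [Ring.choose_natCast, Nat.choose_eq_zero_of_lt (by omega)]
    simp
  rw [h2]
  rcases eq_or_ne n 0 with rfl | hn
  · simp [H.E_zero]
  · rw [sum_neg_one_pow_mul_choose n hn, if_neg (by omega), zero_smul]

theorem sum_range_ite_E (x : ℤ) : ∑ r ∈ range (N + 1), (if x = r then E r else 0) = E x := by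
  by_cases h : 0 ≤ x ∧ x ≤ N
  · obtain ⟨n, rfl⟩ := Int.eq_ofNat_of_zero_le h.1
    rw [Finset.sum_eq_single n]
    · simp
    · intro m _ hm; rw [if_neg (by simpa using hm.symm)]
    · intro hn; simp at hn; omega
  · have h2 : E x = 0 := by
      rcases not_and_or.1 h with h | h
      · exact H.E_neg _ (by omega)
      · exact H.E_big _ (by omega)
    rw [h2]
    refine Finset.sum_eq_zero fun r _ => ?_
    split_ifs with h1
    · rw [← h1, h2]
    · rfl

/-- Compressing the sum of all divided powers between two labels leaves one term. -/
theorem A_mul_exp_mul_A (c a : ℤ) : A c * dividedExp N E * A a = E (c - a) * A a := by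
  rw [dividedExp, Finset.mul_sum, Finset.sum_mul, ← H.sum_range_ite_E (c - a), Finset.sum_mul]
  refine Finset.sum_congr rfl fun r _ => ?_
  rw [mul_assoc, H.E_A, ← mul_assoc, H.A_mul]
  split_ifs with h1 h2 h2
  · rw [h1, ← H.E_A]
  · omega
  · omega
  · simp

theorem exp_mul_expNeg : dividedExp N E * dividedExpNeg N E = 1 := by
  refine H.ext_A fun a => ?_
  rw [← one_mul (dividedExp N E), ← H.A_sum, Finset.sum_mul, Finset.sum_mul, Finset.sum_mul]
  have : ∀ c ∈ range (N + 1), A c * dividedExp N E * dividedExpNeg N E * A a =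
      A c * if (c : ℤ) = a then 1 else 0 := by
    intro c _
    simp only [← sub_eq_zero (a := (c : ℤ))]
    rw [← H.sum_E_mul_E, dividedExpNeg, Finset.mul_sum, Finset.sum_mul, Finset.mul_sum]
    refine Finset.sum_congr rfl fun r _ => ?_
    rw [mul_smul_comm, smul_mul_assoc, mul_smul_comm, mul_assoc _ (E r), H.E_A, ← mul_assoc,
      H.A_mul_exp_mul_A, mul_assoc, ← H.E_A, ← mul_assoc, show (c - (a + r) : ℤ) = c - a - r by ring]
    congr 1
    rw [mul_assoc, H.E_A, ← mul_assoc, H.E_A, mul_assoc]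
    have h3 : a + r + (c - a - r) = (c : ℤ) := by ring
    rw [h3]
  rw [Finset.sum_congr rfl this, H.A_sum, one_mul]
  simp only [mul_ite, mul_one, mul_zero]
  by_cases h : 0 ≤ a ∧ a ≤ N
  · obtain ⟨n, rfl⟩ := Int.eq_ofNat_of_zero_le h.1
    rw [Finset.sum_eq_single n]
    · simp
    · intro m _ hm; rw [if_neg (by simpa using hm)]
    · intro hn; simp at hn; omega
  · have h2 : A a = 0 := by
      rcases not_and_or.1 h with h | h
      · exact H.A_neg _ (by omega)
      · exact H.A_big _ (by omega)
    rw [h2]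
    refine Finset.sum_eq_zero fun r _ => ?_
    split_ifs with h1
    · rw [h1, h2]
    · rfl

theorem expNeg_mul_exp : dividedExpNeg N E * dividedExp N E = 1 := by
  have h := congrArg (fun x => labelSign N A * x * labelSign N A) H.exp_mul_expNeg
  simp only [mul_one, H.labelSign_mul_self] at h
  rw [← h, ← H.labelSign_conj_E]
  simp only [mul_assoc, H.labelSign_mul_self, mul_one]

/-- Prescribing the final label `c` selects from `dividedExp N E` the one power that leads from `a -
s` to `c`. The result is a nontrivial ladder sum for many `c`; the last factor of `ladderCrossing`
is there to remove those with `c ≠ b`. -/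
theorem A_mul_exp_sign_exp (a b c : ℤ) :
    A c * (dividedExp N E * labelSign N A * dividedExp N F) * (A a * B b) =
      intSign a • ∑ s ∈ range (N + 1), intSign s • (E (s + (c - a)) * F s * (A a * B b)) := by
  conv_lhs => rw [dividedExp.eq_1 N F]
  simp only [Finset.mul_sum, Finset.sum_mul, Finset.smul_sum]
  refine Finset.sum_congr rfl fun s _ => ?_
  have h1 : A c * (dividedExp N E * labelSign N A * F s) * (A a * B b) =
      A c * dividedExp N E * (labelSign N A * A (a - s)) * (B (b + s) * F s) := by
    rw [mul_assoc (A c), mul_assoc (dividedExp N E * _), H.F_weight]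
    simp only [mul_assoc]
  rw [h1, H.labelSign_mul, mul_smul_comm, smul_mul_assoc, H.A_mul_exp_mul_A, mul_assoc (E _),
    ← mul_assoc (A (a - s)), ← H.F_weight, smul_smul, intSign_sub, ← mul_assoc,
    show (s + (c - a) : ℤ) = c - (a - s) by ring]

variable (N A E F) in
omit H in
/-- The operator that exchanges the two strands. -/
def _root_.ladderCrossing : R :=
  dividedExp N E * labelSign N A * dividedExp N F * dividedExpNeg N E

/-- The term `E^(p)` of `dividedExpNeg N E` moves the weight to `(a + p, b - p)`. There the ladder
sum vanishes if `p > b - c`; otherwise `sum_ladder_mul_E` with `q = b - c - p` turns it into a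
ladder sum independent of `p`, followed on the right by `E^(b-c-p)`. What remains of the sum over
`p` is `Σ (-1)^p E^(b-c-p) E^(p)`, which is `1` for `b = c` and `0` otherwise. -/
theorem A_mul_crossing (a b c : ℤ) :
    A c * ladderCrossing N A E F * (A a * B b) = if c = b then
      intSign a • ∑ s ∈ range (N + 1), intSign s • (E (s + (b - a)) * F s * (A a * B b)) else 0 := by
  -- The bound required by `sum_ladder_mul_E` reads `a + p + q = a + b - c ≤ N` and needs `c ≥ 0`,
  -- so negative `c` is treated apart.
  by_cases hc : c < 0
  · rw [H.A_neg c hc, zero_mul, zero_mul]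
    split_ifs with h
    · rw [H.B_neg b (by omega)]; simp
    · rfl
  have h1 : ∀ p ∈ range (N + 1), A c * (dividedExp N E * labelSign N A * dividedExp N F *
      intSign p • E p) * (A a * B b) = intSign (a + b - c) •
        ((∑ s ∈ range (N + 1), intSign s • (E (s + (2 * c - a - b)) * F s)) *
          (intSign p • (E (b - c - p) * E p)) * (A a * B b)) := by
    intro p _
    rw [mul_smul_comm, mul_smul_comm, smul_mul_assoc, ← mul_assoc (A c), mul_assoc _ (E p), H.E_weight,
      ← mul_assoc, H.A_mul_exp_sign_exp]
    by_cases hw : N < a + b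
    · rw [H.weight_big (a + p) (b - p) (by omega), H.weight_big a b hw]; simp
    by_cases hq : b - c - p < 0
    · rw [H.E_neg _ hq]
      by_cases hb : b - p < 0
      · rw [H.B_neg _ hb]; simp
      · rw [H.sum_ladder_eq_zero (a + p) (b - p) (c - (a + p)) (by omega) N (by omega)]; simp
    · obtain ⟨q, hq'⟩ : ∃ q : ℕ, (q : ℤ) = b - c - p := ⟨(b - c - p).toNat, by omega⟩
      have h2 := H.sum_ladder_mul_E (a + p) (b - p) (c - (a + p)) q (by omega) N (by omega)
      replace h2 := congrArg (fun x => intSign q • x) h2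
      simp only [smul_smul, intSign_mul_self, one_smul] at h2
      rw [← h2, ← hq']
      simp only [Finset.smul_sum, Finset.sum_mul]
      refine Finset.sum_congr rfl fun s _ => ?_
      simp only [smul_mul_assoc, mul_smul_comm, smul_smul]
      rw [mul_assoc _ _ (E p), ← H.E_weight, show (s + (c - (a + p)) - q : ℤ) = s + (2 * c - a - b) by omega]
      simp only [mul_assoc]
      congr 1
      rw [hq']
      simp only [intSign_sub, intSign_add]
      linear_combination (intSign a * intSign b * intSign c * intSign s * intSign p) *
        intSign_mul_self p
  rw [ladderCrossing, dividedExpNeg, Finset.mul_sum, Finset.mul_sum, Finset.sum_mul,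
    Finset.sum_congr rfl h1, ← Finset.smul_sum, ← Finset.sum_mul, ← Finset.mul_sum, H.sum_E_mul_E]
  by_cases h : c = b
  · subst h
    rw [if_pos (sub_self c), if_pos rfl, mul_one, Finset.sum_mul, add_sub_cancel_right]
    congr 1
    refine Finset.sum_congr rfl fun s _ => ?_
    rw [smul_mul_assoc, show 2 * c - a - c = c - a by ring]
  · rw [if_neg (by omega), if_neg h]; simp

/-- `X = e (h f) e⁻¹` is conjugate to `h f`, which is an involution because `h f h = f⁻¹`. -/
theorem crossing_mul_self : ladderCrossing N A E F * ladderCrossing N A E F = 1 := by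
  have h1 : labelSign N A * dividedExp N F * (labelSign N A * dividedExp N F) = 1 := by
    rw [← mul_assoc, H.labelSign_conj_F, H.mirror.expNeg_mul_exp]
  calc _ = dividedExp N E * (labelSign N A * dividedExp N F * (dividedExpNeg N E * dividedExp N E)
        * (labelSign N A * dividedExp N F)) * dividedExpNeg N E := by
        simp only [ladderCrossing, mul_assoc]
    _ = 1 := by rw [H.expNeg_mul_exp, mul_one, h1, mul_one, H.exp_mul_expNeg]

/-- Both sides equal `A b * X * B b`, since by `A_mul_crossing` the element `A c * X * B b` vanishes
for `c ≠ b`. -/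
theorem crossing_mul_B (b : ℤ) :
    ladderCrossing N A E F * B b = A b * ladderCrossing N A E F := by
  have h1 : ∀ c, A c * ladderCrossing N A E F * B b =
      if c = b then A c * ladderCrossing N A E F * B b else 0 := by
    intro c
    split_ifs with h
    · rfl
    · refine H.ext_A fun a => ?_
      rw [mul_assoc, ← H.A_B, H.A_mul_crossing, if_neg h, zero_mul]
  have h2 : ∀ b', A b * ladderCrossing N A E F * B b' =
      if b' = b then A b * ladderCrossing N A E F * B b' else 0 := by
    intro c
    split_ifs with h
    · rfl
    · refine H.ext_A fun a => ?_
      rw [mul_assoc, ← H.A_B, H.A_mul_crossing, if_neg (Ne.symm h), zero_mul]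
  have h3 : ladderCrossing N A E F * B b = A b * ladderCrossing N A E F * B b := by
    by_cases h : 0 ≤ b ∧ b ≤ N
    · obtain ⟨n, rfl⟩ := Int.eq_ofNat_of_zero_le h.1
      conv_lhs => rw [← one_mul (ladderCrossing N A E F), ← H.A_sum]
      rw [Finset.sum_mul, Finset.sum_mul, Finset.sum_eq_single n]
      · intro m _ hm; rw [h1, if_neg (by simpa using hm)]
      · intro hn; simp at hn; omega
    · have : B b = 0 := by
        rcases not_and_or.1 h with h | h
        · exact H.B_neg _ (by omega)
        · exact H.B_big _ (by omega)
      rw [this, mul_zero, mul_zero]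
  rw [h3]
  refine H.ext_B fun b' => ?_
  rw [h2 b', mul_assoc, H.B_mul]
  split_ifs with h h' h'
  · rw [h]
  · exact absurd h.symm h'
  · exact absurd h'.symm h
  · rw [mul_zero]

theorem crossing_mul_A (a : ℤ) :
    ladderCrossing N A E F * A a = B a * ladderCrossing N A E F := by
  have h := congrArg (fun x => ladderCrossing N A E F * x * ladderCrossing N A E F)
    (H.crossing_mul_B a)
  simp only [← mul_assoc, H.crossing_mul_self, one_mul] at h
  rw [h, mul_assoc, H.crossing_mul_self, mul_one]

/-- As `(-1)^a (-1)^s = (-1)^(a-s)` for `s ≤ a`, this is the alternating sum that defines the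
crossing of two strands. -/
theorem crossing_weight (a b : ℤ) : ladderCrossing N A E F * (A a * B b) =
    intSign a • ∑ s ∈ range (N + 1), intSign s • (E (s + (b - a)) * F s * (A a * B b)) := by
  have h := H.A_mul_crossing a b b
  rw [if_pos rfl] at h
  rw [← h, ← H.crossing_mul_B, H.A_B, mul_assoc, ← mul_assoc (B b) (B b), H.B_mul, if_pos rfl]

end LadderPair

end

/-! ### Triangularity, ladders upside down, and the exchange of three strands. -/

section

open Finset

section Triangular

variable {R : Type*} [Ring R]

/-- A complete family of orthogonal idempotents indexed by integers. -/
structure LabelProjectors (B : ℤ → R) : Prop where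
  mul (i j : ℤ) : B i * B j = if i = j then B i else 0
  complete : ∃ S : Finset ℤ, ∑ i ∈ S, B i = 1

/-- The element `x` does not lower the label. -/
def UpperTriangular (B : ℤ → R) (x : R) : Prop := ∀ i j, i < j → B i * x * B j = 0

namespace LabelProjectors

variable {B : ℤ → R} (H : LabelProjectors B)
include H

theorem neg : LabelProjectors (fun i => B (-i)) where
  mul i j := by simp [H.mul]
  complete := by
    obtain ⟨S, hS⟩ := H.complete
    refine ⟨S.map (Equiv.neg ℤ).toEmbedding, ?_⟩
    rw [Finset.sum_map, ← hS]
    simp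

theorem upper_mul {x y : R} (hx : UpperTriangular B x) (hy : UpperTriangular B y) :
    UpperTriangular B (x * y) := by
  intro i j hij
  obtain ⟨S, hS⟩ := H.complete
  rw [← mul_one x, ← hS, Finset.mul_sum, Finset.sum_mul, Finset.mul_sum, Finset.sum_mul]
  refine Finset.sum_eq_zero fun l _ => ?_
  have h : B i * (x * B l * y) * B j = (B i * x * B l) * (B l * y * B j) := by
    have := H.mul l l
    rw [if_pos rfl] at this
    conv_lhs => rw [← this]
    simp only [mul_assoc]
  rw [h]
  by_cases h1 : i < l
  · rw [hx i l h1, zero_mul]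
  · rw [hy l j (by omega), mul_zero]

/-- Neither factor lowers the label, so an intermediate label `l` contributes only if `i ≥ l` and `l
≥ i`. -/
theorem diag_mul {x y : R} (hx : UpperTriangular B x) (hy : UpperTriangular B y) (i : ℤ) :
    B i * (x * y) * B i = (B i * x * B i) * (B i * y * B i) := by
  obtain ⟨S, hS⟩ := H.complete
  have h : ∀ l, B i * (x * B l * y) * B i = (B i * x * B l) * (B l * y * B i) := by
    intro l
    have := H.mul l l
    rw [if_pos rfl] at this
    conv_lhs => rw [← this]
    simp only [mul_assoc]
  conv_lhs => rw [← mul_one x, ← hS, Finset.mul_sum, Finset.sum_mul, Finset.mul_sum, Finset.sum_mul]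
  simp only [h]
  by_cases hi : i ∈ S
  · rw [Finset.sum_eq_single_of_mem i hi]
    intro l _ hl
    rcases lt_or_gt_of_ne hl with h1 | h1
    · rw [hy l i h1, mul_zero]
    · rw [hx i l h1, zero_mul]
  · have h0 : B i = 0 := by
      rw [← mul_one (B i), ← hS, Finset.mul_sum]
      refine Finset.sum_eq_zero fun l hl => ?_
      rw [H.mul, if_neg (fun h : i = l => hi (by rw [h]; exact hl))]
    simp [h0]

theorem ext_of_commute {x y : R} (hx : ∀ i, x * B i = B i * x) (hy : ∀ i, y * B i = B i * y)
    (h : ∀ i, B i * x * B i = B i * y * B i) : x = y := by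
  obtain ⟨S, hS⟩ := H.complete
  rw [← mul_one x, ← mul_one y, ← hS, Finset.mul_sum, Finset.mul_sum]
  refine Finset.sum_congr rfl fun i _ => ?_
  have h1 := h i
  rw [← hx, ← hy, mul_assoc, mul_assoc, H.mul, if_pos rfl] at h1
  exact h1

theorem upper_of_commute {x : R} (hx : ∀ i, x * B i = B i * x) : UpperTriangular B x := by
  intro i j hij
  rw [← hx, mul_assoc, H.mul, if_neg hij.ne, mul_zero]

variable {K : ℤ → R} (hK : ∀ r b, K r * B b = B (b + r) * K r)
include hK

theorem upper_dividedExp (N : ℕ) : UpperTriangular B (dividedExp N K) := by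
  intro i j hij
  rw [dividedExp, Finset.mul_sum, Finset.sum_mul]
  refine Finset.sum_eq_zero fun r _ => ?_
  rw [mul_assoc, hK, ← mul_assoc, H.mul, if_neg (by omega), zero_mul]

theorem upper_dividedExpNeg (N : ℕ) : UpperTriangular B (dividedExpNeg N K) := by
  intro i j hij
  rw [dividedExpNeg, Finset.mul_sum, Finset.sum_mul]
  refine Finset.sum_eq_zero fun r _ => ?_
  rw [mul_smul_comm, smul_mul_assoc, mul_assoc, hK, ← mul_assoc, H.mul, if_neg (by omega), zero_mul,
    smul_zero]

theorem diag_dividedExp (N : ℕ) (h0 : K 0 = 1) (i : ℤ) : B i * dividedExp N K * B i = B i := by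
  rw [dividedExp, Finset.mul_sum, Finset.sum_mul, Finset.sum_eq_single 0]
  · simp [h0, H.mul]
  · intro r _ hr
    rw [mul_assoc, hK, ← mul_assoc, H.mul, if_neg (by omega), zero_mul]
  · simp

theorem diag_dividedExpNeg (N : ℕ) (h0 : K 0 = 1) (i : ℤ) :
    B i * dividedExpNeg N K * B i = B i := by
  rw [dividedExpNeg, Finset.mul_sum, Finset.sum_mul, Finset.sum_eq_single 0]
  · simp [h0, H.mul, intSign_zero]
  · intro r _ hr
    rw [mul_smul_comm, smul_mul_assoc, mul_assoc, hK, ← mul_assoc, H.mul, if_neg (by omega),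
      zero_mul, smul_zero]
  · simp

/-- A Serre type relation bounds the effect of a conjugation on the labels. -/
theorem conj_upper {D : ℤ → R} (hD : ∀ r b, D r * B b = B (b - r) * D r) (N : ℕ)
    (hKneg : ∀ r < 0, K r = 0) (hKbig : ∀ r : ℤ, N < r → K r = 0)
    (serre : ∀ r s : ℕ, r < s →
      ∑ p ∈ range (s + 1), intSign p • (K p * D r * K (s - p)) = 0) :
    ∀ i j, j < i → B i * (dividedExpNeg N K * dividedExp N D * dividedExp N K) * B j = 0 := by
  intro i j hij
  have hword : ∀ p r q b : ℤ, K p * D r * K q * B b = B (b + q - r + p) * (K p * D r * K q) := by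
    intro p r q b
    rw [mul_assoc (K p * D r), hK, ← mul_assoc, mul_assoc (K p) (D r), hD, ← mul_assoc (K p), hK]
    simp only [mul_assoc]
  conv_lhs => rw [dividedExp.eq_1 N D]
  simp only [Finset.mul_sum, Finset.sum_mul]
  refine Finset.sum_eq_zero fun r _ => ?_
  -- `s` is the total power of `K` that together with `D r` changes the label from `j` to `i`. Since
  -- `i > j` it exceeds `r`, which is the range of the Serre relation.
  obtain ⟨s, hs⟩ : ∃ s : ℕ, (s : ℤ) = i - j + r := ⟨(i - j + r).toNat, by omega⟩
  have h1 : B i * (dividedExpNeg N K * D r * dividedExp N K) * B j =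
      (∑ p ∈ range (N + 1), intSign p • (K p * D r * K (s - p))) * B j := by
    rw [dividedExpNeg, Finset.sum_mul, Finset.sum_mul, Finset.mul_sum, Finset.sum_mul,
      Finset.sum_mul]
    refine Finset.sum_congr rfl fun p _ => ?_
    simp only [smul_mul_assoc, mul_smul_comm]
    congr 1
    rw [dividedExp, Finset.mul_sum, Finset.mul_sum, Finset.sum_mul]
    have h2 : ∀ q : ℕ, B i * (K p * D r * K q) * B j =
        if i = j + q - r + p then B i * (K p * D r * K q) else 0 := by
      intro q
      rw [mul_assoc, hword, ← mul_assoc, H.mul, ite_mul, zero_mul]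
    by_cases hq : 0 ≤ (s - p : ℤ) ∧ (s - p : ℤ) ≤ N
    · obtain ⟨q, hq'⟩ : ∃ q : ℕ, (q : ℤ) = s - p := ⟨(s - p : ℤ).toNat, by omega⟩
      rw [Finset.sum_eq_single q]
      · rw [h2, if_pos (by omega), ← hq']
        rw [hword, show j + q - r + p = i by omega]
      · intro q' _ hne; rw [h2, if_neg (by omega)]
      · intro hn; simp at hn; omega
    · have h0 : K (s - p) = 0 := by
        rcases not_and_or.1 hq with h | h
        · exact hKneg _ (by omega)
        · exact hKbig _ (by omega)
      rw [h0, mul_zero, zero_mul]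
      refine Finset.sum_eq_zero fun q hq' => ?_
      simp only [mem_range] at hq'
      rw [h2, if_neg (by omega)]
  rw [h1]
  have h3 : ∑ p ∈ range (N + 1), intSign p • (K p * D r * K (s - p)) =
      ∑ p ∈ range (s + 1), intSign p • (K p * D r * K (s - p)) := by
    have h4 : ∀ m : ℕ, (m = N ∨ m = s) → ∑ p ∈ range (m + 1), intSign p • (K p * D r * K (s - p)) =
        ∑ p ∈ range (N + s + 1), intSign p • (K p * D r * K (s - p)) := by
      intro m hm
      refine Finset.sum_subset (by intro x; simp; omega) fun p _ hp => ?_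
      simp only [mem_range] at hp
      rcases hm with rfl | rfl
      · rw [hKbig p (by omega)]; simp
      · rw [hKneg (m - p) (by omega)]; simp
    rw [h4 N (by simp), h4 s (by simp)]
  rw [h3, serre r s (by omega), zero_mul]

end LabelProjectors

end Triangular

/-- Symmetry of the binomial coefficients; the order of the factors is reversed in the opposite
ring. -/
theorem LadderPair.E_mul' {R : Type*} [Ring R] {N : ℕ} {A B E F : ℤ → R}
    (H : LadderPair N A B E F) (m : ℤ) (j : ℕ) : E j * E (m - j) = Ring.choose m j • E m := by
  by_cases h : m < j
  · rw [H.E_neg (m - j) (by omega), mul_zero]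
    by_cases hm : m < 0
    · rw [H.E_neg m hm, smul_zero]
    · obtain ⟨n, rfl⟩ := Int.eq_ofNat_of_zero_le (not_lt.1 hm)
      rw [Ring.choose_natCast, Nat.choose_eq_zero_of_lt (by omega)]
      simp
  · obtain ⟨n, rfl⟩ := Int.eq_ofNat_of_zero_le (show 0 ≤ m by omega)
    have h1 := H.E_mul n (n - j)
    rw [Nat.cast_sub (by omega), sub_sub_cancel] at h1
    rw [h1, Ring.choose_natCast, Ring.choose_natCast, Nat.choose_symm (by omega)]

theorem LadderPair.projectors_A {R : Type*} [Ring R] {N : ℕ} {A B E F : ℤ → R}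
    (H : LadderPair N A B E F) : LabelProjectors A where
  mul := H.A_mul
  complete := ⟨(range (N + 1)).map Nat.castEmbedding, by rw [Finset.sum_map]; exact H.A_sum⟩

open MulOpposite in
/-- Reading ladders upside down. -/
theorem LadderPair.opposite {R : Type*} [Ring R] {N : ℕ} {A B E F : ℤ → R} (H : LadderPair N A B E F) :
    LadderPair N (fun a => op (A a)) (fun a => op (B a)) (fun r => op (F r)) (fun r => op (E r)) where
  A_mul a a' := by
    rw [← op_mul, H.A_mul]; split_ifs with h1 h2 h2
    · rw [h1]
    · exact absurd h1.symm h2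
    · exact absurd h2.symm h1
    · rfl
  B_mul a a' := by
    rw [← op_mul, H.B_mul]; split_ifs with h1 h2 h2
    · rw [h1]
    · exact absurd h1.symm h2
    · exact absurd h2.symm h1
    · rfl
  A_B a b := by rw [← op_mul, ← op_mul, H.A_B]
  A_neg a h := by rw [H.A_neg a h, op_zero]
  B_neg a h := by rw [H.B_neg a h, op_zero]
  A_big a h := by rw [H.A_big a h, op_zero]
  B_big a h := by rw [H.B_big a h, op_zero]
  A_sum := by rw [← Finset.op_sum, H.A_sum, op_one]
  B_sum := by rw [← Finset.op_sum, H.B_sum, op_one]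
  weight_big a b h := by rw [← op_mul, ← H.A_B, H.weight_big a b h, op_zero]
  E_neg r h := by rw [H.F_neg r h, op_zero]
  F_neg r h := by rw [H.E_neg r h, op_zero]
  E_zero := by rw [H.F_zero, op_one]
  F_zero := by rw [H.E_zero, op_one]
  E_A r a := by rw [← op_mul, ← op_mul, H.F_A, add_sub_cancel_right]
  E_B r a := by rw [← op_mul, ← op_mul, H.F_B, sub_add_cancel]
  F_A r a := by rw [← op_mul, ← op_mul, H.E_A, sub_add_cancel]
  F_B r a := by rw [← op_mul, ← op_mul, H.E_B, add_sub_cancel_right]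
  E_mul m j := by
    rw [← op_mul, ← op_smul, H.mirror.E_mul']
  F_mul m j := by
    rw [← op_mul, ← op_smul, H.E_mul']
  swap r s a b M hM := by
    have h := H.swap s r (a - s + r) (b + s - r) M hM.symm
    have h1 : ∀ t : ℤ, F (r - t) * E (s - t) * (A (a - s + r) * B (b + s - r)) =
        B b * A a * (F (r - t) * E (s - t)) := by
      intro t
      rw [mul_assoc, H.E_weight, ← mul_assoc, H.F_weight, ← H.A_B, mul_assoc]
      congr 3 <;> ring
    have h2 : E s * F r * (A (a - s + r) * B (b + s - r)) = B b * A a * (E s * F r) := by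
      rw [mul_assoc, H.F_weight, ← mul_assoc, H.E_weight, ← H.A_B, mul_assoc]
      congr 3 <;> ring
    simp only [h1, h2] at h
    simp only [← op_mul, ← op_smul, ← Finset.op_sum]
    rw [h]
    congr 1
    refine Finset.sum_congr rfl fun t _ => ?_
    congr 2; ring

open MulOpposite in
/-- The exchange of two strands is invariant under reading ladders upside down. -/
theorem LadderPair.crossing_opposite {R : Type*} [Ring R] {N : ℕ} {A B E F : ℤ → R}
    (H : LadderPair N A B E F) :
    ladderCrossing N (fun a => op (A a)) (fun r => op (F r)) (fun r => op (E r)) =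
      op (ladderCrossing N A E F) := by
  have hsign : labelSign N (fun a => op (A a)) = op (labelSign N A) := by
    simp only [labelSign, Finset.op_sum, op_smul]
  have hexp : ∀ K : ℤ → R, dividedExp N (fun r => op (K r)) = op (dividedExp N K) := fun K => by
    simp only [dividedExp, Finset.op_sum]
  have hexpNeg : ∀ K : ℤ → R, dividedExpNeg N (fun r => op (K r)) = op (dividedExpNeg N K) :=
    fun K => by simp only [dividedExpNeg, Finset.op_sum, op_smul]
  -- `Y = f⁻¹ e h f` is the exchange operator of the upside-down ladders, read in the original ring.
  -- On the weight `(a, b)` the operator `X` equals `A b * e h f = A b * f * Y`. As `Y` already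
  -- lands in the first label `b`, only the diagonal part of `f` contributes, and that is the
  -- identity.
  obtain ⟨Y, hY⟩ : ∃ Y, Y = dividedExpNeg N F * (dividedExp N E * (labelSign N A * dividedExp N F)) :=
    ⟨_, rfl⟩
  have hop : ladderCrossing N (fun a => op (A a)) (fun r => op (F r)) (fun r => op (E r)) = op Y := by
    rw [ladderCrossing, hsign, hexp, hexp, hexpNeg, hY]
    simp only [op_mul, mul_assoc]
  have hYA : ∀ a, A a * Y = Y * B a := fun a => by
    have := H.opposite.crossing_mul_A a
    rw [hop, ← op_mul, ← op_mul] at this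
    exact op_injective this
  have hYB : ∀ a, B a * Y = Y * A a := fun a => by
    have := H.opposite.crossing_mul_B a
    rw [hop, ← op_mul, ← op_mul] at this
    exact op_injective this
  rw [hop]
  congr 1
  refine H.ext_A fun a => H.ext_B fun b => ?_
  have hm : ∀ x : R, x * A a * B b = x * (A a * B b) := fun x => mul_assoc _ _ _
  rw [hm, hm, H.crossing_weight]
  have h1 := H.A_mul_exp_sign_exp a b b
  rw [← h1]
  have h2 : dividedExp N E * labelSign N A * dividedExp N F = dividedExp N F * Y := by
    rw [hY, ← mul_assoc (dividedExp N F) (dividedExpNeg N F), H.mirror.exp_mul_expNeg, one_mul, mul_assoc]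
  have h3 : Y * (A a * B b) = A b * (Y * (A a * B b)) := by
    rw [H.A_B, ← mul_assoc Y, ← hYA, mul_assoc, ← mul_assoc (A b) (A b), H.A_mul, if_pos rfl]
  have h4 : A b * dividedExp N F * A b = A b := by
    have := H.projectors_A.neg.diag_dividedExp (K := F)
      (fun r c => by rw [H.F_A]; congr 2; ring) N H.F_zero (-b)
    simpa using this
  calc Y * (A a * B b) = (A b * dividedExp N F * A b) * (Y * (A a * B b)) := by rw [h4, ← h3]
    _ = A b * dividedExp N F * (A b * (Y * (A a * B b))) := by simp only [mul_assoc]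
    _ = _ := by rw [← h3, h2]; simp only [mul_assoc]

/-- Divided powers acting on three strands, `E₁`, `F₁` on the first two, `E₂`, `F₂` on the last two;
the projections onto the parts with given labels are `A`, `B`, `C`. -/
structure LadderTriple {R : Type*} [Ring R] (N : ℕ) (A B C E₁ F₁ E₂ F₂ : ℤ → R) : Prop where
  pair₁ : LadderPair N A B E₁ F₁
  pair₂ : LadderPair N B C E₂ F₂
  A_C (a c : ℤ) : A a * C c = C c * A a
  E₁_C (r c : ℤ) : E₁ r * C c = C c * E₁ r
  F₁_C (r c : ℤ) : F₁ r * C c = C c * F₁ r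
  E₂_A (r a : ℤ) : E₂ r * A a = A a * E₂ r
  F₂_A (r a : ℤ) : F₂ r * A a = A a * F₂ r
  serre_E₂ (r s : ℕ) : r < s → ∑ p ∈ range (s + 1), intSign p • (E₂ p * E₁ r * E₂ (s - p)) = 0
  serre_E₁ (r s : ℕ) : r < s → ∑ p ∈ range (s + 1), intSign p • (E₁ p * E₂ r * E₁ (s - p)) = 0
  serre_F₂ (r s : ℕ) : r < s → ∑ p ∈ range (s + 1), intSign p • (F₂ (s - p) * F₁ r * F₂ p) = 0
  serre_F₁ (r s : ℕ) : r < s → ∑ p ∈ range (s + 1), intSign p • (F₁ (s - p) * F₂ r * F₁ p) = 0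

namespace LadderTriple

variable {R : Type*} [Ring R] {N : ℕ} {A B C E₁ F₁ E₂ F₂ : ℤ → R}
  (H : LadderTriple N A B C E₁ F₁ E₂ F₂)
include H

open MulOpposite in
theorem opposite : LadderTriple N (fun a => op (A a)) (fun a => op (B a)) (fun a => op (C a))
    (fun r => op (F₁ r)) (fun r => op (E₁ r)) (fun r => op (F₂ r)) (fun r => op (E₂ r)) where
  pair₁ := H.pair₁.opposite
  pair₂ := H.pair₂.opposite
  A_C a c := by rw [← op_mul, ← op_mul, H.A_C]
  E₁_C a c := by rw [← op_mul, ← op_mul, H.F₁_C]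
  F₁_C a c := by rw [← op_mul, ← op_mul, H.E₁_C]
  E₂_A a c := by rw [← op_mul, ← op_mul, H.F₂_A]
  F₂_A a c := by rw [← op_mul, ← op_mul, H.E₂_A]
  serre_E₂ r s h := by
    simp only [← op_mul, ← op_smul, ← Finset.op_sum, ← mul_assoc, H.serre_F₂ r s h, op_zero]
  serre_E₁ r s h := by
    simp only [← op_mul, ← op_smul, ← Finset.op_sum, ← mul_assoc, H.serre_F₁ r s h, op_zero]
  serre_F₂ r s h := by
    simp only [← op_mul, ← op_smul, ← Finset.op_sum, ← mul_assoc, H.serre_E₂ r s h, op_zero]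
  serre_F₁ r s h := by
    simp only [← op_mul, ← op_smul, ← Finset.op_sum, ← mul_assoc, H.serre_E₁ r s h, op_zero]

theorem crossing₁_mul_C (c : ℤ) :
    ladderCrossing N A E₁ F₁ * C c = C c * ladderCrossing N A E₁ F₁ := by
  have h1 : Commute (C c) (dividedExp N E₁) := Commute.sum_right _ _ _ fun r _ => (H.E₁_C r c).symm
  have h2 : Commute (C c) (dividedExpNeg N E₁) :=
    Commute.sum_right _ _ _ fun r _ => Commute.smul_right (H.E₁_C r c).symm _
  have h3 : Commute (C c) (dividedExp N F₁) := Commute.sum_right _ _ _ fun r _ => (H.F₁_C r c).symm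
  have h4 : Commute (C c) (labelSign N A) :=
    Commute.sum_right _ _ _ fun r _ => Commute.smul_right (H.A_C r c).symm _
  exact (((h1.mul_right h4).mul_right h3).mul_right h2).eq.symm

theorem crossing₂_mul_A (a : ℤ) :
    ladderCrossing N B E₂ F₂ * A a = A a * ladderCrossing N B E₂ F₂ := by
  have h1 : Commute (A a) (dividedExp N E₂) := Commute.sum_right _ _ _ fun r _ => (H.E₂_A r a).symm
  have h2 : Commute (A a) (dividedExpNeg N E₂) :=
    Commute.sum_right _ _ _ fun r _ => Commute.smul_right (H.E₂_A r a).symm _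
  have h3 : Commute (A a) (dividedExp N F₂) := Commute.sum_right _ _ _ fun r _ => (H.F₂_A r a).symm
  have h4 : Commute (A a) (labelSign N B) :=
    Commute.sum_right _ _ _ fun r _ => Commute.smul_right (H.pair₁.A_B a r) _
  exact (((h1.mul_right h4).mul_right h3).mul_right h2).eq.symm

/-- Conjugating the rungs between the first two strands by the exchange of the last two agrees with
conjugating the rungs between the last two strands by the exchange of the first two. -/
theorem crossing_conj_exp :
    ladderCrossing N B E₂ F₂ * dividedExp N E₁ * ladderCrossing N B E₂ F₂ =
      ladderCrossing N A E₁ F₁ * dividedExp N E₂ * ladderCrossing N A E₁ F₁ := by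
  have P₁ := H.pair₁
  have P₂ := H.pair₂
  have Q : LabelProjectors B := P₂.projectors_A
  set X₁ := ladderCrossing N A E₁ F₁ with hX₁
  set X₂ := ladderCrossing N B E₂ F₂ with hX₂
  set e₁ := dividedExp N E₁ with he₁
  set e₂ := dividedExp N E₂ with he₂
  set e₁' := dividedExpNeg N E₁ with he₁'
  set e₂' := dividedExpNeg N E₂ with he₂'
  set f₁ := dividedExp N F₁ with hf₁
  set f₂ := dividedExp N F₂ with hf₂
  set f₁' := dividedExpNeg N F₁ with hf₁'
  set f₂' := dividedExpNeg N F₂ with hf₂'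
  set h₁ := labelSign N A with hh₁
  set h₂ := labelSign N B with hh₂
  have ee₁ : e₁ * e₁' = 1 := P₁.exp_mul_expNeg
  have ee₁' : e₁' * e₁ = 1 := P₁.expNeg_mul_exp
  have ee₂ : e₂ * e₂' = 1 := P₂.exp_mul_expNeg
  have ee₂' : e₂' * e₂ = 1 := P₂.expNeg_mul_exp
  have hB₁ : ∀ b, h₁ * B b = B b * h₁ := fun b => by
    refine (Commute.sum_right _ _ _ fun r _ => Commute.smul_right ?_ _).eq.symm
    exact (P₁.A_B r b).symm
  have hB₂ : ∀ b, h₂ * B b = B b * h₂ := fun b => by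
    refine (Commute.sum_right _ _ _ fun r _ => Commute.smul_right ?_ _).eq.symm
    show B b * B r = B r * B b
    rw [P₂.A_mul, P₂.A_mul]
    split_ifs with i1 i2 i2
    · rw [i1]
    · exact absurd i1.symm i2
    · exact absurd i2.symm i1
    · rfl
  have hE₂ : h₁ * e₂ = e₂ * h₁ := by
    refine (Commute.sum_left _ _ _ fun a _ => Commute.smul_left ?_ _)
    exact Commute.sum_right _ _ _ fun r _ => (H.E₂_A r a).symm
  have upE₂ : ∀ r b, E₂ r * B b = B (b + r) * E₂ r := P₂.E_A
  have upF₁ : ∀ r b, F₁ r * B b = B (b + r) * F₁ r := P₁.F_B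
  have lowE₁ : ∀ r b, E₁ r * B (-b) = B (-(b + r)) * E₁ r := fun r b => by
    rw [P₁.E_B]; congr 2; ring
  have lowF₂ : ∀ r b, F₂ r * B (-b) = B (-(b + r)) * F₂ r := fun r b => by
    rw [P₂.F_A]; congr 2; ring
  -- `e₂` raises the middle label and `e₁` lowers it. The Serre relations show nevertheless that `u`
  -- does not raise it and `v` does not lower it.
  set u := e₂' * e₁ * e₂ with hu
  set v := e₁' * e₂ * e₁ with hv
  have lowu : UpperTriangular (fun i => B (-i)) u := fun i j hij =>
    Q.conj_upper upE₂ (D := E₁) P₁.E_B N P₂.E_neg P₂.E_big H.serre_E₂ _ _ (by omega)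
  have upv : UpperTriangular B v := fun i j hij => by
    have := Q.neg.conj_upper (K := E₁) lowE₁ (D := E₂)
      (fun r b => by rw [upE₂]; congr 2; ring) N P₁.E_neg P₁.E_big H.serre_E₁ (-i) (-j) (by omega)
    simpa using this
  -- the conjugate of `e₁`
  have X₂l : X₂ = e₂ * h₂ * f₂ * e₂' := rfl
  have hf2 : h₂ * f₂ = f₂' * h₂ := by
    rw [hf₂', ← P₂.labelSign_conj_F, mul_assoc, P₂.labelSign_mul_self, mul_one]
  have X₂r : X₂ = e₂ * f₂' * h₂ * e₂' := by rw [X₂l, mul_assoc e₂, hf2, ← mul_assoc]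
  have hf1 : h₁ * f₁ = f₁' * h₁ := by
    rw [hf₁', ← P₁.labelSign_conj_F, mul_assoc, P₁.labelSign_mul_self, mul_one]
  have X₁l : X₁ = e₁ * h₁ * f₁ * e₁' := rfl
  have X₁r : X₁ = e₁ * f₁' * h₁ * e₁' := by rw [X₁l, mul_assoc e₁, hf1, ← mul_assoc]
  set y := X₂ * e₁ * X₂ with hy
  set z := X₁ * e₂ * X₁ with hz
  -- One copy of `X₂` is taken as `e h f e⁻¹` and the other as `e f⁻¹ h e⁻¹`, so that conjugating by
  -- `e₂` leaves `u` conjugated by `h₂ f₂`.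
  have conj_y : e₂' * y * e₂ = h₂ * (f₂ * u * f₂') * h₂ := by
    calc e₂' * y * e₂ = (e₂' * e₂) * h₂ * f₂ * e₂' * e₁ * e₂ * f₂' * h₂ * (e₂' * e₂) := by
          rw [hy]; nth_rewrite 2 [X₂r]; rw [X₂l]; simp only [mul_assoc]
      _ = _ := by rw [ee₂', one_mul, mul_one, hu]; simp only [mul_assoc]
  have conj_z : e₁' * z * e₁ = h₁ * (f₁ * v * f₁') * h₁ := by
    calc e₁' * z * e₁ = (e₁' * e₁) * h₁ * f₁ * e₁' * e₂ * e₁ * f₁' * h₁ * (e₁' * e₁) := by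
          rw [hz]; nth_rewrite 2 [X₁r]; rw [X₁l]; simp only [mul_assoc]
      _ = _ := by rw [ee₁', one_mul, mul_one, hv]; simp only [mul_assoc]
  -- `X₂` carries the middle label to the third strand, `e₁` leaves that strand alone, and the
  -- second `X₂` brings the label back. For `z` the first strand plays this role.
  have yB : ∀ b, y * B b = B b * y := by
    intro b
    have hC : Commute (C b) e₁ := Commute.sum_right _ _ _ fun r _ => (H.E₁_C r b).symm
    rw [hy, mul_assoc, P₂.crossing_mul_A, ← mul_assoc, mul_assoc X₂, ← hC.eq, ← mul_assoc,
      P₂.crossing_mul_B, mul_assoc, mul_assoc, mul_assoc]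
  have zB : ∀ b, z * B b = B b * z := by
    intro b
    have hA : Commute (A b) e₂ := Commute.sum_right _ _ _ fun r _ => (H.E₂_A r b).symm
    rw [hz, mul_assoc, P₁.crossing_mul_B, ← mul_assoc, mul_assoc X₁, ← hA.eq, ← mul_assoc,
      P₁.crossing_mul_A, mul_assoc, mul_assoc, mul_assoc]
  have BB : ∀ b, B b * B b = B b := fun b => by rw [P₂.A_mul, if_pos rfl]
  -- diagonal parts
  have diag_y : ∀ b, B b * y * B b = B b * u * B b := by
    intro b
    -- Conjugation by the unipotent `e₂` does not change the diagonal blocks of `y`, which is itself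
    -- block diagonal. The next step does the same for `u` and `f₂`, both lower triangular.
    have e1 : B b * (e₂' * y * e₂) * B b = B b * y * B b := by
      rw [Q.diag_mul (Q.upper_mul (Q.upper_dividedExpNeg upE₂ N) (Q.upper_of_commute yB))
        (Q.upper_dividedExp upE₂ N), Q.diag_mul (Q.upper_dividedExpNeg upE₂ N)
        (Q.upper_of_commute yB), Q.diag_dividedExp upE₂ N P₂.E_zero,
        Q.diag_dividedExpNeg upE₂ N P₂.E_zero]
      simp only [mul_assoc, BB]
      simp only [← mul_assoc, BB]
    have e2 : B b * (f₂ * u * f₂') * B b = B b * u * B b := by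
      have lf := Q.neg.upper_dividedExp lowF₂ N
      have lf' := Q.neg.upper_dividedExpNeg lowF₂ N
      have d1 := Q.neg.diag_mul (Q.neg.upper_mul lf lowu) lf' (-b)
      rw [Q.neg.diag_mul lf lowu, Q.neg.diag_dividedExp lowF₂ N P₂.F_zero,
        Q.neg.diag_dividedExpNeg lowF₂ N P₂.F_zero] at d1
      simp only [neg_neg] at d1
      rw [d1]
      simp only [mul_assoc, BB]
      simp only [← mul_assoc, BB]
    rw [← e1, conj_y, ← e2]
    -- `h₂` is the scalar `(-1)^b` on the block of the middle label `b`, so conjugating with it has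
    -- no effect there.
    have hs : B b * h₂ = intSign b • B b := by rw [← hB₂, P₂.labelSign_mul]
    calc B b * (h₂ * (f₂ * u * f₂') * h₂) * B b
        = (B b * h₂) * (f₂ * u * f₂') * (h₂ * B b) := by simp only [mul_assoc]
      _ = _ := by rw [hB₂, hs, smul_mul_assoc, smul_mul_assoc, mul_smul_comm, smul_smul,
                    intSign_mul_self, one_smul]
  -- Unlike `h₂`, the sign `h₁` need not be scalar on the blocks of the middle label. It is kept and
  -- turns `v` into `w`.
  set w := e₁ * e₂ * e₁' with hw
  have hvw : h₁ * v * h₁ = w := by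
    have i1 : h₁ * e₁' = e₁ * h₁ := by
      rw [he₁', ← P₁.labelSign_conj_E]
      simp only [← mul_assoc, hh₁, P₁.labelSign_mul_self, one_mul]; rfl
    calc h₁ * v * h₁ = (h₁ * e₁') * e₂ * (e₁ * h₁) := by rw [hv]; simp only [mul_assoc]
      _ = e₁ * (h₁ * e₂) * (h₁ * e₁') := by rw [i1]; simp only [mul_assoc]
      _ = e₁ * e₂ * (h₁ * h₁) * e₁' := by rw [hE₂]; simp only [mul_assoc]
      _ = w := by rw [hh₁, P₁.labelSign_mul_self, mul_one]
  have upw : UpperTriangular B w := by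
    rw [← hvw]
    exact Q.upper_mul (Q.upper_mul (Q.upper_of_commute hB₁) upv) (Q.upper_of_commute hB₁)
  have diag_z : ∀ b, B b * z * B b = B b * w * B b := by
    intro b
    have e1 : B b * (e₁' * z * e₁) * B b = B b * z * B b := by
      have lz : UpperTriangular (fun i => B (-i)) z := Q.neg.upper_of_commute fun i => zB (-i)
      have le := Q.neg.upper_dividedExp lowE₁ N
      have le' := Q.neg.upper_dividedExpNeg lowE₁ N
      have d1 := Q.neg.diag_mul (Q.neg.upper_mul le' lz) le (-b)
      rw [Q.neg.diag_mul le' lz, Q.neg.diag_dividedExp lowE₁ N P₁.E_zero,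
        Q.neg.diag_dividedExpNeg lowE₁ N P₁.E_zero] at d1
      simp only [neg_neg] at d1
      rw [d1]
      simp only [mul_assoc, BB]
      simp only [← mul_assoc, BB]
    have e2 : B b * (f₁ * v * f₁') * B b = B b * v * B b := by
      rw [Q.diag_mul (Q.upper_mul (Q.upper_dividedExp upF₁ N) upv)
        (Q.upper_dividedExpNeg upF₁ N), Q.diag_mul (Q.upper_dividedExp upF₁ N)
        upv, Q.diag_dividedExp upF₁ N P₁.F_zero, Q.diag_dividedExpNeg upF₁ N P₁.F_zero]
      simp only [mul_assoc, BB]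
      simp only [← mul_assoc, BB]
    rw [← e1, conj_z, ← hvw]
    calc B b * (h₁ * (f₁ * v * f₁') * h₁) * B b
        = (B b * h₁) * (f₁ * v * f₁') * (h₁ * B b) := by simp only [mul_assoc]
      _ = (h₁ * B b) * (f₁ * v * f₁') * (B b * h₁) := by rw [hB₁]
      _ = h₁ * (B b * v * B b) * h₁ := by rw [← e2]; simp only [mul_assoc]
      _ = (h₁ * B b) * v * (B b * h₁) := by simp only [mul_assoc]
      _ = (B b * h₁) * v * (h₁ * B b) := by rw [hB₁]
      _ = _ := by simp only [mul_assoc]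
  -- Both `u e₁⁻¹` and `e₂⁻¹ w` equal `e₂⁻¹ e₁ e₂ e₁⁻¹`. In the first product both factors are lower
  -- triangular, in the second both are upper triangular, and the extra factor is unipotent each
  -- time; so the diagonals of `u` and `w` agree.
  have diag_uw : ∀ b, B b * u * B b = B b * w * B b := by
    intro b
    have e1 : B b * (u * e₁') * B b = B b * u * B b := by
      have d1 := Q.neg.diag_mul lowu (Q.neg.upper_dividedExpNeg lowE₁ N) (-b)
      rw [Q.neg.diag_dividedExpNeg lowE₁ N P₁.E_zero] at d1
      simp only [neg_neg] at d1
      rw [d1]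
      simp only [mul_assoc, BB]
    have e2 : B b * (e₂' * w) * B b = B b * w * B b := by
      rw [Q.diag_mul (Q.upper_dividedExpNeg upE₂ N) upw, Q.diag_dividedExpNeg upE₂ N P₂.E_zero]
      simp only [← mul_assoc, BB]
    rw [← e1, ← e2, hu, hw]
    simp only [mul_assoc]
  exact Q.ext_of_commute yB zB fun b => by rw [diag_y, diag_z, diag_uw]

/-- Exchanging a strand with two strands commutes with the ladders between these. -/
theorem crossing_mul_exp :
    ladderCrossing N A E₁ F₁ * ladderCrossing N B E₂ F₂ * dividedExp N E₁ =
      dividedExp N E₂ * (ladderCrossing N A E₁ F₁ * ladderCrossing N B E₂ F₂) := by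
  have h := congrArg (fun x => ladderCrossing N A E₁ F₁ * x * ladderCrossing N B E₂ F₂)
    H.crossing_conj_exp
  simp only [← mul_assoc, H.pair₁.crossing_mul_self, one_mul] at h
  rw [mul_assoc, H.pair₂.crossing_mul_self, mul_one] at h
  rw [h, mul_assoc]

open MulOpposite in
theorem exp_mul_crossing :
    dividedExp N F₁ * (ladderCrossing N B E₂ F₂ * ladderCrossing N A E₁ F₁) =
      ladderCrossing N B E₂ F₂ * ladderCrossing N A E₁ F₁ * dividedExp N F₂ := by
  have h := H.opposite.crossing_mul_exp
  rw [H.pair₁.crossing_opposite, H.pair₂.crossing_opposite] at h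
  have hexp : ∀ K : ℤ → R, dividedExp N (fun r => op (K r)) = op (dividedExp N K) := fun K => by
    simp only [dividedExp, Finset.op_sum]
  rw [hexp, hexp, ← op_mul, ← op_mul, ← op_mul] at h
  exact op_injective h

end LadderTriple

end

/-! ### Homogeneous parts of the exchange relations. -/

section

open Finset

section

variable {R : Type*} [Ring R] {N : ℕ}

namespace LadderTriple

variable {A B C E₁ F₁ E₂ F₂ : ℤ → R} (H : LadderTriple N A B C E₁ F₁ E₂ F₂)
include H

/-- `X₁ X₂` carries the first label to the middle one. Compressing `crossing_mul_exp` between the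
labels `a` and `a + r` therefore isolates the `r`-th divided power on both sides. -/
theorem crossing_mul_E (r : ℤ) :
    ladderCrossing N A E₁ F₁ * ladderCrossing N B E₂ F₂ * E₁ r =
      E₂ r * (ladderCrossing N A E₁ F₁ * ladderCrossing N B E₂ F₂) := by
  set X₁ := ladderCrossing N A E₁ F₁
  set X₂ := ladderCrossing N B E₂ F₂
  have hA : ∀ a, X₁ * X₂ * A a = B a * (X₁ * X₂) := fun a => by
    rw [mul_assoc, H.crossing₂_mul_A, ← mul_assoc, H.pair₁.crossing_mul_A, mul_assoc]
  refine H.pair₁.ext_A fun a => ?_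
  have h := congrArg (fun x => B (a + r) * x * A a) H.crossing_mul_exp
  have e1 : B (a + r) * (X₁ * X₂ * dividedExp N E₁) * A a =
      X₁ * X₂ * (A (a + r) * dividedExp N E₁ * A a) := by
    rw [← mul_assoc (B (a + r)), ← hA]; simp only [mul_assoc]
  have e2 : B (a + r) * (dividedExp N E₂ * (X₁ * X₂)) * A a =
      (B (a + r) * dividedExp N E₂ * B a) * (X₁ * X₂) := by
    simp only [mul_assoc] at hA ⊢; rw [hA]
  rw [e1, e2, H.pair₁.A_mul_exp_mul_A, H.pair₂.A_mul_exp_mul_A, add_sub_cancel_left,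
    mul_assoc (E₂ r), ← hA] at h
  simpa only [mul_assoc] using h

theorem F_mul_crossing (r : ℤ) :
    F₁ r * (ladderCrossing N B E₂ F₂ * ladderCrossing N A E₁ F₁) =
      ladderCrossing N B E₂ F₂ * ladderCrossing N A E₁ F₁ * F₂ r := by
  set X₁ := ladderCrossing N A E₁ F₁
  set X₂ := ladderCrossing N B E₂ F₂
  have hC : ∀ c, X₂ * X₁ * C c = B c * (X₂ * X₁) := fun c => by
    rw [mul_assoc, H.crossing₁_mul_C, ← mul_assoc, H.pair₂.crossing_mul_B, mul_assoc]
  refine H.pair₂.ext_B fun c => ?_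
  have h := congrArg (fun x => B (c + r) * x * C c) H.exp_mul_crossing
  have e1 : B (c + r) * (X₂ * X₁ * dividedExp N F₂) * C c =
      X₂ * X₁ * (C (c + r) * dividedExp N F₂ * C c) := by
    rw [← mul_assoc (B (c + r)), ← hC]; simp only [mul_assoc]
  have e2 : B (c + r) * (dividedExp N F₁ * (X₂ * X₁)) * C c =
      (B (c + r) * dividedExp N F₁ * B c) * (X₂ * X₁) := by
    simp only [mul_assoc] at hC ⊢; rw [hC]
  rw [e1, e2, H.pair₁.mirror.A_mul_exp_mul_A, H.pair₂.mirror.A_mul_exp_mul_A, add_sub_cancel_left,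
    mul_assoc (F₁ r), ← hC] at h
  simpa only [mul_assoc] using h

end LadderTriple

/-- Divided powers indexed by natural numbers, extended by zero to the integers. -/
def extendByZero (E : ℕ → R) (r : ℤ) : R := if 0 ≤ r then E r.toNat else 0

theorem extendByZero_natCast (E : ℕ → R) (r : ℕ) : extendByZero E r = E r := by
  simp [extendByZero]

theorem extendByZero_of_neg (E : ℕ → R) {r : ℤ} (h : r < 0) : extendByZero E r = 0 := by
  simp [extendByZero, h]

theorem extendByZero_mul {E : ℕ → R} (h0 : ∀ r s, E r * E s = (r + s).choose s • E (r + s)) (m : ℤ)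
    (j : ℕ) : extendByZero E (m - j) * extendByZero E j = Ring.choose m j • extendByZero E m := by
  rcases lt_or_ge m j with h | h
  · rw [extendByZero_of_neg E (by omega), zero_mul]
    rcases lt_or_ge m 0 with h' | h'
    · rw [extendByZero_of_neg E h', smul_zero]
    · lift m to ℕ using h'
      rw [Ring.choose_natCast, Nat.choose_eq_zero_of_lt (by exact_mod_cast h)]
      simp
  · obtain ⟨r, rfl⟩ : ∃ r : ℕ, m = r + j := ⟨(m - j).toNat, by omega⟩
    rw [add_sub_cancel_right, ← Nat.cast_add, extendByZero_natCast, extendByZero_natCast,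
      extendByZero_natCast, h0, Ring.choose_natCast, natCast_zsmul]

end

/-! ### Checking the ladder relations on homogeneous vectors. -/

section

variable {k V ι : Type*} [CommRing k] [AddCommGroup V] [Module k V] {N : ℕ}

/-- Criterion for a ladder pair in terms of a spanning family of homogeneous vectors. -/
theorem LadderPair.of_vectors {v : ι → V}
    (ext : ∀ x y : Module.End k V, (∀ i, x (v i) = y (v i)) → x = y) {α β : ι → ℕ}
    (hN : ∀ i, α i + β i ≤ N) {A B : ℤ → Module.End k V}
    (hA : ∀ i z, A z (v i) = if z = α i then v i else 0)
    (hB : ∀ i z, B z (v i) = if z = β i then v i else 0) {E F : ℕ → Module.End k V}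
    (E_zero : E 0 = 1) (F_zero : F 0 = 1)
    (E_lt : ∀ i r, β i < r → E r (v i) = 0) (F_lt : ∀ i r, α i < r → F r (v i) = 0)
    (A_E : ∀ i r z, r ≤ β i → A z (E r (v i)) = if z = α i + r then E r (v i) else 0)
    (B_E : ∀ i r z, r ≤ β i → B z (E r (v i)) = if z = β i - r then E r (v i) else 0)
    (A_F : ∀ i r z, r ≤ α i → A z (F r (v i)) = if z = α i - r then F r (v i) else 0)
    (B_F : ∀ i r z, r ≤ α i → B z (F r (v i)) = if z = β i + r then F r (v i) else 0)
    (E_mul : ∀ r s, E r * E s = (r + s).choose s • E (r + s))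
    (F_mul : ∀ r s, F r * F s = (r + s).choose s • F (r + s))
    (swap : ∀ i r s, s ≤ α i + r → r ≤ β i + s → E r (F s (v i)) =
      ∑ t ∈ range (min r s + 1), Ring.choose ((α i : ℤ) - β i + r - s) t •
        F (s - t) (E (r - t) (v i))) :
    LadderPair N A B (extendByZero E) (extendByZero F) := by
  have hcases : ∀ (K : ℕ → Module.End k V) (r : ℤ), extendByZero K r = 0 ∨
      ∃ n : ℕ, r = n ∧ extendByZero K r = K n := by
    intro K r
    rcases lt_or_ge r 0 with h | h
    · exact Or.inl (extendByZero_of_neg K h)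
    · lift r to ℕ using h
      exact Or.inr ⟨r, rfl, extendByZero_natCast K r⟩
  have sum_one : ∀ (A : ℤ → Module.End k V) (α : ι → ℕ), (∀ i, α i ≤ N) →
      (∀ i z, A z (v i) = if z = α i then v i else 0) → ∑ a ∈ range (N + 1), A a = 1 := by
    intro A α hα hA
    refine ext _ _ fun i => ?_
    rw [LinearMap.sum_apply, Finset.sum_eq_single_of_mem (α i) (by simpa using Nat.lt_succ_of_le (hα i))]
    · simp [hA]
    · intro j _ hj
      rw [hA, if_neg (by exact_mod_cast hj)]
  have mul_proj : ∀ (A : ℤ → Module.End k V) (α : ι → ℕ),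
      (∀ i z, A z (v i) = if z = α i then v i else 0) → ∀ a a', A a * A a' = if a = a' then A a else 0 := by
    intro A α hA a a'
    refine ext _ _ fun i => ?_
    rw [Module.End.mul_apply, hA]
    split_ifs with h1 h2 h2
    · rfl
    · rw [hA, if_neg (by omega)]; rfl
    · subst h2; rw [hA, if_neg h1, map_zero]
    · simp
  -- `ε` is the direction in which `K` changes the label, so that one statement yields all four
  -- commutation rules.
  have comm : ∀ (K : ℕ → Module.End k V) (A : ℤ → Module.End k V) (α γ : ι → ℕ) (ε : ℤ),
      (∀ i z, A z (v i) = if z = α i then v i else 0) → (∀ i r, γ i < r → K r (v i) = 0) →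
      (∀ i r z, r ≤ γ i → A z (K r (v i)) = if z = α i + ε * (r : ℤ) then K r (v i) else 0) →
      ∀ r a, extendByZero K r * A a = A (a + ε * r) * extendByZero K r := by
    intro K A α γ ε hA h0 h1 r a
    rcases hcases K r with h | ⟨n, rfl, h⟩
    · rw [h, zero_mul, mul_zero]
    rw [h]
    refine ext _ _ fun i => ?_
    rw [Module.End.mul_apply, Module.End.mul_apply, hA]
    rcases lt_or_ge (γ i) n with h2 | h2
    · rw [h0 i n h2, map_zero]
      split_ifs
      · exact h0 i n h2
      · exact map_zero _
    · rw [h1 i n _ h2]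
      by_cases h3 : a = α i
      · rw [if_pos h3, if_pos (by omega)]
      · rw [if_neg h3, if_neg (by omega), map_zero]
  have F_A : ∀ r a, extendByZero F r * A a = A (a - r) * extendByZero F r := fun r a => by
    simpa [sub_eq_add_neg] using comm F A α α (-1) hA F_lt
      (fun i r z h => by simpa [sub_eq_add_neg] using A_F i r z h) r a
  have E_A : ∀ r a, extendByZero E r * A a = A (a + r) * extendByZero E r := fun r a => by
    simpa using comm E A α β 1 hA E_lt (fun i r z h => by simpa using A_E i r z h) r a
  have E_B : ∀ r a, extendByZero E r * B a = B (a - r) * extendByZero E r := fun r a => by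
    simpa [sub_eq_add_neg] using comm E B β β (-1) hB E_lt
      (fun i r z h => by simpa [sub_eq_add_neg] using B_E i r z h) r a
  have F_B : ∀ r a, extendByZero F r * B a = B (a + r) * extendByZero F r := fun r a => by
    simpa using comm F B β α 1 hB F_lt (fun i r z h => by simpa using B_F i r z h) r a
  have A_neg : ∀ a < 0, A a = 0 := fun a ha => ext _ _ fun i => by
    rw [hA, if_neg (by omega)]; rfl
  have B_neg : ∀ a < 0, B a = 0 := fun a ha => ext _ _ fun i => by
    rw [hB, if_neg (by omega)]; rfl
  refine
  { A_mul := mul_proj A α hA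
    B_mul := mul_proj B β hB
    A_B := ?_
    A_neg, B_neg
    A_big := ?_
    B_big := ?_
    A_sum := sum_one A α (fun i => (Nat.le_add_right _ _).trans (hN i)) hA
    B_sum := sum_one B β (fun i => (Nat.le_add_left _ _).trans (hN i)) hB
    weight_big := ?_
    E_neg := fun r h => extendByZero_of_neg E h
    F_neg := fun r h => extendByZero_of_neg F h
    E_zero := by simpa using (extendByZero_natCast E 0).trans E_zero
    F_zero := by simpa using (extendByZero_natCast F 0).trans F_zero
    E_A, E_B, F_A, F_B
    E_mul := extendByZero_mul E_mul
    F_mul := extendByZero_mul F_mul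
    swap := ?_ }
  · intro a b
    refine ext _ _ fun i => ?_
    rw [Module.End.mul_apply, Module.End.mul_apply, hA, hB]
    split_ifs with h1 h2 h2 <;> simp [*]
  · intro a ha
    refine ext _ _ fun i => ?_
    rw [hA, if_neg (by have := hN i; omega)]; rfl
  · intro a ha
    refine ext _ _ fun i => ?_
    rw [hB, if_neg (by have := hN i; omega)]; rfl
  · intro a b h
    refine ext _ _ fun i => ?_
    rw [Module.End.mul_apply, hB]
    split_ifs with h1
    · rw [hA, if_neg (by have := hN i; omega)]; rfl
    · simp
  · intro r s a b M hM
    refine ext _ _ fun i => ?_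
    rw [LinearMap.sum_apply]
    simp only [Module.End.mul_apply, LinearMap.smul_apply, hB]
    by_cases hb : b = β i
    swap
    · simp [hb]
    by_cases ha : a = α i
    swap
    · simp [hb, hA, ha]
    subst ha hb
    simp only [hA, if_true]
    have hAv : A (α i) (v i) = v i := by simp [hA]
    have hBv : B (β i) (v i) = v i := by simp [hB]
    rcases lt_or_ge r 0 with hr | hr
    · rw [extendByZero_of_neg E hr, LinearMap.zero_apply]
      refine (Finset.sum_eq_zero fun t _ => ?_).symm
      rw [extendByZero_of_neg E (by omega), LinearMap.zero_apply, map_zero, smul_zero]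
    rcases lt_or_ge s 0 with hs | hs
    · rw [extendByZero_of_neg F hs, LinearMap.zero_apply, map_zero]
      refine (Finset.sum_eq_zero fun t _ => ?_).symm
      rw [extendByZero_of_neg F (by omega), LinearMap.zero_apply, smul_zero]
    lift r to ℕ using hr
    lift s to ℕ using hs
    -- The hypothesis `swap` covers only the case where both final labels are nonnegative. In the
    -- other cases every term of the identity vanishes for reasons of weight.
    have hF : ∀ x y : ℤ, x < y → ∀ w : V, extendByZero F y (A x w) = 0 := fun x y hxy w => by
      rw [← Module.End.mul_apply, F_A, A_neg _ (by omega), zero_mul, LinearMap.zero_apply]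
    have hE : ∀ x y : ℤ, x < y → ∀ w : V, extendByZero E y (B x w) = 0 := fun x y hxy w => by
      rw [← Module.End.mul_apply, E_B, B_neg _ (by omega), zero_mul, LinearMap.zero_apply]
    rcases lt_or_ge (α i + r) s with h1 | h1
    · have h2 : extendByZero F s (v i) = 0 := by
        rw [← hAv]; exact hF _ _ (by omega) _
      rw [h2, map_zero]
      refine (Finset.sum_eq_zero fun t _ => ?_).symm
      rw [← hAv, ← Module.End.mul_apply (extendByZero E _), E_A, Module.End.mul_apply,
        hF _ _ (by omega), smul_zero]
    rcases lt_or_ge (β i + s) r with h3 | h3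
    · have h2 : extendByZero E r (extendByZero F s (v i)) = 0 := by
        rw [← hBv, ← Module.End.mul_apply (extendByZero F _), F_B, Module.End.mul_apply,
          hE _ _ (by omega)]
      rw [h2]
      refine (Finset.sum_eq_zero fun t _ => ?_).symm
      rcases lt_or_ge s t with h4 | h4
      · rw [extendByZero_of_neg F (by omega), LinearMap.zero_apply, smul_zero]
      · rw [← hBv, hE _ _ (by omega), map_zero, smul_zero]
    rw [extendByZero_natCast, extendByZero_natCast, swap i r s h1 h3]
    refine (Finset.sum_congr rfl fun t ht => ?_).trans
      (Finset.sum_subset (Finset.range_subset_range.2 (by omega)) fun t _ ht => ?_)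
    · have h4 : t ≤ r ∧ t ≤ s := by simp at ht; omega
      rw [← extendByZero_natCast F, ← extendByZero_natCast E, Nat.cast_sub h4.1, Nat.cast_sub h4.2]
    · rcases lt_or_ge s t with h4 | h4
      · rw [extendByZero_of_neg F (by omega), LinearMap.zero_apply, smul_zero]
      · rw [extendByZero_of_neg E (by simp at ht; omega), LinearMap.zero_apply, map_zero, smul_zero]

end

end

namespace PWeb

variable {k : Type u} [CommRing k] [Invertible (2 : k)]

/-! ### The tensor product in terms of words -/

/-- The tensor product of morphisms between words. -/
def tens {a a' b b' : List ℕ+} (f : (⟨a⟩ : PWeb k) ⟶ ⟨a'⟩) (g : (⟨b⟩ : PWeb k) ⟶ ⟨b'⟩) :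
    (⟨a ++ b⟩ : PWeb k) ⟶ ⟨a' ++ b'⟩ := tensorHom f g

section

variable {a a' a'' b b' b'' c c' : List ℕ+}

theorem ofPreWeb_mem {f : PreWeb k a a'} {p : ZMod 2} (hf : f.HasParity p) :
    ofPreWeb f ∈ parity (⟨a⟩ : PWeb k) ⟨a'⟩ p := ⟨f, hf, rfl⟩

theorem id_mem_parity (a : List ℕ+) : 𝟙 (⟨a⟩ : PWeb k) ∈ parity (⟨a⟩ : PWeb k) ⟨a⟩ 0 :=
  ofPreWeb_mem (.id a)

theorem tens_mem {f : (⟨a⟩ : PWeb k) ⟶ ⟨a'⟩} {g : (⟨b⟩ : PWeb k) ⟶ ⟨b'⟩} {p q : ZMod 2}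
    (hf : f ∈ parity (⟨a⟩ : PWeb k) ⟨a'⟩ p) (hg : g ∈ parity (⟨b⟩ : PWeb k) ⟨b'⟩ q) :
    tens f g ∈ parity (⟨a ++ b⟩ : PWeb k) ⟨a' ++ b'⟩ (p + q) :=
  StrictMonoidalSupercategory.tensorHom_mem (k := k) (C := PWeb k) hf hg

theorem comp_mem_even {f : (⟨a⟩ : PWeb k) ⟶ ⟨b⟩} {g : (⟨b⟩ : PWeb k) ⟶ ⟨c⟩} {p : ZMod 2}
    (hf : f ∈ parity (⟨a⟩ : PWeb k) ⟨b⟩ 0) (hg : g ∈ parity (⟨b⟩ : PWeb k) ⟨c⟩ p) :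
    f ≫ g ∈ parity (⟨a⟩ : PWeb k) ⟨c⟩ p := by
  have := StrictMonoidalSupercategory.comp_mem (k := k) (C := PWeb k) hf hg
  rwa [zero_add] at this

theorem eqToHom_mem (h : (⟨a⟩ : PWeb k) = ⟨b⟩) : eqToHom h ∈ parity (⟨a⟩ : PWeb k) ⟨b⟩ 0 := by
  cases h; exact id_mem_parity a

theorem exists_parity_add (f : (⟨a⟩ : PWeb k) ⟶ ⟨b⟩) :
    ∃ f₀ ∈ parity (⟨a⟩ : PWeb k) ⟨b⟩ 0, ∃ f₁ ∈ parity (⟨a⟩ : PWeb k) ⟨b⟩ 1, f = f₀ + f₁ := by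
  obtain ⟨f, rfl⟩ := Hom.exists_rep f
  obtain ⟨f₀, f₁, h₀, h₁, h⟩ := exists_add_parity f
  exact ⟨ofPreWeb f₀, ⟨f₀, h₀, rfl⟩, ofPreWeb f₁, ⟨f₁, h₁, rfl⟩, Hom.sound h⟩

theorem tens_id_id (a b : List ℕ+) : tens (𝟙 (⟨a⟩ : PWeb k)) (𝟙 (⟨b⟩ : PWeb k)) = 𝟙 _ :=
  StrictMonoidalSupercategory.id_tensorHom_id (k := k) (C := PWeb k) ⟨a⟩ ⟨b⟩

theorem tens_add_left (f f' : (⟨a⟩ : PWeb k) ⟶ ⟨a'⟩) (g : (⟨b⟩ : PWeb k) ⟶ ⟨b'⟩) :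
    tens (f + f') g = tens f g + tens f' g :=
  LinearMap.map_add₂ (tensorHom (k := k) (a := ⟨a⟩) (a' := ⟨a'⟩) (b := ⟨b⟩) (b' := ⟨b'⟩)) f f' g

theorem tens_add_right (f : (⟨a⟩ : PWeb k) ⟶ ⟨a'⟩) (g g' : (⟨b⟩ : PWeb k) ⟶ ⟨b'⟩) :
    tens f (g + g') = tens f g + tens f g' := map_add _ _ _

theorem tens_smul_left (x : k) (f : (⟨a⟩ : PWeb k) ⟶ ⟨a'⟩) (g : (⟨b⟩ : PWeb k) ⟶ ⟨b'⟩) :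
    tens (x • f) g = x • tens f g :=
  LinearMap.map_smul₂ (tensorHom (k := k) (a := ⟨a⟩) (a' := ⟨a'⟩) (b := ⟨b⟩) (b' := ⟨b'⟩)) x f g

theorem tens_smul_right (x : k) (f : (⟨a⟩ : PWeb k) ⟶ ⟨a'⟩) (g : (⟨b⟩ : PWeb k) ⟶ ⟨b'⟩) :
    tens f (x • g) = x • tens f g := map_smul _ _ _

theorem tens_zero_left (g : (⟨b⟩ : PWeb k) ⟶ ⟨b'⟩) :
    tens (0 : (⟨a⟩ : PWeb k) ⟶ ⟨a'⟩) g = 0 :=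
  LinearMap.map_zero₂ (tensorHom (k := k) (a := ⟨a⟩) (a' := ⟨a'⟩) (b := ⟨b⟩) (b' := ⟨b'⟩)) g

theorem tens_zero_right (f : (⟨a⟩ : PWeb k) ⟶ ⟨a'⟩) :
    tens f (0 : (⟨b⟩ : PWeb k) ⟶ ⟨b'⟩) = 0 := map_zero _

theorem tens_comp_tens {p q : ZMod 2} (h : (⟨a⟩ : PWeb k) ⟶ ⟨a'⟩) (e : (⟨b⟩ : PWeb k) ⟶ ⟨b'⟩)
    (f : (⟨a'⟩ : PWeb k) ⟶ ⟨a''⟩) (g : (⟨b'⟩ : PWeb k) ⟶ ⟨b''⟩)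
    (hh : h ∈ parity (⟨a⟩ : PWeb k) ⟨a'⟩ p) (hg : g ∈ parity (⟨b'⟩ : PWeb k) ⟨b''⟩ q) :
    tens h e ≫ tens f g = koszulSign k p q • tens (h ≫ f) (e ≫ g) :=
  StrictMonoidalSupercategory.super_interchange (k := k) (C := PWeb k) h e f g hh hg

theorem koszulSign_zero_left {R : Type*} [CommRing R] (q : ZMod 2) : koszulSign R 0 q = 1 := by simp [koszulSign]

theorem koszulSign_zero_right {R : Type*} [CommRing R] (q : ZMod 2) : koszulSign R q 0 = 1 := by simp [koszulSign]

/-- Splitting `g` into its even and odd parts removes any homogeneity condition on `g`: with `h`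
even, both parts carry the sign `1`. -/
theorem tens_comp_tens_of_even_left (h : (⟨a⟩ : PWeb k) ⟶ ⟨a'⟩) (e : (⟨b⟩ : PWeb k) ⟶ ⟨b'⟩)
    (f : (⟨a'⟩ : PWeb k) ⟶ ⟨a''⟩) (g : (⟨b'⟩ : PWeb k) ⟶ ⟨b''⟩)
    (hh : h ∈ parity (⟨a⟩ : PWeb k) ⟨a'⟩ 0) :
    tens h e ≫ tens f g = tens (h ≫ f) (e ≫ g) := by
  obtain ⟨g₀, h₀, g₁, h₁, rfl⟩ := exists_parity_add g
  rw [tens_add_right, Preadditive.comp_add, tens_comp_tens h e f g₀ hh h₀,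
    tens_comp_tens h e f g₁ hh h₁, koszulSign_zero_left, koszulSign_zero_left, one_smul, one_smul,
    Preadditive.comp_add, tens_add_right]

theorem tens_comp_tens_of_even_right (h : (⟨a⟩ : PWeb k) ⟶ ⟨a'⟩) (e : (⟨b⟩ : PWeb k) ⟶ ⟨b'⟩)
    (f : (⟨a'⟩ : PWeb k) ⟶ ⟨a''⟩) (g : (⟨b'⟩ : PWeb k) ⟶ ⟨b''⟩)
    (hg : g ∈ parity (⟨b'⟩ : PWeb k) ⟨b''⟩ 0) :
    tens h e ≫ tens f g = tens (h ≫ f) (e ≫ g) := by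
  obtain ⟨g₀, h₀, g₁, h₁, rfl⟩ := exists_parity_add h
  rw [tens_add_left, Preadditive.add_comp, tens_comp_tens g₀ e f g h₀ hg,
    tens_comp_tens g₁ e f g h₁ hg, koszulSign_zero_right, koszulSign_zero_right, one_smul, one_smul,
    Preadditive.add_comp, tens_add_left]

theorem tens_id_comp (c : List ℕ+) (f : (⟨a⟩ : PWeb k) ⟶ ⟨a'⟩) (g : (⟨a'⟩ : PWeb k) ⟶ ⟨a''⟩) :
    tens (𝟙 (⟨c⟩ : PWeb k)) (f ≫ g) = tens (𝟙 (⟨c⟩ : PWeb k)) f ≫ tens (𝟙 (⟨c⟩ : PWeb k)) g := by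
  rw [tens_comp_tens_of_even_left _ _ _ _ (id_mem_parity c), Category.comp_id]

theorem tens_comp_id (c : List ℕ+) (f : (⟨a⟩ : PWeb k) ⟶ ⟨a'⟩) (g : (⟨a'⟩ : PWeb k) ⟶ ⟨a''⟩) :
    tens (f ≫ g) (𝟙 (⟨c⟩ : PWeb k)) = tens f (𝟙 (⟨c⟩ : PWeb k)) ≫ tens g (𝟙 (⟨c⟩ : PWeb k)) := by
  rw [tens_comp_tens_of_even_right _ _ _ _ (id_mem_parity c), Category.comp_id]

/-- First `g`, then `f`; no sign occurs. -/
theorem id_tens_comp_tens_id (f : (⟨a⟩ : PWeb k) ⟶ ⟨a'⟩) (g : (⟨b⟩ : PWeb k) ⟶ ⟨b'⟩) :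
    tens (𝟙 (⟨a⟩ : PWeb k)) g ≫ tens f (𝟙 (⟨b'⟩ : PWeb k)) = tens f g := by
  rw [tens_comp_tens_of_even_left _ _ _ _ (id_mem_parity a), Category.comp_id, Category.id_comp]

theorem tens_id_comp_id_tens {f : (⟨a⟩ : PWeb k) ⟶ ⟨a'⟩} (g : (⟨b⟩ : PWeb k) ⟶ ⟨b'⟩)
    (hf : f ∈ parity (⟨a⟩ : PWeb k) ⟨a'⟩ 0) :
    tens f (𝟙 (⟨b⟩ : PWeb k)) ≫ tens (𝟙 (⟨a'⟩ : PWeb k)) g = tens f g := by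
  rw [tens_comp_tens_of_even_left _ _ _ _ hf, Category.comp_id, Category.id_comp]

theorem tens_id_comp_id_tens' (f : (⟨a⟩ : PWeb k) ⟶ ⟨a'⟩) {g : (⟨b⟩ : PWeb k) ⟶ ⟨b'⟩}
    (hg : g ∈ parity (⟨b⟩ : PWeb k) ⟨b'⟩ 0) :
    tens f (𝟙 (⟨b⟩ : PWeb k)) ≫ tens (𝟙 (⟨a'⟩ : PWeb k)) g = tens f g := by
  rw [tens_comp_tens_of_even_right _ _ _ _ hg, Category.comp_id, Category.id_comp]

/-- The two bracketings of a concatenation are equal lists, but not definitionally. Heterogeneous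
equality keeps the transports between them out of the computations with webs. -/
theorem tens_assoc_heq (f : (⟨a⟩ : PWeb k) ⟶ ⟨a'⟩) (g : (⟨b⟩ : PWeb k) ⟶ ⟨b'⟩)
    (h : (⟨c⟩ : PWeb k) ⟶ ⟨c'⟩) : tens (tens f g) h ≍ tens f (tens g h) :=
  (conj_eqToHom_iff_heq' _ _ _ _).1
    (StrictMonoidalSupercategory.assoc_hom (k := k) (C := PWeb k) f g h)

theorem tens_unit_heq (f : (⟨a⟩ : PWeb k) ⟶ ⟨a'⟩) : tens f (𝟙 (⟨[]⟩ : PWeb k)) ≍ f :=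
  (conj_eqToHom_iff_heq' _ _ _ _).1
    (StrictMonoidalSupercategory.tensorHom_unit (k := k) (C := PWeb k) f)

theorem unit_tens (f : (⟨a⟩ : PWeb k) ⟶ ⟨a'⟩) : tens (𝟙 (⟨[]⟩ : PWeb k)) f = f :=
  eq_of_heq ((conj_eqToHom_iff_heq' _ _ _ _).1
    (StrictMonoidalSupercategory.unit_tensorHom (k := k) (C := PWeb k) f))

theorem ofPreWeb_cast_heq (ha : a = a') (hb : b = b') (f : PreWeb k a b) :
    ofPreWeb (f.cast ha hb) ≍ ofPreWeb f := by
  subst ha hb; rfl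

end

section HEq

variable {a₁ a₂ b₁ b₂ c₁ c₂ d₁ d₂ : List ℕ+}

theorem comp_heq {f : (⟨a₁⟩ : PWeb k) ⟶ ⟨b₁⟩} {f' : (⟨a₂⟩ : PWeb k) ⟶ ⟨b₂⟩}
    {g : (⟨b₁⟩ : PWeb k) ⟶ ⟨c₁⟩} {g' : (⟨b₂⟩ : PWeb k) ⟶ ⟨c₂⟩} (ha : a₁ = a₂) (hb : b₁ = b₂)
    (hc : c₁ = c₂) (hf : f ≍ f') (hg : g ≍ g') : f ≫ g ≍ f' ≫ g' := by
  subst ha hb hc; cases hf; cases hg; rfl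

theorem tens_heq {f : (⟨a₁⟩ : PWeb k) ⟶ ⟨b₁⟩} {f' : (⟨a₂⟩ : PWeb k) ⟶ ⟨b₂⟩}
    {g : (⟨c₁⟩ : PWeb k) ⟶ ⟨d₁⟩} {g' : (⟨c₂⟩ : PWeb k) ⟶ ⟨d₂⟩} (ha : a₁ = a₂) (hb : b₁ = b₂)
    (hc : c₁ = c₂) (hd : d₁ = d₂) (hf : f ≍ f') (hg : g ≍ g') : tens f g ≍ tens f' g' := by
  subst ha hb hc hd; cases hf; cases hg; rfl

theorem id_heq (h : a₁ = a₂) : 𝟙 (⟨a₁⟩ : PWeb k) ≍ 𝟙 (⟨a₂⟩ : PWeb k) := by subst h; rfl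

end HEq

/-! ### Words of natural numbers -/

/-- The object attached to a sequence of natural numbers: zeros are deleted. -/
def wd : List ℕ → List ℕ+
  | [] => []
  | a :: t => strand a ++ wd t

variable (k) in
/-- Morphisms between the objects attached to sequences of natural numbers. -/
abbrev LHom (x y : List ℕ) : Type u := (⟨wd x⟩ : PWeb k) ⟶ ⟨wd y⟩

variable (k) in
/-- Morphisms between two pairs of strands. -/
abbrev PairHom (a b c d : ℕ) : Type u :=
  (⟨strand a ++ strand b⟩ : PWeb k) ⟶ ⟨strand c ++ strand d⟩

/-- Add a strand on the left. -/
def L (a : ℕ) {x y : List ℕ} (f : LHom k x y) : LHom k (a :: x) (a :: y) :=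
  tens (𝟙 (⟨strand a⟩ : PWeb k)) f

section

variable {x y z : List ℕ}

theorem L_comp (a : ℕ) (f : LHom k x y) (g : LHom k y z) : L a (f ≫ g) = L a f ≫ L a g :=
  tens_id_comp _ f g

theorem L_id (a : ℕ) (x : List ℕ) : L a (𝟙 (⟨wd x⟩ : PWeb k)) = 𝟙 _ := tens_id_id _ _

theorem L_add (a : ℕ) (f g : LHom k x y) : L a (f + g) = L a f + L a g := tens_add_right _ f g

theorem L_smul (a : ℕ) (c : k) (f : LHom k x y) : L a (c • f) = c • L a f := tens_smul_right c _ f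

theorem L_zero (a : ℕ) : L a (0 : LHom k x y) = 0 := tens_zero_right _

/-- Adding a strand as a linear map. -/
def Llin (a : ℕ) (x y : List ℕ) : LHom k x y →ₗ[k] LHom k (a :: x) (a :: y) where
  toFun := L a
  map_add' := L_add a
  map_smul' := L_smul a

theorem L_sub (a : ℕ) (f g : LHom k x y) : L a (f - g) = L a f - L a g := map_sub (Llin a x y) f g

theorem L_neg (a : ℕ) (f : LHom k x y) : L a (-f) = -L a f := map_neg (Llin a x y) f

theorem L_sum (a : ℕ) {ι : Type*} (s : Finset ι) (f : ι → LHom k x y) :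
    L a (∑ i ∈ s, f i) = ∑ i ∈ s, L a (f i) := map_sum (Llin a x y) f s

/-- A strand labelled `0` may be omitted. -/
theorem L_nil (f : LHom k x y) : L 0 f = f := unit_tens f

theorem L_mem (a : ℕ) {f : LHom k x y} {p : ZMod 2} (hf : f ∈ parity (⟨wd x⟩ : PWeb k) ⟨wd y⟩ p) :
    L a f ∈ parity (⟨wd (a :: x)⟩ : PWeb k) ⟨wd (a :: y)⟩ p := by
  have := tens_mem (id_mem_parity (k := k) (strand a)) hf
  rwa [zero_add] at this

end

/-- The merge of the first two strands. -/
def mg (a b c : ℕ) (h : a + b = c) (t : List ℕ) : LHom k (a :: b :: t) (c :: t) :=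
  eqToHom (congrArg PWeb.mk (List.append_assoc _ _ _).symm) ≫
    tens (ofPreWeb (.merge a b)) (𝟙 (⟨wd t⟩ : PWeb k)) ≫ eqToHom (by subst h; rfl)

/-- The split of the first strand. -/
def sp (a b c : ℕ) (h : a + b = c) (t : List ℕ) : LHom k (c :: t) (a :: b :: t) :=
  eqToHom (by subst h; rfl) ≫ tens (ofPreWeb (.split a b)) (𝟙 (⟨wd t⟩ : PWeb k)) ≫
    eqToHom (congrArg PWeb.mk (List.append_assoc _ _ _))

/-- The cap of the first two strands. -/
def cp (t : List ℕ) : LHom k (1 :: 1 :: t) t := tens (ofPreWeb .cap) (𝟙 (⟨wd t⟩ : PWeb k))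

/-- The antenna on the first strand. -/
def an (t : List ℕ) : LHom k (2 :: t) t := tens (ofPreWeb .antenna) (𝟙 (⟨wd t⟩ : PWeb k))

/-- A morphism of pairs of strands applied to the first two strands. -/
def pr {a b c d : ℕ} (f : PairHom k a b c d) (t : List ℕ) : LHom k (a :: b :: t) (c :: d :: t) :=
  eqToHom (congrArg PWeb.mk (List.append_assoc _ _ _).symm) ≫
    tens f (𝟙 (⟨wd t⟩ : PWeb k)) ≫ eqToHom (congrArg PWeb.mk (List.append_assoc _ _ _))

theorem mg_heq {a b c : ℕ} (h : a + b = c) (t : List ℕ) :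
    (mg a b c h t : LHom k _ _) ≍ tens (ofPreWeb (.merge a b)) (𝟙 (⟨wd t⟩ : PWeb k)) := by
  subst h
  rw [mg, eqToHom_comp_heq_iff, comp_eqToHom_heq_iff]

theorem sp_heq {a b c : ℕ} (h : a + b = c) (t : List ℕ) :
    (sp a b c h t : LHom k _ _) ≍ tens (ofPreWeb (.split a b)) (𝟙 (⟨wd t⟩ : PWeb k)) := by
  subst h
  rw [sp, eqToHom_comp_heq_iff, comp_eqToHom_heq_iff]

theorem pr_heq {a b c d : ℕ} (f : PairHom k a b c d) (t : List ℕ) :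
    pr f t ≍ tens f (𝟙 (⟨wd t⟩ : PWeb k)) := by
  rw [pr, eqToHom_comp_heq_iff, comp_eqToHom_heq_iff]

theorem tail_cons_heq {a a' : List ℕ+} (f : (⟨a⟩ : PWeb k) ⟶ ⟨a'⟩) (c : ℕ) (t : List ℕ) :
    tens f (𝟙 (⟨wd (c :: t)⟩ : PWeb k)) ≍
      tens (tens f (𝟙 (⟨strand c⟩ : PWeb k))) (𝟙 (⟨wd t⟩ : PWeb k)) := by
  refine HEq.trans (heq_of_eq ?_) (tens_assoc_heq f (𝟙 (⟨strand c⟩ : PWeb k)) _).symm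
  rw [tens_id_id]; rfl

theorem L_heq {a' b' : List ℕ+} {x y t : List ℕ} (a : ℕ) (f : LHom k x y)
    (g : (⟨a'⟩ : PWeb k) ⟶ ⟨b'⟩) (hx : wd x = a' ++ wd t) (hy : wd y = b' ++ wd t)
    (h : f ≍ tens g (𝟙 (⟨wd t⟩ : PWeb k))) :
    L a f ≍ tens (tens (𝟙 (⟨strand a⟩ : PWeb k)) g) (𝟙 (⟨wd t⟩ : PWeb k)) :=
  (tens_heq rfl rfl hx hy HEq.rfl h).trans (tens_assoc_heq _ _ _).symm

/-! ### Naturality in the tail -/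

section

variable {t t' : List ℕ}

/-- Both sides are the tensor product of the merge with `g`. The merge is even, so `g` may be
arbitrary. -/
theorem mg_naturality {a b c : ℕ} (h : a + b = c) (g : LHom k t t') :
    mg a b c h t ≫ L c g = L a (L b g) ≫ mg a b c h t' := by
  subst h
  have h1 : mg a b (a + b) rfl t ≫ L (a + b) g ≍ tens (ofPreWeb (.merge a b)) g := by
    refine (comp_heq (List.append_assoc _ _ _).symm rfl rfl (mg_heq rfl t) HEq.rfl).trans ?_
    exact heq_of_eq (tens_id_comp_id_tens g (ofPreWeb_mem (.merge a b)))
  have h2 : L a (L b g) ≫ mg a b (a + b) rfl t' ≍ tens (ofPreWeb (.merge a b)) g := by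
    refine (comp_heq (List.append_assoc _ _ _).symm (List.append_assoc _ _ _).symm rfl
      (tens_assoc_heq _ _ g).symm (mg_heq rfl t')).trans (heq_of_eq ?_)
    exact (congrArg (· ≫ _) (congrArg (tens · g) (tens_id_id _ _))).trans (id_tens_comp_tens_id _ g)
  exact eq_of_heq (h1.trans h2.symm)

theorem sp_naturality {a b c : ℕ} (h : a + b = c) (g : LHom k t t') :
    sp a b c h t ≫ L a (L b g) = L c g ≫ sp a b c h t' := by
  subst h
  have h1 : L (a + b) g ≫ sp a b (a + b) rfl t' ≍ tens (ofPreWeb (.split a b)) g := by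
    refine (comp_heq rfl rfl (List.append_assoc _ _ _).symm HEq.rfl (sp_heq rfl t')).trans ?_
    exact heq_of_eq (id_tens_comp_tens_id _ g)
  have h2 : sp a b (a + b) rfl t ≫ L a (L b g) ≍ tens (ofPreWeb (.split a b)) g := by
    refine (comp_heq rfl (List.append_assoc _ _ _).symm (List.append_assoc _ _ _).symm
      (sp_heq rfl t) (tens_assoc_heq _ _ g).symm).trans (heq_of_eq ?_)
    exact (congrArg (_ ≫ ·) (congrArg (tens · g) (tens_id_id _ _))).trans
      (tens_id_comp_id_tens g (ofPreWeb_mem (.split a b)))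
  exact eq_of_heq (h2.trans h1.symm)

theorem pr_naturality {a b c d : ℕ} {f : PairHom k a b c d}
    (hf : f ∈ parity (⟨strand a ++ strand b⟩ : PWeb k) ⟨strand c ++ strand d⟩ 0)
    (g : LHom k t t') :
    pr f t ≫ L c (L d g) = L a (L b g) ≫ pr f t' := by
  have h1 : pr f t ≫ L c (L d g) ≍ tens f g := by
    refine (comp_heq (List.append_assoc _ _ _).symm (List.append_assoc _ _ _).symm
      (List.append_assoc _ _ _).symm (pr_heq f t) (tens_assoc_heq _ _ g).symm).trans (heq_of_eq ?_)
    exact (congrArg (_ ≫ ·) (congrArg (tens · g) (tens_id_id _ _))).trans (tens_id_comp_id_tens g hf)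
  have h2 : L a (L b g) ≫ pr f t' ≍ tens f g := by
    refine (comp_heq (List.append_assoc _ _ _).symm (List.append_assoc _ _ _).symm
      (List.append_assoc _ _ _).symm (tens_assoc_heq _ _ g).symm (pr_heq f t')).trans (heq_of_eq ?_)
    exact (congrArg (· ≫ _) (congrArg (tens · g) (tens_id_id _ _))).trans (id_tens_comp_tens_id _ g)
  exact eq_of_heq (h1.trans h2.symm)

/-- In contrast to merges and splits, the cap is odd, and an odd `g` would pick up a sign. -/
theorem cp_naturality {g : LHom k t t'} (hg : g ∈ parity (⟨wd t⟩ : PWeb k) ⟨wd t'⟩ 0) :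
    cp t ≫ g = L 1 (L 1 g) ≫ cp t' := by
  have h1 : cp t ≫ g = tens (ofPreWeb .cap) g := by
    rw [← tens_id_comp_id_tens' (ofPreWeb .cap) hg, unit_tens]; rfl
  have h2 : L 1 (L 1 g) ≫ cp t' = tens (ofPreWeb .cap) g := by
    rw [← id_tens_comp_tens_id]
    congr 1
    refine eq_of_heq ((tens_assoc_heq _ _ g).symm.trans (heq_of_eq ?_))
    rw [tens_id_id]
  rw [h1, h2]

theorem an_naturality {g : LHom k t t'} (hg : g ∈ parity (⟨wd t⟩ : PWeb k) ⟨wd t'⟩ 0) :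
    an t ≫ g = L 2 g ≫ an t' := by
  have h1 : an t ≫ g = tens (ofPreWeb .antenna) g := by
    rw [← tens_id_comp_id_tens' (ofPreWeb .antenna) hg, unit_tens]; rfl
  have h2 : L 2 g ≫ an t' = tens (ofPreWeb .antenna) g := id_tens_comp_tens_id _ _
  rw [h1, h2]

end

theorem mg_mem {a b c : ℕ} (h : a + b = c) (t : List ℕ) :
    mg a b c h t ∈ parity (⟨wd (a :: b :: t)⟩ : PWeb k) ⟨wd (c :: t)⟩ 0 := by
  refine comp_mem_even (eqToHom_mem _) (comp_mem_even ?_ (eqToHom_mem _))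
  exact tens_mem (ofPreWeb_mem (.merge a b)) (id_mem_parity _)

end PWeb

namespace PWeb

variable {k : Type u} [CommRing k] [Invertible (2 : k)]

/-! ### The relations with strands on the right -/

theorem ofPreWeb_rel {a b : List ℕ+} {f g : PreWeb k a b} (h : PreWeb.WebRel k f g) :
    ofPreWeb f = ofPreWeb g := Hom.sound (.rel h)

theorem tens_cast_heq {a a' b b' : List ℕ+} (ha : a = a') (hb : b = b') (f : PreWeb k a b)
    (t : List ℕ+) :
    tens (ofPreWeb (f.cast ha hb)) (𝟙 (⟨t⟩ : PWeb k)) ≍ tens (ofPreWeb f) (𝟙 (⟨t⟩ : PWeb k)) :=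
  tens_heq ha.symm hb.symm rfl rfl (ofPreWeb_cast_heq ha hb f) HEq.rfl

theorem ofPreWeb_comp {a b c : List ℕ+} (f : PreWeb k a b) (g : PreWeb k b c) :
    ofPreWeb (f.comp g) = ofPreWeb f ≫ ofPreWeb g := rfl

theorem ofPreWeb_comp_tens {a b c : List ℕ+} (f : PreWeb k a b) (g : PreWeb k b c) (t : List ℕ+) :
    tens (ofPreWeb (f.comp g)) (𝟙 (⟨t⟩ : PWeb k)) =
      tens (ofPreWeb f) (𝟙 (⟨t⟩ : PWeb k)) ≫ tens (ofPreWeb g) (𝟙 (⟨t⟩ : PWeb k)) :=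
  tens_comp_id t (ofPreWeb f) (ofPreWeb g)

theorem tail_heq_id {a b : List ℕ+} {f : (⟨a⟩ : PWeb k) ⟶ ⟨b⟩} {c : List ℕ+} (t : List ℕ+)
    (ha : a = c) (hb : b = c) (h : f ≍ 𝟙 (⟨c⟩ : PWeb k)) :
    tens f (𝟙 (⟨t⟩ : PWeb k)) ≍ 𝟙 (⟨c ++ t⟩ : PWeb k) := by
  subst ha hb; cases h; exact heq_of_eq (tens_id_id _ _)

/-- `wd (0 :: b :: t)` reduces to `wd (b :: t)`, so that a merge with an empty strand can be read as
an endomorphism. -/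
theorem mg_zero_left {b : ℕ} (h : 0 + b = b) (t : List ℕ) :
    (mg 0 b b h t : LHom k (b :: t) (b :: t)) = 𝟙 _ := by
  refine eq_of_heq ((mg_heq h t).trans (tail_heq_id (c := strand b) _ rfl (by rw [h]) ?_))
  rw [ofPreWeb_rel (.zero_merge b)]
  exact ofPreWeb_cast_heq _ _ _

theorem mg_zero_right {a : ℕ} (h : a + 0 = a) (t : List ℕ) :
    (mg a 0 a h t : LHom k (a :: t) (a :: t)) = 𝟙 _ := by
  refine eq_of_heq ((mg_heq h t).trans (tail_heq_id (c := strand a) _ (List.append_nil _) rfl ?_))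
  rw [ofPreWeb_rel (.merge_zero a)]
  exact ofPreWeb_cast_heq _ _ _

theorem sp_zero_left {b : ℕ} (h : 0 + b = b) (t : List ℕ) :
    (sp 0 b b h t : LHom k (b :: t) (b :: t)) = 𝟙 _ := by
  refine eq_of_heq ((sp_heq h t).trans (tail_heq_id (c := strand b) _ (by rw [h]) rfl ?_))
  rw [ofPreWeb_rel (.zero_split b)]
  exact ofPreWeb_cast_heq _ _ _

theorem sp_zero_right {a : ℕ} (h : a + 0 = a) (t : List ℕ) :
    (sp a 0 a h t : LHom k (a :: t) (a :: t)) = 𝟙 _ := by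
  refine eq_of_heq ((sp_heq h t).trans (tail_heq_id (c := strand a) _ rfl (List.append_nil _) ?_))
  rw [ofPreWeb_rel (.split_zero a)]
  exact ofPreWeb_cast_heq _ _ _

section

variable {a b c x y z : ℕ} (t : List ℕ)

theorem mg_cons_heq (h : a + b = c) (e : ℕ) :
    (mg a b c h (e :: t) : LHom k _ _) ≍
      tens (tens (ofPreWeb (.merge a b)) (𝟙 (⟨strand e⟩ : PWeb k))) (𝟙 (⟨wd t⟩ : PWeb k)) :=
  (mg_heq h _).trans (tail_cons_heq _ _ _)

theorem sp_cons_heq (h : a + b = c) (e : ℕ) :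
    (sp a b c h (e :: t) : LHom k _ _) ≍
      tens (tens (ofPreWeb (.split a b)) (𝟙 (⟨strand e⟩ : PWeb k))) (𝟙 (⟨wd t⟩ : PWeb k)) :=
  (sp_heq h _).trans (tail_cons_heq _ _ _)

theorem L_mg_heq (h : a + b = c) (e : ℕ) :
    (L e (mg a b c h t) : LHom k _ _) ≍
      tens (tens (𝟙 (⟨strand e⟩ : PWeb k)) (ofPreWeb (.merge a b))) (𝟙 (⟨wd t⟩ : PWeb k)) :=
  L_heq e _ _ (List.append_assoc _ _ _).symm (by subst h; rfl) (mg_heq h t)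

theorem L_sp_heq (h : a + b = c) (e : ℕ) :
    (L e (sp a b c h t) : LHom k _ _) ≍
      tens (tens (𝟙 (⟨strand e⟩ : PWeb k)) (ofPreWeb (.split a b))) (𝟙 (⟨wd t⟩ : PWeb k)) :=
  L_heq e _ _ (by subst h; rfl) (List.append_assoc _ _ _).symm (sp_heq h t)

/-- The sums of labels are variables bound by equations, so the relation can be used whatever form
the labels have. -/
theorem mg_assoc (hx : a + b = x) (hy : x + c = y) (hz : b + c = z) (hy' : a + z = y) :
    (mg a b x hx (c :: t) ≫ mg x c y hy t : LHom k _ _) =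
      L a (mg b c z hz t) ≫ mg a z y hy' t := by
  subst hx hz hy
  have e1 : wd (a :: b :: c :: t) = (strand a ++ strand b) ++ strand c ++ wd t := by simp [wd]
  have e2 : wd (a :: b :: c :: t) = strand a ++ (strand b ++ strand c) ++ wd t := by simp [wd]
  have e3 : strand (a + b + c) ++ wd t = strand (a + (b + c)) ++ wd t := by rw [Nat.add_assoc]
  refine eq_of_heq (HEq.trans (comp_heq e1 (List.append_assoc _ _ _).symm rfl
    (mg_cons_heq t rfl c) (mg_heq rfl t)) ?_)
  refine HEq.trans ?_ (comp_heq e2 (List.append_assoc _ _ _).symm e3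
    (L_mg_heq t rfl a) (mg_heq hy' t)).symm
  refine (heq_of_eq (tens_comp_id _ _ _).symm).trans
    (HEq.trans ?_ (heq_of_eq (tens_comp_id _ _ _)))
  refine tens_heq (List.append_assoc _ _ _) (by rw [Nat.add_assoc]) rfl rfl ?_ HEq.rfl
  exact (ofPreWeb_cast_heq _ _ _).symm.trans (heq_of_eq (ofPreWeb_rel (.assoc_merge a b c)))

theorem sp_assoc (hx : a + b = x) (hy : x + c = y) (hz : b + c = z) (hy' : a + z = y) :
    (sp x c y hy t ≫ sp a b x hx (c :: t) : LHom k _ _) =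
      sp a z y hy' t ≫ L a (sp b c z hz t) := by
  subst hx hz hy
  have e1 : wd (a :: b :: c :: t) = (strand a ++ strand b) ++ strand c ++ wd t := by simp [wd]
  have e2 : wd (a :: b :: c :: t) = strand a ++ (strand b ++ strand c) ++ wd t := by simp [wd]
  have e3 : strand (a + b + c) ++ wd t = strand (a + (b + c)) ++ wd t := by rw [Nat.add_assoc]
  refine eq_of_heq (HEq.trans (comp_heq rfl (List.append_assoc _ _ _).symm e1
    (sp_heq rfl t) (sp_cons_heq t rfl c)) ?_)
  refine HEq.trans ?_ (comp_heq e3 (List.append_assoc _ _ _).symm e2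
    (sp_heq hy' t) (L_sp_heq t rfl a)).symm
  refine (heq_of_eq (tens_comp_id _ _ _).symm).trans
    (HEq.trans ?_ (heq_of_eq (tens_comp_id _ _ _)))
  refine tens_heq (by rw [Nat.add_assoc]) (List.append_assoc _ _ _) rfl rfl ?_ HEq.rfl
  exact (ofPreWeb_cast_heq _ _ _).symm.trans (heq_of_eq (ofPreWeb_rel (.assoc_split a b c)))

theorem mg_antenna (h : 1 + 1 = 2) : mg 1 1 2 h t ≫ an t = (cp t : LHom k _ _) := by
  refine eq_of_heq (HEq.trans (comp_heq (List.append_assoc _ _ _).symm rfl rfl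
    (mg_heq h t) HEq.rfl) (heq_of_eq ?_))
  exact (tens_comp_id _ _ _).symm.trans (congrArg (tens · _) (ofPreWeb_rel .antenna_retraction))

theorem antenna_eq (h : 1 + 1 = 2) : (an t : LHom k _ _) = (⅟2 : k) • (sp 1 1 2 h t ≫ cp t) := by
  have h1 : (sp 1 1 2 h t ≫ cp t : LHom k _ _) =
      tens (ofPreWeb (.split 1 1) ≫ ofPreWeb .cap) (𝟙 (⟨wd t⟩ : PWeb k)) :=
    eq_of_heq ((comp_heq rfl (List.append_assoc _ _ _).symm rfl (sp_heq h t) HEq.rfl).trans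
      (heq_of_eq (tens_comp_id _ _ _).symm))
  rw [h1]
  exact tens_smul_left (⅟2 : k) (ofPreWeb (.split 1 1) ≫ ofPreWeb .cap) (𝟙 (⟨wd t⟩ : PWeb k))

end

section

variable {a b c d a' b' : ℕ} (t : List ℕ)

theorem pr_comp (f : PairHom k a b c d) (g : PairHom k c d a' b') :
    pr (f ≫ g) t = pr f t ≫ pr g t := by
  refine eq_of_heq ((pr_heq _ t).trans ((heq_of_eq (tens_comp_id _ _ _)).trans ?_))
  exact (comp_heq (List.append_assoc _ _ _).symm (List.append_assoc _ _ _).symm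
    (List.append_assoc _ _ _).symm (pr_heq f t) (pr_heq g t)).symm

theorem pr_add (f g : PairHom k a b c d) : pr (f + g) t = pr f t + pr g t := by
  simp only [pr, tens_add_left, Preadditive.add_comp, Preadditive.comp_add]

theorem pr_smul (x : k) (f : PairHom k a b c d) : pr (x • f) t = x • pr f t := by
  simp only [pr, tens_smul_left, Linear.smul_comp, Linear.comp_smul]

/-- Adding strands on the right as a linear map. -/
def prLin (a b c d : ℕ) : PairHom k a b c d →ₗ[k] LHom k (a :: b :: t) (c :: d :: t) where
  toFun f := pr f t
  map_add' := pr_add t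
  map_smul' := pr_smul t

theorem pr_zero : pr (0 : PairHom k a b c d) t = 0 := map_zero (prLin t a b c d)

theorem pr_sum {ι : Type*} (s : Finset ι) (f : ι → PairHom k a b c d) :
    pr (∑ i ∈ s, f i) t = ∑ i ∈ s, pr (f i) t := map_sum (prLin t a b c d) f s

end

/-- A rung from left to right. -/
def rR (s a b c d : ℕ) (t : List ℕ) : LHom k (a :: b :: t) (c :: d :: t) :=
  pr (ofPreWeb (PreWeb.rungRight s a b c d)) t

/-- A rung from right to left. -/
def rL (r a b c d : ℕ) (t : List ℕ) : LHom k (a :: b :: t) (c :: d :: t) :=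
  pr (ofPreWeb (PreWeb.rungLeft r a b c d)) t

/-- A cap between two strands. -/
def capB (a b c d : ℕ) (t : List ℕ) : LHom k (a :: b :: t) (c :: d :: t) :=
  pr (ofPreWeb (PreWeb.capBetween a b c d)) t

/-- An antenna on the left strand. -/
def antR (a b c : ℕ) (t : List ℕ) : LHom k (a :: b :: t) (c :: b :: t) :=
  pr (ofPreWeb (PreWeb.antennaRight a b c)) t

/-- An antenna on the right strand. -/
def antL (a b d : ℕ) (t : List ℕ) : LHom k (a :: b :: t) (a :: d :: t) :=
  pr (ofPreWeb (PreWeb.antennaLeft a b d)) t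

section

variable {a b c d s : ℕ} (t : List ℕ)

theorem rR_eq (h : c + s = a) (h' : s + b = d) :
    (rR s a b c d t : LHom k _ _) = sp c s a h (b :: t) ≫ L c (mg s b d h' t) := by
  subst h h'
  have e : wd (c :: s :: b :: t) = strand c ++ (strand s ++ strand b) ++ wd t := by simp [wd]
  refine (congrArg (fun f => pr (ofPreWeb f) t) (dif_pos ⟨rfl, rfl⟩)).trans ?_
  refine eq_of_heq ((pr_heq _ t).trans ((heq_of_eq (ofPreWeb_comp_tens _ _ _)).trans ?_))
  exact comp_heq (List.append_assoc _ _ _) e.symm (List.append_assoc _ _ _)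
    ((tens_cast_heq _ _ _ _).trans (sp_cons_heq t rfl b).symm) ((tens_cast_heq _ _ _ _).trans (L_mg_heq t rfl c).symm)

theorem rR_eq_zero (h : ¬ (c + s = a ∧ s + b = d)) : (rR s a b c d t : LHom k _ _) = 0 := by
  rw [rR, PreWeb.rungRight, dif_neg h]
  exact pr_zero t

theorem rL_eq (h : a + s = c) (h' : s + d = b) :
    (rL s a b c d t : LHom k _ _) = L a (sp s d b h' t) ≫ mg a s c h (d :: t) := by
  subst h h'
  have e : wd (a :: s :: d :: t) = (strand a ++ strand s) ++ strand d ++ wd t := by simp [wd]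
  refine (congrArg (fun f => pr (ofPreWeb f) t) (dif_pos ⟨rfl, rfl⟩)).trans ?_
  refine eq_of_heq ((pr_heq _ t).trans ((heq_of_eq (ofPreWeb_comp_tens _ _ _)).trans ?_))
  exact comp_heq (List.append_assoc _ _ _) e.symm (List.append_assoc _ _ _)
    ((tens_cast_heq _ _ _ _).trans (L_sp_heq t rfl a).symm) ((tens_cast_heq _ _ _ _).trans (mg_cons_heq t rfl d).symm)

theorem rL_eq_zero (h : ¬ (a + s = c ∧ s + d = b)) : (rL s a b c d t : LHom k _ _) = 0 := by
  rw [rL, PreWeb.rungLeft, dif_neg h]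
  exact pr_zero t

theorem capB_eq_zero (h : ¬ (c + 1 = a ∧ 1 + d = b)) : (capB a b c d t : LHom k _ _) = 0 := by
  exact (congrArg (fun f => pr (ofPreWeb f) t) (dif_neg h)).trans (pr_zero t)

theorem capB_eq (h : c + 1 = a) (h' : 1 + d = b) :
    (capB a b c d t : LHom k _ _) =
      sp c 1 a h (b :: t) ≫ L c (L 1 (sp 1 d b h' t)) ≫ L c (cp (d :: t)) := by
  subst h h'
  have e0 : wd (c :: 1 :: (1 + d) :: t) = (strand c ++ strand 1) ++ strand (1 + d) ++ wd t := by
    simp [wd]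
  have e1 : wd (c :: 1 :: 1 :: d :: t) =
    (strand c ++ strand 1) ++ (strand 1 ++ strand d) ++ wd t := by simp [wd]
  have e2 : wd (c :: 1 :: 1 :: d :: t) =
    strand c ++ ((strand 1 ++ strand 1) ++ strand d) ++ wd t := by simp [wd]
  -- The tensor product of the two splits is the left split followed by the right one, with no sign
  -- as both are even.
  have h1 : (sp c 1 (c + 1) rfl ((1 + d) :: t) ≫ L c (L 1 (sp 1 d (1 + d) rfl t)) : LHom k _ _) ≍
      tens (tens (ofPreWeb (.split c 1)) (ofPreWeb (.split 1 d))) (𝟙 (⟨wd t⟩ : PWeb k)) := by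
    have h2 : (L c (L 1 (sp 1 d (1 + d) rfl t)) : LHom k _ _) ≍
        tens (tens (𝟙 (⟨strand c ++ strand 1⟩ : PWeb k)) (ofPreWeb (.split 1 d)))
          (𝟙 (⟨wd t⟩ : PWeb k)) := by
      refine (L_heq c _ _ (by simp [wd]) (by simp [wd]) (L_sp_heq t rfl 1)).trans ?_
      refine tens_heq (by simp) (by simp) rfl rfl ?_ HEq.rfl
      refine (tens_assoc_heq _ _ _).symm.trans (heq_of_eq (congrArg (tens · _) (tens_id_id _ _)))
    refine (comp_heq (List.append_assoc _ _ _).symm e0 e1 (sp_cons_heq t rfl _) h2).trans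
      (heq_of_eq ?_)
    refine (tens_comp_id _ _ _).symm.trans (congrArg (tens · _) ?_)
    exact tens_id_comp_id_tens _ (ofPreWeb_mem (.split c 1))
  have h3 : (L c (cp (d :: t)) : LHom k _ _) ≍
      tens (tens (𝟙 (⟨strand c⟩ : PWeb k)) (tens (ofPreWeb .cap) (𝟙 (⟨strand d⟩ : PWeb k))))
        (𝟙 (⟨wd t⟩ : PWeb k)) :=
    L_heq c _ _ (by simp [wd]) (by simp [wd]) (tail_cons_heq _ _ _)
  rw [← Category.assoc]
  refine (congrArg (fun f => pr (ofPreWeb f) t) (dif_pos ⟨rfl, rfl⟩)).trans ?_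
  refine eq_of_heq ((pr_heq _ t).trans ((heq_of_eq (ofPreWeb_comp_tens _ _ _)).trans ?_))
  exact comp_heq (List.append_assoc _ _ _) e2.symm (List.append_assoc _ _ _)
    ((tens_cast_heq _ _ _ _).trans h1.symm) h3.symm

theorem antR_eq (h : c + 2 = a) :
    (antR a b c t : LHom k _ _) = sp c 2 a h (b :: t) ≫ L c (an (b :: t)) := by
  subst h
  have e : wd (c :: 2 :: b :: t) = strand c ++ (strand 2 ++ strand b) ++ wd t := by simp [wd]
  have h3 : (L c (an (b :: t)) : LHom k _ _) ≍
      tens (tens (𝟙 (⟨strand c⟩ : PWeb k)) (tens (ofPreWeb .antenna) (𝟙 (⟨strand b⟩ : PWeb k))))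
        (𝟙 (⟨wd t⟩ : PWeb k)) :=
    L_heq c _ _ (by simp [wd]) (by simp [wd]) (tail_cons_heq _ _ _)
  refine (congrArg (fun f => pr (ofPreWeb f) t) (dif_pos rfl)).trans ?_
  refine eq_of_heq ((pr_heq _ t).trans ((heq_of_eq (ofPreWeb_comp_tens _ _ _)).trans ?_))
  exact comp_heq (List.append_assoc _ _ _) e.symm (List.append_assoc _ _ _)
    ((tens_cast_heq _ _ _ _).trans (sp_cons_heq t rfl b).symm) (h3.symm)

theorem antL_eq (h : 2 + d = b) :
    (antL a b d t : LHom k _ _) = L a (sp 2 d b h t) ≫ L a (an (d :: t)) := by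
  subst h
  have e : wd (a :: 2 :: d :: t) = strand a ++ (strand 2 ++ strand d) ++ wd t := by simp [wd]
  have h3 : (L a (an (d :: t)) : LHom k _ _) ≍
      tens (tens (𝟙 (⟨strand a⟩ : PWeb k)) (tens (ofPreWeb .antenna) (𝟙 (⟨strand d⟩ : PWeb k))))
        (𝟙 (⟨wd t⟩ : PWeb k)) :=
    L_heq a _ _ (by simp [wd]) (by simp [wd]) (tail_cons_heq _ _ _)
  refine (congrArg (fun f => pr (ofPreWeb f) t) (dif_pos rfl)).trans ?_
  refine eq_of_heq ((pr_heq _ t).trans ((heq_of_eq (ofPreWeb_comp_tens _ _ _)).trans ?_))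
  exact comp_heq (List.append_assoc _ _ _) e.symm (List.append_assoc _ _ _)
    ((tens_cast_heq _ _ _ _).trans (L_sp_heq t rfl a).symm) (h3.symm)

end

end PWeb

/-! ### Rung swap, cap and digon relations with further strands on the right. -/

namespace PWeb

variable {k : Type u} [CommRing k] [Invertible (2 : k)]

theorem ofPreWeb_sum {a b : List ℕ+} (n : ℕ) (f : ℕ → PreWeb k a b) :
    ofPreWeb (PreWeb.sum n f) = ∑ i ∈ Finset.range n, ofPreWeb (f i) := by
  induction n with
  | zero => rfl
  | succ n ih => rw [Finset.sum_range_succ, ← ih]; rfl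

theorem ofPreWeb_add {a b : List ℕ+} (f g : PreWeb k a b) :
    ofPreWeb (f.add g) = ofPreWeb f + ofPreWeb g := rfl

theorem ofPreWeb_smul {a b : List ℕ+} (x : k) (f : PreWeb k a b) :
    ofPreWeb (.smul x f) = x • ofPreWeb f := rfl

section

variable (t : List ℕ)

theorem rung_swap {a b a' b' : ℕ} (r s c d : ℕ) (ha : a - s = a') (hb : b + s = b')
    (hc : c + s = a + r) (hd : d + r = b + s) :
    (rR s a b a' b' t ≫ rL r a' b' c d t : LHom k _ _) =
      ∑ i ∈ Finset.range (min r s + 1), Ring.choose ((a : ℤ) - b + r - s) i •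
        (rL (r - i) a b (a + (r - i)) (b - (r - i)) t ≫
          rR (s - i) (a + (r - i)) (b - (r - i)) c d t) := by
  subst ha hb
  have h := congrArg (fun f => pr f t) (ofPreWeb_rel (k := k) (.rung_swap a b r s c d hc hd))
  simp only [ofPreWeb_sum, ofPreWeb_comp, ofPreWeb_smul, pr_sum, pr_comp, pr_smul] at h
  simp only [Int.cast_smul_eq_zsmul] at h
  exact h

/-- The cap and rungs from left to right. -/
theorem rR_capB {a b r c d a₁ b₁ a₂ b₂ a₃ : ℕ} (h1 : a₁ + (r + 1) = a) (h2 : b + (r + 1) = b₁)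
    (h3 : c + 1 = a₁) (h4 : d + 1 = b₁) (h5 : a₂ + 1 = a) (h6 : b - 1 = b₂) (h7 : a₃ + 2 = a) :
    (rR (r + 1) a b a₁ b₁ t ≫ capB a₁ b₁ c d t : LHom k _ _) =
      capB a b a₂ b₂ t ≫ rR (r + 1) a₂ b₂ c d t +
        (2 : k) • (antR a b a₃ t ≫ rR r a₃ b c d t) := by
  obtain rfl : a₁ = a - (r + 1) := by omega
  obtain rfl : a₂ = a - 1 := by omega
  obtain rfl : a₃ = a - 2 := by omega
  subst h2 h6
  have h := congrArg (fun f => pr f t)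
    (ofPreWeb_rel (k := k) (.cap_rungRight a b (r + 1) c d (by omega) (by omega)))
  -- The rung label is written `r + 1` because the antenna term is absent for the label `0`.
  rw [if_neg (Nat.succ_ne_zero r)] at h
  simp only [ofPreWeb_add, ofPreWeb_comp, ofPreWeb_smul, pr_add, pr_comp, pr_smul] at h
  exact h

/-- The cap and rungs from right to left. -/
theorem rL_capB {a b r c d a₁ b₁ a₂ b₂ b₃ : ℕ} (h1 : a + (r + 1) = a₁) (h2 : b₁ + (r + 1) = b)
    (h3 : c + 1 = a₁) (h4 : d + 1 = b₁) (h5 : a - 1 = a₂) (h6 : b₂ + 1 = b) (h7 : b₃ + 2 = b) :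
    (rL (r + 1) a b a₁ b₁ t ≫ capB a₁ b₁ c d t : LHom k _ _) =
      capB a b a₂ b₂ t ≫ rL (r + 1) a₂ b₂ c d t +
        (2 : k) • (antL a b b₃ t ≫ rL r a b₃ c d t) := by
  obtain rfl : b₁ = b - (r + 1) := by omega
  obtain rfl : b₂ = b - 1 := by omega
  obtain rfl : b₃ = b - 2 := by omega
  subst h1 h5
  have h := congrArg (fun f => pr f t)
    (ofPreWeb_rel (k := k) (.cap_rungLeft a b (r + 1) c d (by omega) (by omega)))
  rw [if_neg (Nat.succ_ne_zero r)] at h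
  simp only [ofPreWeb_add, ofPreWeb_comp, ofPreWeb_smul, pr_add, pr_comp, pr_smul] at h
  exact h

variable {a b c d : ℕ}

theorem comp_eq_right {x y : List ℕ} {f : LHom k x x} (g : LHom k x y) (h : f = 𝟙 _) :
    f ≫ g = g := by rw [h, Category.id_comp]

theorem comp_eq_left {x y : List ℕ} (f : LHom k x y) {g : LHom k y y} (h : g = 𝟙 _) :
    f ≫ g = f := by rw [h, Category.comp_id]

theorem L_eq_id {x : List ℕ} (a : ℕ) {f : LHom k x x} (h : f = 𝟙 _) : L a f = 𝟙 _ := by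
  rw [h, L_id]

theorem rR_zero : (rR 0 a b a b t : LHom k _ _) = 𝟙 _ :=
  (rR_eq t (add_zero a) (zero_add b)).trans
    ((comp_eq_right (x := a :: b :: t) (L a (mg 0 b b (zero_add b) t))
      (sp_zero_right (add_zero a) (b :: t))).trans (L_eq_id a (mg_zero_left (zero_add b) t)))

theorem rL_zero : (rL 0 a b a b t : LHom k _ _) = 𝟙 _ :=
  (rL_eq t (add_zero a) (zero_add b)).trans
    ((comp_eq_left (y := a :: b :: t) (L a (sp 0 b b (zero_add b) t))
      (mg_zero_right (add_zero a) (b :: t))).trans (L_eq_id a (sp_zero_left (zero_add b) t)))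

/-- A rung that takes the whole right strand is a merge. -/
theorem rL_merge (h : a + b = c) : (rL b a b c 0 t : LHom k _ (c :: t)) = mg a b c h t :=
  (rL_eq t h (add_zero b)).trans (comp_eq_right (x := a :: b :: t) (mg a b c h t)
    (L_eq_id a (sp_zero_right (add_zero b) t)))

theorem rR_split (h : c + d = a) : (rR d a 0 c d t : LHom k (a :: t) _) = sp c d a h t :=
  (rR_eq t h (add_zero d)).trans (comp_eq_left (y := c :: d :: t) (sp c d a h t)
    (L_eq_id c (mg_zero_right (add_zero d) t)))

theorem rR_merge (h : a + b = d) : (rR a a b 0 d t : LHom k _ (d :: t)) = mg a b d h t :=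
  (rR_eq t (zero_add a) h).trans ((comp_eq_right (x := a :: b :: t) (L 0 (mg a b d h t))
    (sp_zero_left (zero_add a) (b :: t))).trans (L_nil _))

theorem rL_split (h : c + d = b) : (rL c 0 b c d t : LHom k (b :: t) _) = sp c d b h t :=
  (rL_eq t (zero_add c) h).trans ((comp_eq_left (y := c :: d :: t) (L 0 (sp c d b h t))
    (mg_zero_left (zero_add c) (d :: t))).trans (L_nil _))

/-- The split is a rung into an empty strand and the merge is the rung back. In the rung swap on
`(c, 0)` every term that still takes something from the empty strand vanishes, which leaves `i = b`
with coefficient `choose c b`. -/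
theorem sp_mg (h : a + b = c) :
    (sp a b c h t ≫ mg a b c h t : LHom k _ _) = (c.choose b : ℤ) • 𝟙 _ := by
  have key := rung_swap (k := k) t b b c 0 (show c - b = a by omega) (zero_add b) rfl rfl
  have h1 : (rR b c 0 a b t ≫ rL b a b c 0 t : LHom k (c :: t) (c :: t)) =
      sp a b c h t ≫ mg a b c h t := by
    exact congrArg₂ (· ≫ ·) (rR_split t h) (rL_merge t h)
  rw [Finset.sum_eq_single_of_mem b (by simp)] at key
  · rw [Nat.sub_self, Nat.add_zero, Nat.sub_zero, rL_zero, rR_zero, Category.comp_id] at key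
    refine h1.symm.trans (key.trans (congrArg (· • _) ?_))
    simp [Ring.choose_natCast]
  · intro i hi hib
    have : b - i ≠ 0 := by simp at hi; omega
    rw [rL_eq_zero t (by omega)]
    simp

end

end PWeb

namespace PWeb

variable {k : Type u} [CommRing k] [Invertible (2 : k)]

theorem L_zsmul {x y : List ℕ} (a : ℕ) (m : ℤ) (f : LHom k x y) : L a (m • f) = m • L a f :=
  map_zsmul (Llin a x y) m f

/-! ### Products of rungs -/

/-- Associativity gathers the two rungs into one strand `r + s` that splits and merges again, and
`sp_mg` evaluates this digon. -/
theorem rL_comp_rL {r s a b a₁ b₁ a₂ b₂ : ℕ} (t : List ℕ) (h₁ : a + s = a₁) (h₁' : s + b₁ = b)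
    (h₂ : a₁ + r = a₂) (h₂' : r + b₂ = b₁) :
    (rL s a b a₁ b₁ t ≫ rL r a₁ b₁ a₂ b₂ t : LHom k _ _) =
      ((r + s).choose s : ℤ) • rL (r + s) a b a₂ b₂ t := by
  rw [rL_eq t h₁ h₁', rL_eq t h₂ h₂', rL_eq t (show a + (r + s) = a₂ by omega)
    (show (r + s) + b₂ = b by omega)]
  rw [Category.assoc, ← Category.assoc (mg a s a₁ h₁ (b₁ :: t)), mg_naturality, Category.assoc,
    mg_assoc (b₂ :: t) h₁ h₂ (add_comm s r) (by omega), ← Category.assoc, ← L_comp,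
    ← sp_assoc t (add_comm s r) (by omega) h₂' h₁', L_comp, Category.assoc,
    ← Category.assoc (L a (sp s r _ _ _)), ← L_comp, sp_mg, L_zsmul, L_id,
    Preadditive.zsmul_comp, Preadditive.comp_zsmul, Category.id_comp, Nat.choose_symm_add]

theorem rR_comp_rR {r s a b a₁ b₁ a₂ b₂ : ℕ} (t : List ℕ) (h₁ : a₁ + s = a) (h₁' : s + b = b₁)
    (h₂ : a₂ + r = a₁) (h₂' : r + b₁ = b₂) :
    (rR s a b a₁ b₁ t ≫ rR r a₁ b₁ a₂ b₂ t : LHom k _ _) =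
      ((r + s).choose s : ℤ) • rR (r + s) a b a₂ b₂ t := by
  rw [rR_eq t h₁ h₁', rR_eq t h₂ h₂', rR_eq t (show a₂ + (r + s) = a by omega)
    (show (r + s) + b = b₂ by omega)]
  rw [Category.assoc, ← Category.assoc (L a₁ _), ← sp_naturality, Category.assoc,
    ← Category.assoc, sp_assoc (b :: t) h₂ h₁ rfl (by omega), ← L_comp,
    ← mg_assoc t rfl (by omega) h₁' h₂', L_comp, Category.assoc,
    ← Category.assoc (L a₂ (sp r s _ _ _)), ← L_comp, sp_mg, L_zsmul, L_id,
    Preadditive.zsmul_comp, Preadditive.comp_zsmul, Category.id_comp]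

/-! ### The operators of rungs on webs with three strands at the top -/

/-- Triples of labels with sum `n`. -/
abbrev Labels (n : ℕ) : Type := {x : ℕ × ℕ × ℕ // x.1 + x.2.1 + x.2.2 = n}

variable (k) in
/-- Webs with a fixed object at the bottom and three strands with labels of sum `n` at the top. -/
abbrev LadderSpace (z : List ℕ) (n : ℕ) : Type u :=
  DirectSum (Labels n) fun i => LHom k z [i.1.1, i.1.2.1, i.1.2.2]

section

variable {z : List ℕ} {n : ℕ}

/-- A web as an element of the ladder space. -/
def vec {a b c : ℕ} (h : a + b + c = n) (g : LHom k z [a, b, c]) : LadderSpace k z n :=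
  DirectSum.lof k (Labels n) (fun i => LHom k z [i.1.1, i.1.2.1, i.1.2.2]) ⟨(a, b, c), h⟩ g

/-- `vec` as a linear map. -/
def vecLin {a b c : ℕ} (h : a + b + c = n) : LHom k z [a, b, c] →ₗ[k] LadderSpace k z n :=
  DirectSum.lof k (Labels n) (fun i => LHom k z [i.1.1, i.1.2.1, i.1.2.2]) ⟨(a, b, c), h⟩

/-- Operator identities are brought back to webs by applying them to the identity web and comparing
components. -/
theorem vec_injective {a b c : ℕ} (h : a + b + c = n) {g g' : LHom k z [a, b, c]}
    (e : vec h g = vec h g') : g = g' :=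
  DirectSum.of_injective (β := fun i : Labels n => LHom k z [i.1.1, i.1.2.1, i.1.2.2])
    ⟨(a, b, c), h⟩ e

theorem vec_zero {a b c : ℕ} (h : a + b + c = n) : vec h (0 : LHom k z [a, b, c]) = 0 :=
  map_zero (vecLin h)

theorem vec_zsmul {a b c : ℕ} (h : a + b + c = n) (m : ℤ) (g : LHom k z [a, b, c]) :
    vec h (m • g) = m • vec h g := map_zsmul (vecLin h) m g

theorem vec_sum {a b c : ℕ} (h : a + b + c = n) {ι : Type*} (s : Finset ι)
    (f : ι → LHom k z [a, b, c]) : vec h (∑ i ∈ s, f i) = ∑ i ∈ s, vec h (f i) :=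
  map_sum (vecLin h) f s

/-- The operator given on each summand by a linear map. -/
def ladderOp (φ : ∀ a b c : ℕ, a + b + c = n → LHom k z [a, b, c] →ₗ[k] LadderSpace k z n) :
    Module.End k (LadderSpace k z n) :=
  DirectSum.toModule k (Labels n) _ fun i => φ i.1.1 i.1.2.1 i.1.2.2 i.2

theorem ladderOp_vec (φ : ∀ a b c : ℕ, a + b + c = n → LHom k z [a, b, c] →ₗ[k] LadderSpace k z n)
    {a b c : ℕ} (h : a + b + c = n) (g : LHom k z [a, b, c]) :
    ladderOp φ (vec h g) = φ a b c h g :=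
  DirectSum.toModule_lof k _ _

theorem ladder_ext {x y : Module.End k (LadderSpace k z n)}
    (e : ∀ (a b c : ℕ) (h : a + b + c = n) (g : LHom k z [a, b, c]), x (vec h g) = y (vec h g)) :
    x = y := by
  refine DirectSum.linearMap_ext k fun i => LinearMap.ext fun g => ?_
  exact e i.1.1 i.1.2.1 i.1.2.2 i.2 g

variable (k z n)

/-- The projections to the webs with prescribed first label. -/
def projA (x : ℤ) : Module.End k (LadderSpace k z n) :=
  ladderOp fun a _ _ h => if x = a then vecLin h else 0

/-- The projections to the webs with prescribed second label. -/
def projB (x : ℤ) : Module.End k (LadderSpace k z n) :=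
  ladderOp fun _ b _ h => if x = b then vecLin h else 0

/-- The projections to the webs with prescribed third label. -/
def projC (x : ℤ) : Module.End k (LadderSpace k z n) :=
  ladderOp fun _ _ c h => if x = c then vecLin h else 0

/-- Rungs from the second to the first strand. -/
def opE₁ (r : ℕ) : Module.End k (LadderSpace k z n) :=
  ladderOp fun a b c h => if h' : r ≤ b then
    vecLin (a := a + r) (b := b - r) (c := c) (by omega) ∘ₗ
      Linear.rightComp k _ (rL r a b (a + r) (b - r) [c]) else 0

/-- Rungs from the first to the second strand. -/
def opF₁ (r : ℕ) : Module.End k (LadderSpace k z n) :=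
  ladderOp fun a b c h => if h' : r ≤ a then
    vecLin (a := a - r) (b := b + r) (c := c) (by omega) ∘ₗ
      Linear.rightComp k _ (rR r a b (a - r) (b + r) [c]) else 0

/-- Rungs from the third to the second strand. -/
def opE₂ (r : ℕ) : Module.End k (LadderSpace k z n) :=
  ladderOp fun a b c h => if h' : r ≤ c then
    vecLin (a := a) (b := b + r) (c := c - r) (by omega) ∘ₗ
      Linear.rightComp k _ (L a (rL r b c (b + r) (c - r) [])) else 0

/-- Rungs from the second to the third strand. -/
def opF₂ (r : ℕ) : Module.End k (LadderSpace k z n) :=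
  ladderOp fun a b c h => if h' : r ≤ b then
    vecLin (a := a) (b := b - r) (c := c + r) (by omega) ∘ₗ
      Linear.rightComp k _ (L a (rR r b c (b - r) (c + r) [])) else 0

variable {k z n}

section

variable {a b c a' b' c' : ℕ} (h : a + b + c = n) (g : LHom k z [a, b, c])

theorem projA_vec (x : ℤ) : projA k z n x (vec h g) = if x = a then vec h g else 0 := by
  rw [projA, ladderOp_vec]; split_ifs <;> rfl

theorem projB_vec (x : ℤ) : projB k z n x (vec h g) = if x = b then vec h g else 0 := by
  rw [projB, ladderOp_vec]; split_ifs <;> rfl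

theorem projC_vec (x : ℤ) : projC k z n x (vec h g) = if x = c then vec h g else 0 := by
  rw [projC, ladderOp_vec]; split_ifs <;> rfl

theorem opE₁_vec {r : ℕ} (ha : a + r = a') (hb : r + b' = b) (h' : a' + b' + c = n) :
    opE₁ k z n r (vec h g) = vec h' (g ≫ rL r a b a' b' [c]) := by
  obtain rfl : b' = b - r := by omega
  subst ha
  rw [opE₁, ladderOp_vec, dif_pos (by omega)]; rfl

theorem opE₁_vec_of_lt {r : ℕ} (hr : b < r) : opE₁ k z n r (vec h g) = 0 := by
  rw [opE₁, ladderOp_vec, dif_neg (by omega)]; rfl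

theorem opF₁_vec {r : ℕ} (ha : a' + r = a) (hb : r + b = b') (h' : a' + b' + c = n) :
    opF₁ k z n r (vec h g) = vec h' (g ≫ rR r a b a' b' [c]) := by
  obtain rfl : a' = a - r := by omega
  obtain rfl : b' = b + r := by omega
  rw [opF₁, ladderOp_vec, dif_pos (by omega)]; rfl

theorem opF₁_vec_of_lt {r : ℕ} (hr : a < r) : opF₁ k z n r (vec h g) = 0 := by
  rw [opF₁, ladderOp_vec, dif_neg (by omega)]; rfl

theorem opE₂_vec {r : ℕ} (hb : b + r = b') (hc : r + c' = c) (h' : a + b' + c' = n) :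
    opE₂ k z n r (vec h g) = vec h' (g ≫ L a (rL r b c b' c' [])) := by
  obtain rfl : c' = c - r := by omega
  subst hb
  rw [opE₂, ladderOp_vec, dif_pos (by omega)]; rfl

theorem opE₂_vec_of_lt {r : ℕ} (hr : c < r) : opE₂ k z n r (vec h g) = 0 := by
  rw [opE₂, ladderOp_vec, dif_neg (by omega)]; rfl

theorem opF₂_vec {r : ℕ} (hb : b' + r = b) (hc : r + c = c') (h' : a + b' + c' = n) :
    opF₂ k z n r (vec h g) = vec h' (g ≫ L a (rR r b c b' c' [])) := by
  obtain rfl : b' = b - r := by omega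
  obtain rfl : c' = c + r := by omega
  rw [opF₂, ladderOp_vec, dif_pos (by omega)]; rfl

theorem opF₂_vec_of_lt {r : ℕ} (hr : b < r) : opF₂ k z n r (vec h g) = 0 := by
  rw [opF₂, ladderOp_vec, dif_neg (by omega)]; rfl

end

end

end PWeb

namespace PWeb

variable {k : Type u} [CommRing k] [Invertible (2 : k)] {z : List ℕ} {n : ℕ}

/-! ### The ladder pairs of three strands -/

theorem opE₁_mul (r s : ℕ) :
    opE₁ k z n r * opE₁ k z n s = (r + s).choose s • opE₁ k z n (r + s) := by
  refine ladder_ext fun a b c h g => ?_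
  rw [Module.End.mul_apply, LinearMap.smul_apply]
  rcases lt_or_ge b (r + s) with h1 | h1
  · rw [opE₁_vec_of_lt h g h1, smul_zero]
    rcases lt_or_ge b s with h2 | h2
    · rw [opE₁_vec_of_lt h g h2, map_zero]
    · obtain ⟨x, hx⟩ := Nat.exists_eq_add_of_le h2
      rw [opE₁_vec (a' := a + s) (b' := x) h g rfl hx.symm (by omega),
        opE₁_vec_of_lt _ _ (by omega)]
  · obtain ⟨x, hx⟩ := Nat.exists_eq_add_of_le h1
    rw [opE₁_vec (a' := a + s) (b' := r + x) h g rfl (by omega) (by omega),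
      opE₁_vec (a' := a + s + r) (b' := x) _ _ rfl rfl (by omega),
      opE₁_vec (a' := a + s + r) (b' := x) h g (by omega) (by omega) (by omega),
      Category.assoc,  rL_comp_rL _ rfl (by omega) rfl rfl, Preadditive.comp_zsmul,
      vec_zsmul, natCast_zsmul]

theorem opF₁_mul (r s : ℕ) :
    opF₁ k z n r * opF₁ k z n s = (r + s).choose s • opF₁ k z n (r + s) := by
  refine ladder_ext fun a b c h g => ?_
  rw [Module.End.mul_apply, LinearMap.smul_apply]
  rcases lt_or_ge a (r + s) with h1 | h1
  · rw [opF₁_vec_of_lt h g h1, smul_zero]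
    rcases lt_or_ge a s with h2 | h2
    · rw [opF₁_vec_of_lt h g h2, map_zero]
    · obtain ⟨x, hx⟩ := Nat.exists_eq_add_of_le' h2
      rw [opF₁_vec (a' := x) (b' := s + b) h g hx.symm rfl (by omega),
        opF₁_vec_of_lt _ _ (by omega)]
  · obtain ⟨x, hx⟩ := Nat.exists_eq_add_of_le' h1
    rw [opF₁_vec (a' := x + r) (b' := s + b) h g (by omega) rfl (by omega),
      opF₁_vec (a' := x) (b' := r + (s + b)) _ _ rfl rfl (by omega),
      opF₁_vec (a' := x) (b' := r + (s + b)) h g (by omega) (by omega) (by omega),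
      Category.assoc,  rR_comp_rR _ (by omega) rfl rfl rfl, Preadditive.comp_zsmul,
      vec_zsmul, natCast_zsmul]

theorem opE₁_opF₁ {a b c : ℕ} (h : a + b + c = n) (g : LHom k z [a, b, c]) (r s : ℕ)
    (hs : s ≤ a + r) (hr : r ≤ b + s) :
    opE₁ k z n r (opF₁ k z n s (vec h g)) =
      ∑ t ∈ Finset.range (min r s + 1), Ring.choose ((a : ℤ) - b + r - s) t •
        opF₁ k z n (s - t) (opE₁ k z n (r - t) (vec h g)) := by
  obtain ⟨x, hx⟩ := Nat.exists_eq_add_of_le' hs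
  obtain ⟨y, hy⟩ := Nat.exists_eq_add_of_le' hr
  have h' : x + y + c = n := by omega
  have key := rung_swap (k := k) [c] r s x y (a := a) (b := b) rfl rfl hx.symm hy.symm
  have e1 : opE₁ k z n r (opF₁ k z n s (vec h g)) = vec h' (g ≫ (rR s a b (a - s) (b + s) [c] ≫
      rL r (a - s) (b + s) x y [c])) := by
    -- For `s > a` the truncated difference `a - s` is `0`, but the labels of the rung then do not
    -- match and the rung is zero, as is the operator.
    rcases lt_or_ge a s with h1 | h1
    · rw [opF₁_vec_of_lt h g h1, map_zero, rR_eq_zero _ (by omega), Limits.zero_comp, Limits.comp_zero,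
        vec_zero]
    · rw [opF₁_vec (a' := a - s) (b' := b + s) h g (by omega) (by omega) (by omega),
        opE₁_vec (a' := x) (b' := y) _ _ (by omega) (by omega) h', Category.assoc]
  rw [e1, key, Preadditive.comp_sum, vec_sum]
  refine Finset.sum_congr rfl fun t ht => ?_
  rw [Preadditive.comp_zsmul, vec_zsmul]
  congr 1
  have ht' : t ≤ r ∧ t ≤ s := by simp at ht; omega
  rcases lt_or_ge b (r - t) with h1 | h1
  · rw [opE₁_vec_of_lt h g h1, map_zero, rL_eq_zero _ (by omega), Limits.zero_comp, Limits.comp_zero,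
      vec_zero]
  · rw [opE₁_vec (a' := a + (r - t)) (b' := b - (r - t)) h g (by omega) (by omega) (by omega),
      opF₁_vec (a' := x) (b' := y) _ _ (by omega) (by omega) h', Category.assoc]

theorem ladderPair₁ : LadderPair n (projA k z n) (projB k z n) (extendByZero (opE₁ k z n))
    (extendByZero (opF₁ k z n)) := by
  have expand : ∀ {P : (Σ i : Labels n, LHom k z [i.1.1, i.1.2.1, i.1.2.2]) → Prop},
      (∀ (a b c : ℕ) (h : a + b + c = n) (g : LHom k z [a, b, c]), P ⟨⟨(a, b, c), h⟩, g⟩) → ∀ i, P i :=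
    fun hP i => hP _ _ _ i.1.2 i.2
  refine LadderPair.of_vectors
    (v := fun i : Σ i : Labels n, LHom k z [i.1.1, i.1.2.1, i.1.2.2] => vec i.1.2 i.2)
    (α := fun i => i.1.1.1) (β := fun i => i.1.1.2.1)
    (fun x y e => ladder_ext fun a b c h g => e ⟨⟨(a, b, c), h⟩, g⟩)
    (fun i => by have := i.1.2; omega) (fun i x => projA_vec _ _ x) (fun i x => projB_vec _ _ x)
    ?_ ?_ (fun i r hr => opE₁_vec_of_lt _ _ hr) (fun i r hr => opF₁_vec_of_lt _ _ hr)
    (expand fun a b c h g r x hr => ?_) (expand fun a b c h g r x hr => ?_)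
    (expand fun a b c h g r x hr => ?_) (expand fun a b c h g r x hr => ?_)
    opE₁_mul opF₁_mul (expand fun a b c h g r s hs hr => opE₁_opF₁ h g r s hs hr)
  · refine ladder_ext fun a b c h g => ?_
    rw [opE₁_vec (a' := a) (b' := b) h g rfl (zero_add _) h, rL_zero, Category.comp_id]; rfl
  · refine ladder_ext fun a b c h g => ?_
    rw [opF₁_vec (a' := a) (b' := b) h g rfl (zero_add _) h, rR_zero, Category.comp_id]; rfl
  all_goals dsimp only at hr ⊢
  · obtain ⟨y, hy⟩ := Nat.exists_eq_add_of_le hr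
    rw [opE₁_vec (a' := a + r) (b' := y) h g rfl hy.symm (by omega), projA_vec, Nat.cast_add]
  · obtain ⟨y, hy⟩ := Nat.exists_eq_add_of_le hr
    rw [opE₁_vec (a' := a + r) (b' := y) h g rfl hy.symm (by omega), projB_vec,
      show (y : ℤ) = b - r by omega]
  · obtain ⟨y, hy⟩ := Nat.exists_eq_add_of_le' hr
    rw [opF₁_vec (a' := y) (b' := r + b) h g hy.symm rfl (by omega), projA_vec,
      show (y : ℤ) = a - r by omega]
  · obtain ⟨y, hy⟩ := Nat.exists_eq_add_of_le' hr
    rw [opF₁_vec (a' := y) (b' := r + b) h g hy.symm rfl (by omega), projB_vec,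
      Nat.cast_add, add_comm (r : ℤ)]

theorem opE₂_mul (r s : ℕ) :
    opE₂ k z n r * opE₂ k z n s = (r + s).choose s • opE₂ k z n (r + s) := by
  refine ladder_ext fun a b c h g => ?_
  rw [Module.End.mul_apply, LinearMap.smul_apply]
  rcases lt_or_ge c (r + s) with h1 | h1
  · rw [opE₂_vec_of_lt h g h1, smul_zero]
    rcases lt_or_ge c s with h2 | h2
    · rw [opE₂_vec_of_lt h g h2, map_zero]
    · obtain ⟨x, hx⟩ := Nat.exists_eq_add_of_le h2
      rw [opE₂_vec (b' := b + s) (c' := x) h g rfl hx.symm (by omega),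
        opE₂_vec_of_lt _ _ (by omega)]
  · obtain ⟨x, hx⟩ := Nat.exists_eq_add_of_le h1
    rw [opE₂_vec (b' := b + s) (c' := r + x) h g rfl (by omega) (by omega),
      opE₂_vec (b' := b + s + r) (c' := x) _ _ rfl rfl (by omega),
      opE₂_vec (b' := b + s + r) (c' := x) h g (by omega) (by omega) (by omega),
      Category.assoc, ← L_comp, rL_comp_rL _ rfl (by omega) rfl rfl, L_zsmul, Preadditive.comp_zsmul,
      vec_zsmul, natCast_zsmul]

theorem opF₂_mul (r s : ℕ) :
    opF₂ k z n r * opF₂ k z n s = (r + s).choose s • opF₂ k z n (r + s) := by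
  refine ladder_ext fun a b c h g => ?_
  rw [Module.End.mul_apply, LinearMap.smul_apply]
  rcases lt_or_ge b (r + s) with h1 | h1
  · rw [opF₂_vec_of_lt h g h1, smul_zero]
    rcases lt_or_ge b s with h2 | h2
    · rw [opF₂_vec_of_lt h g h2, map_zero]
    · obtain ⟨x, hx⟩ := Nat.exists_eq_add_of_le' h2
      rw [opF₂_vec (b' := x) (c' := s + c) h g hx.symm rfl (by omega),
        opF₂_vec_of_lt _ _ (by omega)]
  · obtain ⟨x, hx⟩ := Nat.exists_eq_add_of_le' h1
    rw [opF₂_vec (b' := x + r) (c' := s + c) h g (by omega) rfl (by omega),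
      opF₂_vec (b' := x) (c' := r + (s + c)) _ _ rfl rfl (by omega),
      opF₂_vec (b' := x) (c' := r + (s + c)) h g (by omega) (by omega) (by omega),
      Category.assoc, ← L_comp, rR_comp_rR _ (by omega) rfl rfl rfl, L_zsmul, Preadditive.comp_zsmul,
      vec_zsmul, natCast_zsmul]

theorem opE₂_opF₂ {a b c : ℕ} (h : a + b + c = n) (g : LHom k z [a, b, c]) (r s : ℕ)
    (hs : s ≤ b + r) (hr : r ≤ c + s) :
    opE₂ k z n r (opF₂ k z n s (vec h g)) =
      ∑ t ∈ Finset.range (min r s + 1), Ring.choose ((b : ℤ) - c + r - s) t •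
        opF₂ k z n (s - t) (opE₂ k z n (r - t) (vec h g)) := by
  obtain ⟨x, hx⟩ := Nat.exists_eq_add_of_le' hs
  obtain ⟨y, hy⟩ := Nat.exists_eq_add_of_le' hr
  have h' : a + x + y = n := by omega
  have key := rung_swap (k := k) [] r s x y (a := b) (b := c) rfl rfl hx.symm hy.symm
  have e1 : opE₂ k z n r (opF₂ k z n s (vec h g)) = vec h' (g ≫ L a (rR s b c (b - s) (c + s) [] ≫
      rL r (b - s) (c + s) x y [])) := by
    rcases lt_or_ge b s with h1 | h1
    · rw [opF₂_vec_of_lt h g h1, map_zero, rR_eq_zero _ (by omega), Limits.zero_comp, L_zero, Limits.comp_zero,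
        vec_zero]
    · rw [opF₂_vec (b' := b - s) (c' := c + s) h g (by omega) (by omega) (by omega),
        opE₂_vec (b' := x) (c' := y) _ _ (by omega) (by omega) h', Category.assoc, L_comp]
  rw [e1, key, L_sum, Preadditive.comp_sum, vec_sum]
  refine Finset.sum_congr rfl fun t ht => ?_
  rw [L_zsmul, Preadditive.comp_zsmul, vec_zsmul]
  congr 1
  have ht' : t ≤ r ∧ t ≤ s := by simp at ht; omega
  rcases lt_or_ge c (r - t) with h1 | h1
  · rw [opE₂_vec_of_lt h g h1, map_zero, rL_eq_zero _ (by omega), Limits.zero_comp, L_zero, Limits.comp_zero,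
      vec_zero]
  · rw [opE₂_vec (b' := b + (r - t)) (c' := c - (r - t)) h g (by omega) (by omega) (by omega),
      opF₂_vec (b' := x) (c' := y) _ _ (by omega) (by omega) h', Category.assoc, L_comp]

theorem ladderPair₂ : LadderPair n (projB k z n) (projC k z n) (extendByZero (opE₂ k z n))
    (extendByZero (opF₂ k z n)) := by
  have expand : ∀ {P : (Σ i : Labels n, LHom k z [i.1.1, i.1.2.1, i.1.2.2]) → Prop},
      (∀ (a b c : ℕ) (h : a + b + c = n) (g : LHom k z [a, b, c]), P ⟨⟨(a, b, c), h⟩, g⟩) → ∀ i, P i :=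
    fun hP i => hP _ _ _ i.1.2 i.2
  refine LadderPair.of_vectors
    (v := fun i : Σ i : Labels n, LHom k z [i.1.1, i.1.2.1, i.1.2.2] => vec i.1.2 i.2)
    (α := fun i => i.1.1.2.1) (β := fun i => i.1.1.2.2)
    (fun x y e => ladder_ext fun a b c h g => e ⟨⟨(a, b, c), h⟩, g⟩)
    (fun i => by have := i.1.2; omega) (fun i x => projB_vec _ _ x) (fun i x => projC_vec _ _ x)
    ?_ ?_ (fun i r hr => opE₂_vec_of_lt _ _ hr) (fun i r hr => opF₂_vec_of_lt _ _ hr)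
    (expand fun a b c h g r x hr => ?_) (expand fun a b c h g r x hr => ?_)
    (expand fun a b c h g r x hr => ?_) (expand fun a b c h g r x hr => ?_)
    opE₂_mul opF₂_mul (expand fun a b c h g r s hs hr => opE₂_opF₂ h g r s hs hr)
  · refine ladder_ext fun a b c h g => ?_
    rw [opE₂_vec (b' := b) (c' := c) h g rfl (zero_add _) h, rL_zero, L_id, Category.comp_id]; rfl
  · refine ladder_ext fun a b c h g => ?_
    rw [opF₂_vec (b' := b) (c' := c) h g rfl (zero_add _) h, rR_zero, L_id, Category.comp_id]; rfl
  all_goals dsimp only at hr ⊢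
  · obtain ⟨y, hy⟩ := Nat.exists_eq_add_of_le hr
    rw [opE₂_vec (b' := b + r) (c' := y) h g rfl hy.symm (by omega), projB_vec, Nat.cast_add]
  · obtain ⟨y, hy⟩ := Nat.exists_eq_add_of_le hr
    rw [opE₂_vec (b' := b + r) (c' := y) h g rfl hy.symm (by omega), projC_vec,
      show (y : ℤ) = c - r by omega]
  · obtain ⟨y, hy⟩ := Nat.exists_eq_add_of_le' hr
    rw [opF₂_vec (b' := y) (c' := r + c) h g hy.symm rfl (by omega), projB_vec,
      show (y : ℤ) = b - r by omega]
  · obtain ⟨y, hy⟩ := Nat.exists_eq_add_of_le' hr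
    rw [opF₂_vec (b' := y) (c' := r + c) h g hy.symm rfl (by omega), projC_vec,
      Nat.cast_add, add_comm (r : ℤ)]

end PWeb

/-! ### Vanishing alternating sums of ladders, as identities of webs. -/

namespace PWeb

variable {k : Type u} [CommRing k] [Invertible (2 : k)]

theorem sum_range_eq_of_support {M : Type*} [AddCommMonoid M] {f : ℕ → M} {m n₁ n₂ : ℕ}
    (hf : ∀ i, m < i → f i = 0) (h₁ : m ≤ n₁) (h₂ : m ≤ n₂) :
    ∑ i ∈ Finset.range (n₁ + 1), f i = ∑ i ∈ Finset.range (n₂ + 1), f i := by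
  have key : ∀ n, m ≤ n → ∑ i ∈ Finset.range (m + 1), f i = ∑ i ∈ Finset.range (n + 1), f i :=
    fun n h => Finset.sum_subset (Finset.range_subset_range.2 (by omega)) fun i _ hi =>
      hf i (by simp at hi; omega)
  rw [← key n₁ h₁, ← key n₂ h₂]

theorem intSign_sub_natCast (a i : ℕ) (h : i ≤ a) :
    intSign ((a - i : ℕ) : ℤ) = intSign a * intSign i := by
  rw [Nat.cast_sub h, intSign_sub]

/-- Alternating sums of ladders between labels that are far apart vanish. -/
theorem sum_rR_rL_eq_zero {a b c d : ℕ} (e M : ℕ) (h : a + b = c + d) (hd : d < a)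
    (hM : a ≤ M ∨ c ≤ M) :
    ∑ m ∈ Finset.range (M + 1), intSign m •
      (rR (a - m) a b m (a + b - m) [e] ≫ rL (c - m) m (a + b - m) c d [e] :
        LHom k [a, b, e] [c, d, e]) = 0 := by
  have h0 : a + b + e = a + b + e := rfl
  have h0' : c + d + e = a + b + e := by omega
  -- `sum_ladder_eq_zero` is used with `k = c - a`, where its condition `b < c` is equivalent to `d
  -- < a` because `a + b = c + d`. The index `m = a - s` is the left label between the two rungs,
  -- whence the reflection of the sum.
  have key := congrArg (fun x => x (vec h0 (𝟙 (⟨wd [a, b, e]⟩ : PWeb k))))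
    ((ladderPair₁ (k := k) (z := [a, b, e]) (n := a + b + e)).sum_ladder_eq_zero a b (c - a)
      (by omega) a le_rfl)
  rw [sum_range_eq_of_support (m := min a c) (n₂ := a) _ (by omega) (by omega),
    ← Finset.sum_range_reflect]
  · refine vec_injective h0' ?_
    rw [vec_sum, vec_zero]
    refine Eq.trans ?_ ((congrArg (intSign a • ·) key).trans (smul_zero _))
    simp only [LinearMap.sum_apply, Finset.smul_sum]
    refine Finset.sum_congr rfl fun s hs => ?_
    have hs' : s ≤ a := by simp at hs; omega
    rw [vec_zsmul, LinearMap.smul_apply, smul_smul, Nat.add_sub_cancel, intSign_sub_natCast a s hs']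
    congr 1
    simp only [Module.End.mul_apply, projA_vec, projB_vec, if_true, extendByZero_natCast]
    rw [opF₁_vec (a' := a - s) (b' := a + b - (a - s)) h0 _ (by omega) (by omega) (by omega)]
    rcases lt_or_ge c (a - s) with h2 | h2
    · rw [extendByZero_of_neg _ (by omega), rL_eq_zero _ (by omega), Limits.comp_zero, vec_zero]
      rfl
    · rw [show (s : ℤ) + (c - a) = ((c - (a - s) : ℕ) : ℤ) by omega, extendByZero_natCast,
        opE₁_vec (a' := c) (b' := d) _ _ (by omega) (by omega) h0', Category.id_comp,
        show a - (a - s) = s by omega]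
  · intro i hi
    rcases lt_or_ge a i with h1 | h1
    · rw [rR_eq_zero _ (by omega), Limits.zero_comp, smul_zero]
    · rw [rL_eq_zero _ (by omega), Limits.comp_zero, smul_zero]

theorem sum_rL_rR_eq_zero {a b c d : ℕ} (e M : ℕ) (h : a + b = c + d) (hc : c < b)
    (hM : b ≤ M ∨ d ≤ M) :
    ∑ m ∈ Finset.range (M + 1), intSign m •
      (rL (b - m) a b (a + b - m) m [e] ≫ rR (d - m) (a + b - m) m c d [e] :
        LHom k [a, b, e] [c, d, e]) = 0 := by
  have h0 : a + b + e = a + b + e := rfl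
  have h0' : c + d + e = a + b + e := by omega
  have key := congrArg (fun x => x (vec h0 (𝟙 (⟨wd [a, b, e]⟩ : PWeb k))))
    ((ladderPair₁ (k := k) (z := [a, b, e]) (n := a + b + e)).mirror.sum_ladder_eq_zero b a (d - b)
      (by omega) b le_rfl)
  rw [sum_range_eq_of_support (m := min b d) (n₂ := b) _ (by omega) (by omega),
    ← Finset.sum_range_reflect]
  · refine vec_injective h0' ?_
    rw [vec_sum, vec_zero]
    refine Eq.trans ?_ ((congrArg (intSign b • ·) key).trans (smul_zero _))
    simp only [LinearMap.sum_apply, Finset.smul_sum]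
    refine Finset.sum_congr rfl fun s hs => ?_
    have hs' : s ≤ b := by simp at hs; omega
    rw [vec_zsmul, LinearMap.smul_apply, smul_smul, Nat.add_sub_cancel, intSign_sub_natCast b s hs']
    congr 1
    simp only [Module.End.mul_apply, projA_vec, projB_vec, if_true, extendByZero_natCast]
    rw [opE₁_vec (a' := a + b - (b - s)) (b' := b - s) h0 _ (by omega) (by omega) (by omega)]
    rcases lt_or_ge d (b - s) with h2 | h2
    · rw [extendByZero_of_neg _ (by omega), rR_eq_zero _ (by omega), Limits.comp_zero, vec_zero]
      rfl
    · rw [show (s : ℤ) + (d - b) = ((d - (b - s) : ℕ) : ℤ) by omega, extendByZero_natCast,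
        opF₁_vec (a' := c) (b' := d) _ _ (by omega) (by omega) h0', Category.id_comp,
        show b - (b - s) = s by omega]
  · intro i hi
    rcases lt_or_ge b i with h1 | h1
    · rw [rL_eq_zero _ (by omega), Limits.zero_comp, smul_zero]
    · rw [rR_eq_zero _ (by omega), Limits.comp_zero, smul_zero]

end PWeb

namespace PWeb

variable {k : Type u} [CommRing k] [Invertible (2 : k)]

/-! ### The Serre relations -/

section

variable {a b c a' b' c' a₁ a₂ b₁ b₂ b₃ c₁ c₂ p q r s x : ℕ} (t : List ℕ)

/-- The splits of the third strand are pulled to the bottom and the merge into the first strand to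
the top, which leaves a two-strand ladder on `(b, s)`. For fixed `s = q + p` the outer parts do not
depend on `p`, so a Serre relation reduces to an alternating sum of two-strand ladders. -/
theorem rL_rL_rL_inner (h1 : q + c₁ = c) (h2 : b + q = b₁) (h3 : r + b₂ = b₁) (h4 : a + r = x)
    (h5 : p + c' = c₁) (h6 : b₂ + p = b₃) (h7 : q + p = s) (h8 : s + c' = c) :
    (L a (rL q b c b₁ c₁ t) ≫ rL r a b₁ x b₂ (c₁ :: t) ≫ L x (rL p b₂ c₁ b₃ c' t) : LHom k _ _) =
      L a (L b (sp s c' c h8 t)) ≫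
        L a (rL q b s b₁ p (c' :: t) ≫ rR b₂ b₁ p r b₃ (c' :: t)) ≫
          mg a r x h4 (b₃ :: c' :: t) := by
  rw [rL_eq t h2 h1, rL_eq _ h4 h3, rL_eq t h6 h5, rL_eq _ h2 h7, rR_eq _ h3 h6,
    Category.assoc (L a (sp r b₂ b₁ _ _)), mg_naturality]
  simp only [← Category.assoc, ← L_comp]
  congr 2
  simp only [Category.assoc, L_comp]
  rw [← Category.assoc (sp r b₂ b₁ _ _), sp_naturality, Category.assoc,
    ← Category.assoc (mg b q b₁ _ _), mg_naturality]
  simp only [← Category.assoc, ← L_comp]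
  rw [sp_assoc t h7 h8 h5 h1]

/-- Here the third strand emits `r` at the bottom and the first strand receives `s = q + p` at the
top. The ladder in between lives on `(b, r)` and has `q` as its intermediate left label. -/
theorem rL_rL_rL_outer (h1 : q + b₁ = b) (h2 : a + q = a₁) (h3 : r + c' = c) (h4 : b₁ + r = b₂)
    (h5 : p + b₃ = b₂) (h6 : a₁ + p = a₂) (h7 : q + p = s) (h8 : a + s = a₂) :
    (rL q a b a₁ b₁ (c :: t) ≫ L a₁ (rL r b₁ c b₂ c' t) ≫ rL p a₁ b₂ a₂ b₃ (c' :: t) : LHom k _ _) =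
      L a (L b (sp r c' c h3 t)) ≫
        L a (rR b₁ b r q b₂ (c' :: t) ≫ rL p q b₂ s b₃ (c' :: t)) ≫
          mg a s a₂ h8 (b₃ :: c' :: t) := by
  rw [rL_eq _ h2 h1, rL_eq t h4 h3, rL_eq _ h6 h5, rR_eq _ h1 h4, rL_eq _ h7 h5, Category.assoc,
    ← Category.assoc (L a₁ _), ← L_comp, ← Category.assoc (mg a q a₁ _ _), mg_naturality,
    Category.assoc, mg_assoc _ h2 h6 h7 h8]
  simp only [← Category.assoc, ← L_comp]
  congr 3
  simp only [Category.assoc, L_comp]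
  rw [← Category.assoc (sp q b₁ b _ _), sp_naturality, Category.assoc]

/-- The factorization of `rL_rL_rL_inner` read upside down. -/
theorem rR_rR_rR_inner (h1 : b₁ + p = b) (h2 : p + c = c₁) (h3 : a' + r = a) (h4 : r + b₁ = b₂)
    (h5 : b₃ + q = b₂) (h6 : q + c₁ = c₂) (h7 : q + p = s) (h8 : s + c = c₂) :
    (L a (rR p b c b₁ c₁ t) ≫ rR r a b₁ a' b₂ (c₁ :: t) ≫ L a' (rR q b₂ c₁ b₃ c₂ t) : LHom k _ _) =
      sp a' r a h3 (b :: c :: t) ≫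
        L a' (rL b₁ r b b₂ p (c :: t) ≫ rR q b₂ p b₃ s (c :: t)) ≫
          L a' (L b₃ (mg s c c₂ h8 t)) := by
  rw [rR_eq _ h1 h2, rR_eq _ h3 h4, rR_eq t h5 h6, rL_eq _ h4 h1, rR_eq _ h5 h7,
    ← Category.assoc (L a _), ← Category.assoc (L a _), ← sp_naturality]
  simp only [Category.assoc, ← L_comp]
  congr 2
  simp only [L_comp, Category.assoc]
  congr 1
  rw [← Category.assoc (L r (L b₁ _)), ← mg_naturality, Category.assoc, ← Category.assoc (L b₂ _),
    ← sp_naturality, Category.assoc]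
  simp only [← L_comp]
  rw [mg_assoc t h7 h8 h2 h6]

theorem rR_rR_rR_outer (h1 : a₁ + p = a) (h2 : p + b = b₁) (h3 : b₂ + r = b₁) (h4 : r + c = c')
    (h5 : a₂ + q = a₁) (h6 : q + b₂ = b₃) (h7 : q + p = s) (h8 : a₂ + s = a) :
    (rR p a b a₁ b₁ (c :: t) ≫ L a₁ (rR r b₁ c b₂ c' t) ≫ rR q a₁ b₂ a₂ b₃ (c' :: t) : LHom k _ _) =
      sp a₂ s a h8 (b :: c :: t) ≫
        L a₂ (rR p s b q b₁ (c :: t) ≫ rL b₂ q b₁ b₃ r (c :: t)) ≫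
          L a₂ (L b₃ (mg r c c' h4 t)) := by
  rw [rR_eq _ h1 h2, rR_eq t h3 h4, rR_eq _ h5 h6, rR_eq _ h7 h2, rL_eq _ h6 h3, Category.assoc,
    ← Category.assoc (L a₁ _) (L a₁ _), ← L_comp a₁, ← Category.assoc (L a₁ _), ← sp_naturality]
  simp only [← Category.assoc]
  rw [sp_assoc _ h5 h1 h7 h8]
  simp only [Category.assoc, ← L_comp]
  congr 3
  simp only [L_comp, Category.assoc]
  rw [mg_naturality]

end

variable {z : List ℕ} {n : ℕ}

theorem serre_E₂ (r s : ℕ) (hrs : r < s) :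
    ∑ p ∈ Finset.range (s + 1), intSign p •
      (opE₂ k z n p * opE₁ k z n r * opE₂ k z n (s - p)) = 0 := by
  refine ladder_ext fun a b c h g => ?_
  simp only [LinearMap.sum_apply, LinearMap.smul_apply, Module.End.mul_apply, LinearMap.zero_apply]
  rcases lt_or_ge c s with hc | hc
  · refine Finset.sum_eq_zero fun p hp => ?_
    have hp' : p ≤ s := by simp at hp; omega
    rcases lt_or_ge c (s - p) with h1 | h1
    · rw [opE₂_vec_of_lt h g h1, map_zero, map_zero, smul_zero]
    rw [opE₂_vec (b' := b + (s - p)) (c' := c - (s - p)) h g rfl (by omega) (by omega)]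
    rcases lt_or_ge (b + (s - p)) r with h2 | h2
    · rw [opE₁_vec_of_lt _ _ h2, map_zero, smul_zero]
    rw [opE₁_vec (a' := a + r) (b' := b + (s - p) - r) _ _ rfl (by omega) (by omega),
      opE₂_vec_of_lt _ _ (by omega), smul_zero]
  obtain ⟨c', rfl⟩ := Nat.exists_eq_add_of_le hc
  have h' : (a + r) + (b + s - r) + c' = n := by omega
  -- The ladder leads from `(b, s)` to `(r, b + s - r)`, and `r < s` is the condition for the
  -- alternating sum to vanish.
  have key := sum_rL_rR_eq_zero (k := k) c' s (show b + s = r + (b + s - r) by omega) hrs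
    (Or.inl le_rfl)
  have key' := congrArg (fun f => vec h' (g ≫ L a (L b (sp s c' (s + c') rfl [])) ≫ L a f ≫
    mg a r (a + r) rfl [b + s - r, c'])) key
  simp only [L_zero, Limits.zero_comp, Limits.comp_zero, vec_zero, L_sum, Preadditive.sum_comp,
    Preadditive.comp_sum, vec_sum, L_zsmul, Preadditive.zsmul_comp, Preadditive.comp_zsmul,
    vec_zsmul] at key'
  rw [← key']
  refine Finset.sum_congr rfl fun p hp => ?_
  have hp' : p ≤ s := by simp at hp; omega
  congr 1
  rw [opE₂_vec (b' := b + s - p) (c' := p + c') h g (by omega) (by omega) (by omega)]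
  rcases lt_or_ge (b + s - p) r with h2 | h2
  · rw [opE₁_vec_of_lt _ _ h2, map_zero, rR_eq_zero _ (by omega), Limits.comp_zero, L_zero,
      Limits.zero_comp, Limits.comp_zero, Limits.comp_zero, vec_zero]
  rw [opE₁_vec (a' := a + r) (b' := b + s - r - p) _ _ rfl (by omega) (by omega),
    opE₂_vec (b' := b + s - r) (c' := c') _ _ (by omega) rfl h', Category.assoc, Category.assoc,
    rL_rL_rL_inner [] (s := s) (by omega) (by omega) (by omega) rfl rfl (by omega) (by omega) rfl]

theorem serre_E₁ (r s : ℕ) (hrs : r < s) :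
    ∑ p ∈ Finset.range (s + 1), intSign p •
      (opE₁ k z n p * opE₂ k z n r * opE₁ k z n (s - p)) = 0 := by
  refine ladder_ext fun a b c h g => ?_
  simp only [LinearMap.sum_apply, LinearMap.smul_apply, Module.End.mul_apply, LinearMap.zero_apply]
  have hzero : c < r ∨ b + r < s → ∀ q p, q + p = s → opE₁ k z n p (opE₂ k z n r (opE₁ k z n q (vec h g))) = 0 := by
    intro h0 q p hpq
    rcases lt_or_ge b q with h1 | h1
    · rw [opE₁_vec_of_lt h g h1, map_zero, map_zero]
    rw [opE₁_vec (a' := a + q) (b' := b - q) h g rfl (by omega) (by omega)]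
    rcases lt_or_ge c r with h2 | h2
    · rw [opE₂_vec_of_lt _ _ h2, map_zero]
    rw [opE₂_vec (b' := b - q + r) (c' := c - r) _ _ rfl (by omega) (by omega),
      opE₁_vec_of_lt _ _ (by omega)]
  by_cases h0 : c < r ∨ b + r < s
  · refine Finset.sum_eq_zero fun p hp => ?_
    rw [hzero h0 _ _ (by simp at hp; omega), smul_zero]
  push Not at h0
  obtain ⟨c', rfl⟩ := Nat.exists_eq_add_of_le h0.1
  have h' : (a + s) + (b + r - s) + c' = n := by omega
  have key := sum_rR_rL_eq_zero (k := k) c' s (show b + r = s + (b + r - s) by omega) (by omega)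
    (Or.inr le_rfl)
  -- The sum runs over the intermediate left label, which is `s - p`; the reflection makes `p` the
  -- index, at the price of the sign `(-1)^s`.
  rw [← Finset.sum_range_reflect] at key
  have key' := congrArg (fun f => intSign s • vec h' (g ≫ L a (L b (sp r c' (r + c') rfl [])) ≫ L a f ≫
    mg a s (a + s) rfl [b + r - s, c'])) key
  simp only [L_zero, Limits.zero_comp, Limits.comp_zero, vec_zero, L_sum, Preadditive.sum_comp,
    Preadditive.comp_sum, vec_sum, L_zsmul, Preadditive.zsmul_comp, Preadditive.comp_zsmul,
    vec_zsmul, smul_zero, Finset.smul_sum, smul_smul] at key'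
  rw [← key']
  refine Finset.sum_congr rfl fun p hp => ?_
  have hp' : p ≤ s := by simp at hp; omega
  rw [Nat.add_sub_cancel, intSign_sub_natCast _ _ hp', ← mul_assoc, intSign_mul_self, one_mul]
  congr 1
  rcases lt_or_ge b (s - p) with h1 | h1
  · rw [opE₁_vec_of_lt h g h1, map_zero, map_zero, rR_eq_zero _ (by omega), Limits.zero_comp, L_zero,
      Limits.zero_comp, Limits.comp_zero, Limits.comp_zero, vec_zero]
  rw [opE₁_vec (a' := a + (s - p)) (b' := b - (s - p)) h g (by omega) (by omega) (by omega),
    opE₂_vec (b' := b + r - (s - p)) (c' := c') _ _ (by omega) rfl (by omega),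
    opE₁_vec (a' := a + s) (b' := b + r - s) _ _ (by omega) (by omega) h', Category.assoc,
    Category.assoc, show s - (s - p) = p by omega,
    rL_rL_rL_outer [] (s := s) (by omega) (by omega) rfl (by omega) (by omega) (by omega) (by omega)
      rfl]

theorem serre_F₂ (r s : ℕ) (hrs : r < s) :
    ∑ p ∈ Finset.range (s + 1), intSign p •
      (opF₂ k z n (s - p) * opF₁ k z n r * opF₂ k z n p) = 0 := by
  refine ladder_ext fun a b c h g => ?_
  simp only [LinearMap.sum_apply, LinearMap.smul_apply, Module.End.mul_apply, LinearMap.zero_apply]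
  have hzero : a < r ∨ b + r < s → ∀ q p, q + p = s →
      opF₂ k z n q (opF₁ k z n r (opF₂ k z n p (vec h g))) = 0 := by
    intro h0 q p hpq
    rcases lt_or_ge b p with h1 | h1
    · rw [opF₂_vec_of_lt h g h1, map_zero, map_zero]
    rw [opF₂_vec (b' := b - p) (c' := p + c) h g (by omega) rfl (by omega)]
    rcases lt_or_ge a r with h2 | h2
    · rw [opF₁_vec_of_lt _ _ h2, map_zero]
    rw [opF₁_vec (a' := a - r) (b' := r + (b - p)) _ _ (by omega) rfl (by omega),
      opF₂_vec_of_lt _ _ (by omega)]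
  by_cases h0 : a < r ∨ b + r < s
  · refine Finset.sum_eq_zero fun p hp => ?_
    rw [hzero h0 _ _ (by simp at hp; omega), smul_zero]
  push Not at h0
  obtain ⟨a', rfl⟩ := Nat.exists_eq_add_of_le' h0.1
  have h' : a' + (r + b - s) + (s + c) = n := by omega
  have key := sum_rL_rR_eq_zero (k := k) c s (show r + b = (r + b - s) + s by omega) (by omega)
    (Or.inr le_rfl)
  have key' := congrArg (fun f => vec h' (g ≫ sp a' r (a' + r) rfl [b, c] ≫ L a' f ≫
    L a' (L (r + b - s) (mg s c (s + c) rfl [])))) key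
  simp only [L_zero, Limits.zero_comp, Limits.comp_zero, vec_zero, L_sum, Preadditive.sum_comp,
    Preadditive.comp_sum, vec_sum, L_zsmul, Preadditive.zsmul_comp, Preadditive.comp_zsmul,
    vec_zsmul] at key'
  rw [← key']
  refine Finset.sum_congr rfl fun p hp => ?_
  have hp' : p ≤ s := by simp at hp; omega
  congr 1
  rcases lt_or_ge b p with h1 | h1
  · rw [opF₂_vec_of_lt h g h1, map_zero, map_zero, rL_eq_zero _ (by omega), Limits.zero_comp, L_zero,
      Limits.zero_comp, Limits.comp_zero, Limits.comp_zero, vec_zero]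
  rw [opF₂_vec (b' := b - p) (c' := p + c) h g (by omega) (by omega) (by omega),
    opF₁_vec (a' := a') (b' := r + b - p) _ _ rfl (by omega) (by omega),
    opF₂_vec (b' := r + b - s) (c' := s + c) _ _ (by omega) (by omega) h', Category.assoc,
    Category.assoc,
    rR_rR_rR_inner [] (s := s) (by omega) (by omega) rfl (by omega) (by omega) (by omega) (by omega)
      rfl]

theorem serre_F₁ (r s : ℕ) (hrs : r < s) :
    ∑ p ∈ Finset.range (s + 1), intSign p •
      (opF₁ k z n (s - p) * opF₂ k z n r * opF₁ k z n p) = 0 := by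
  refine ladder_ext fun a b c h g => ?_
  simp only [LinearMap.sum_apply, LinearMap.smul_apply, Module.End.mul_apply, LinearMap.zero_apply]
  rcases lt_or_ge a s with ha | ha
  · refine Finset.sum_eq_zero fun p hp => ?_
    have hp' : p ≤ s := by simp at hp; omega
    rcases lt_or_ge a p with h1 | h1
    · rw [opF₁_vec_of_lt h g h1, map_zero, map_zero, smul_zero]
    rw [opF₁_vec (a' := a - p) (b' := p + b) h g (by omega) rfl (by omega)]
    rcases lt_or_ge (p + b) r with h2 | h2
    · rw [opF₂_vec_of_lt _ _ h2, map_zero, smul_zero]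
    rw [opF₂_vec (b' := p + b - r) (c' := r + c) _ _ (by omega) rfl (by omega),
      opF₁_vec_of_lt _ _ (by omega), smul_zero]
  obtain ⟨a', rfl⟩ := Nat.exists_eq_add_of_le' ha
  have h' : a' + (s + b - r) + (r + c) = n := by omega
  have key := sum_rR_rL_eq_zero (k := k) c s (show s + b = (s + b - r) + r by omega) (by omega)
    (Or.inl le_rfl)
  rw [← Finset.sum_range_reflect] at key
  have key' := congrArg (fun f => intSign s • vec h' (g ≫ sp a' s (a' + s) rfl [b, c] ≫ L a' f ≫
    L a' (L (s + b - r) (mg r c (r + c) rfl [])))) key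
  simp only [L_zero, Limits.zero_comp, Limits.comp_zero, vec_zero, L_sum, Preadditive.sum_comp,
    Preadditive.comp_sum, vec_sum, L_zsmul, Preadditive.zsmul_comp, Preadditive.comp_zsmul,
    vec_zsmul, smul_zero, Finset.smul_sum, smul_smul] at key'
  rw [← key']
  refine Finset.sum_congr rfl fun p hp => ?_
  have hp' : p ≤ s := by simp at hp; omega
  rw [Nat.add_sub_cancel, intSign_sub_natCast _ _ hp', ← mul_assoc, intSign_mul_self, one_mul]
  congr 1
  rw [opF₁_vec (a' := a' + (s - p)) (b' := s + b - (s - p)) h g (by omega) (by omega) (by omega)]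
  rcases lt_or_ge (s + b - (s - p)) r with h2 | h2
  · rw [opF₂_vec_of_lt _ _ h2, map_zero, rL_eq_zero _ (by omega), Limits.comp_zero, L_zero,
      Limits.zero_comp, Limits.comp_zero, Limits.comp_zero, vec_zero]
  rw [opF₂_vec (b' := s + b - r - (s - p)) (c' := r + c) _ _ (by omega) rfl (by omega),
    opF₁_vec (a' := a') (b' := s + b - r) _ _ (by omega) (by omega) h', Category.assoc,
    Category.assoc, show s - (s - p) = p by omega,
    rR_rR_rR_outer [] (s := s) (by omega) (by omega) (by omega) rfl rfl (by omega) (by omega)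
      rfl]

end PWeb

namespace PWeb

variable {k : Type u} [CommRing k] [Invertible (2 : k)]

/-! ### Crossings of strands and their naturality for merges and splits -/

/-- The crossing of the first two strands. -/
def Xt (a b : ℕ) (t : List ℕ) : LHom k (a :: b :: t) (b :: a :: t) := pr (strandCrossing a b) t

/-- The condition `s - r = a - b` determines `r = s + b - a`. If `s + b < a` the truncated
difference is `0`, but the labels then do not match and the rung is zero, so no restriction on `s`
is needed. -/
theorem Xt_eq (a b : ℕ) (t : List ℕ) :
    (Xt a b t : LHom k _ _) = ∑ s ∈ Finset.range (a + 1), (intSign a * intSign s) •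
      (rR s a b (a - s) (b + s) t ≫ rL (s + b - a) (a - s) (b + s) b a t) := by
  rw [Xt, strandCrossing, pr_sum, Finset.sum_filter, Finset.sum_product]
  refine Finset.sum_congr rfl fun s hs => ?_
  have hs' : s ≤ a := by simp at hs; omega
  simp only [pr_smul, pr_comp]
  rcases lt_or_ge (s + b) a with h | h
  · rw [rL_eq_zero t (by omega), Limits.comp_zero, smul_zero]
    exact Finset.sum_eq_zero fun x _ => if_neg (by omega)
  · rw [Finset.sum_eq_single_of_mem (s + b - a) (by simp; omega)]
    · rw [if_pos (by omega), ← intSign_sub, ← Nat.cast_sub hs', intSign_natCast,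
        ← Int.cast_smul_eq_zsmul k]
      push_cast
      rfl
    · intro x _ hx
      exact if_neg (by omega)

section

variable {z : List ℕ} {n : ℕ}

variable (k z n) in
/-- The crossing of the first two strands as an operator. -/
def opX₁ : Module.End k (LadderSpace k z n) :=
  ladderCrossing n (projA k z n) (extendByZero (opE₁ k z n)) (extendByZero (opF₁ k z n))

variable (k z n) in
/-- The crossing of the last two strands as an operator. -/
def opX₂ : Module.End k (LadderSpace k z n) :=
  ladderCrossing n (projB k z n) (extendByZero (opE₂ k z n)) (extendByZero (opF₂ k z n))

/-- By `crossing_weight` the product of exponentials acts on webs as the crossing of the definition.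
Its algebraic properties thereby become identities of webs. -/
theorem opX₁_vec {a b c : ℕ} (h : a + b + c = n) (h' : b + a + c = n) (g : LHom k z [a, b, c]) :
    opX₁ k z n (vec h g) = vec h' (g ≫ Xt a b [c]) := by
  have key := congrArg (fun x => x (vec h g)) ((ladderPair₁ (k := k) (z := z) (n := n)).crossing_weight a b)
  simp only [Module.End.mul_apply, projB_vec, projA_vec, if_true, LinearMap.smul_apply,
    LinearMap.sum_apply] at key
  refine key.trans ?_
  rw [Xt_eq, Preadditive.comp_sum, vec_sum, Finset.smul_sum]
  symm
  refine (Finset.sum_subset (Finset.range_subset_range.2 (show a + 1 ≤ n + 1 by omega))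
    fun s _ hs => ?_).trans (Finset.sum_congr rfl fun s _ => ?_)
  · rw [rR_eq_zero _ (by simp at hs; omega), Limits.zero_comp, smul_zero, Limits.comp_zero, vec_zero]
  rw [Preadditive.comp_zsmul, vec_zsmul, smul_smul, extendByZero_natCast]
  congr 1
  rcases lt_or_ge a s with h1 | h1
  · rw [opF₁_vec_of_lt h g h1, map_zero, rR_eq_zero _ (by omega), Limits.zero_comp, Limits.comp_zero,
      vec_zero]
  rw [opF₁_vec (a' := a - s) (b' := b + s) h g (by omega) (by omega) (by omega)]
  rcases lt_or_ge (s + b) a with h2 | h2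
  · rw [extendByZero_of_neg _ (by omega), rL_eq_zero _ (by omega), Limits.comp_zero, Limits.comp_zero,
      vec_zero]; rfl
  rw [show (s : ℤ) + (b - a) = ((s + b - a : ℕ) : ℤ) by omega, extendByZero_natCast,
    opE₁_vec (a' := b) (b' := a) _ _ (by omega) (by omega) h', Category.assoc]

theorem opX₂_vec {a b c : ℕ} (h : a + b + c = n) (h' : a + c + b = n) (g : LHom k z [a, b, c]) :
    opX₂ k z n (vec h g) = vec h' (g ≫ L a (Xt b c [])) := by
  have key := congrArg (fun x => x (vec h g)) ((ladderPair₂ (k := k) (z := z) (n := n)).crossing_weight b c)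
  simp only [Module.End.mul_apply, projB_vec, projC_vec, if_true, LinearMap.smul_apply,
    LinearMap.sum_apply] at key
  refine key.trans ?_
  rw [Xt_eq, L_sum, Preadditive.comp_sum, vec_sum, Finset.smul_sum]
  symm
  refine (Finset.sum_subset (Finset.range_subset_range.2 (show b + 1 ≤ n + 1 by omega))
    fun s _ hs => ?_).trans (Finset.sum_congr rfl fun s _ => ?_)
  · rw [rR_eq_zero _ (by simp at hs; omega), Limits.zero_comp, smul_zero, L_zero, Limits.comp_zero,
      vec_zero]
  rw [L_zsmul, Preadditive.comp_zsmul, vec_zsmul, smul_smul, extendByZero_natCast]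
  congr 1
  rcases lt_or_ge b s with h1 | h1
  · rw [opF₂_vec_of_lt h g h1, map_zero, rR_eq_zero _ (by omega), Limits.zero_comp, L_zero,
      Limits.comp_zero, vec_zero]
  rw [opF₂_vec (b' := b - s) (c' := c + s) h g (by omega) (by omega) (by omega)]
  rcases lt_or_ge (s + c) b with h2 | h2
  · rw [extendByZero_of_neg _ (by omega), rL_eq_zero _ (by omega), Limits.comp_zero, L_zero,
      Limits.comp_zero, vec_zero]; rfl
  rw [show (s : ℤ) + (c - b) = ((s + c - b : ℕ) : ℤ) by omega, extendByZero_natCast,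
    opE₂_vec (b' := c) (c' := b) _ _ (by omega) (by omega) h', Category.assoc, L_comp]

theorem extendByZero_commute {R : Type*} [Ring R] {E : ℕ → R} {x : R} (h : ∀ r, E r * x = x * E r)
    (r : ℤ) : extendByZero E r * x = x * extendByZero E r := by
  rw [extendByZero]
  split_ifs
  · exact h _
  · rw [zero_mul, mul_zero]

theorem ladderTriple : LadderTriple n (projA k z n) (projB k z n) (projC k z n)
    (extendByZero (opE₁ k z n)) (extendByZero (opF₁ k z n)) (extendByZero (opE₂ k z n))
    (extendByZero (opF₂ k z n)) where
  pair₁ := ladderPair₁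
  pair₂ := ladderPair₂
  A_C a c := by
    refine ladder_ext fun a b c h g => ?_
    simp only [Module.End.mul_apply, projA_vec, projC_vec]
    split_ifs <;> simp [projA_vec, projC_vec, *]
  E₁_C r x := by
    refine extendByZero_commute (fun r => ladder_ext fun a b c h g => ?_) r
    rw [Module.End.mul_apply, Module.End.mul_apply, projC_vec]
    rcases lt_or_ge b r with h1 | h1
    · rw [opE₁_vec_of_lt h g h1, map_zero]; split_ifs
      · exact opE₁_vec_of_lt h g h1
      · exact map_zero _
    · rw [opE₁_vec (a' := a + r) (b' := b - r) h g (by omega) (by omega) (by omega), projC_vec]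
      split_ifs
      · exact opE₁_vec h g (by omega) (by omega) (by omega)
      · exact map_zero _
  F₁_C r x := by
    refine extendByZero_commute (fun r => ladder_ext fun a b c h g => ?_) r
    rw [Module.End.mul_apply, Module.End.mul_apply, projC_vec]
    rcases lt_or_ge a r with h1 | h1
    · rw [opF₁_vec_of_lt h g h1, map_zero]; split_ifs
      · exact opF₁_vec_of_lt h g h1
      · exact map_zero _
    · rw [opF₁_vec (a' := a - r) (b' := b + r) h g (by omega) (by omega) (by omega), projC_vec]
      split_ifs
      · exact opF₁_vec h g (by omega) (by omega) (by omega)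
      · exact map_zero _
  E₂_A r x := by
    refine extendByZero_commute (fun r => ladder_ext fun a b c h g => ?_) r
    rw [Module.End.mul_apply, Module.End.mul_apply, projA_vec]
    rcases lt_or_ge c r with h1 | h1
    · rw [opE₂_vec_of_lt h g h1, map_zero]; split_ifs
      · exact opE₂_vec_of_lt h g h1
      · exact map_zero _
    · rw [opE₂_vec (b' := b + r) (c' := c - r) h g (by omega) (by omega) (by omega), projA_vec]
      split_ifs
      · exact opE₂_vec h g (by omega) (by omega) (by omega)
      · exact map_zero _
  F₂_A r x := by
    refine extendByZero_commute (fun r => ladder_ext fun a b c h g => ?_) r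
    rw [Module.End.mul_apply, Module.End.mul_apply, projA_vec]
    rcases lt_or_ge b r with h1 | h1
    · rw [opF₂_vec_of_lt h g h1, map_zero]; split_ifs
      · exact opF₂_vec_of_lt h g h1
      · exact map_zero _
    · rw [opF₂_vec (b' := b - r) (c' := c + r) h g (by omega) (by omega) (by omega), projA_vec]
      split_ifs
      · exact opF₂_vec h g (by omega) (by omega) (by omega)
      · exact map_zero _
  serre_E₂ r s hrs := by
    rw [← serre_E₂ (k := k) (z := z) (n := n) r s hrs]
    refine Finset.sum_congr rfl fun p hp => ?_
    rw [← Nat.cast_sub (by simp at hp; omega)]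
    simp only [extendByZero_natCast]
  serre_E₁ r s hrs := by
    rw [← serre_E₁ (k := k) (z := z) (n := n) r s hrs]
    refine Finset.sum_congr rfl fun p hp => ?_
    rw [← Nat.cast_sub (by simp at hp; omega)]
    simp only [extendByZero_natCast]
  serre_F₂ r s hrs := by
    rw [← serre_F₂ (k := k) (z := z) (n := n) r s hrs]
    refine Finset.sum_congr rfl fun p hp => ?_
    rw [← Nat.cast_sub (by simp at hp; omega)]
    simp only [extendByZero_natCast]
  serre_F₁ r s hrs := by
    rw [← serre_F₁ (k := k) (z := z) (n := n) r s hrs]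
    refine Finset.sum_congr rfl fun p hp => ?_
    rw [← Nat.cast_sub (by simp at hp; omega)]
    simp only [extendByZero_natCast]

end

theorem Xt_comp_Xt (a b c : ℕ) : (Xt a b [c] ≫ Xt b a [c] : LHom k _ _) = 𝟙 _ := by
  have h0 : a + b + c = a + b + c := rfl
  have h1 : b + a + c = a + b + c := by omega
  have key := congrArg (fun x => x (vec h0 (𝟙 (⟨wd [a, b, c]⟩ : PWeb k))))
    (ladderPair₁ (k := k) (z := [a, b, c]) (n := a + b + c)).crossing_mul_self
  refine vec_injective h0 (Eq.trans ?_ key)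
  refine Eq.trans ?_ (congrArg (opX₁ k _ _) (opX₁_vec h0 h1 _)).symm
  rw [opX₁_vec h1 h0, Category.id_comp]

theorem Xt_zero_right (a : ℕ) (t : List ℕ) : (Xt a 0 t : LHom k (a :: t) (a :: t)) = 𝟙 _ := by
  have h : (Xt a 0 t : LHom k (a :: 0 :: t) (0 :: a :: t)) = rR a a 0 0 a t := by
    rw [Xt_eq, Finset.sum_eq_single_of_mem a (by simp)]
    · simp only [intSign_mul_self, one_smul, Nat.sub_self, Nat.add_zero]
      have h1 : ∀ x y, x = 0 → y = a →
          (rR a a 0 x y t ≫ rL 0 x y 0 a t : LHom k _ _) = rR a a 0 0 a t := by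
        rintro _ _ rfl rfl
        rw [rL_zero, Category.comp_id]
      exact h1 _ _ (Nat.sub_self a) (Nat.zero_add a)
    · intro s hs hsa
      rw [rL_eq_zero _ (by simp at hs; omega), Limits.comp_zero, smul_zero]
  exact h.trans ((rR_split t (zero_add a)).trans (sp_zero_left _ t))

theorem Xt_zero_left (a : ℕ) (t : List ℕ) : (Xt 0 a t : LHom k (a :: t) (a :: t)) = 𝟙 _ := by
  have h : (Xt 0 a t : LHom k (0 :: a :: t) (a :: 0 :: t)) = rL a 0 a a 0 t := by
    rw [Xt_eq, Finset.sum_eq_single_of_mem 0 (by simp)]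
    · simp only [Nat.cast_zero, intSign_mul_self, one_smul, Nat.sub_zero, Nat.zero_add, Nat.add_zero]
      rw [rR_zero, Category.id_comp]
    · intro s hs hsa
      simp at hs; omega
  exact h.trans ((rL_merge t (zero_add a)).trans (mg_zero_left _ t))

/-- A merge is the rung `E₁^(b)` that empties the second strand. After it `X₂` crosses an empty
strand and does nothing, so `crossing_mul_E` turns into naturality for the merge. -/
theorem mg_Xt {a b x : ℕ} (h : a + b = x) (c : ℕ) :
    (mg a b x h [c] ≫ Xt x c [] : LHom k _ _) =
      L a (Xt b c []) ≫ Xt a c [b] ≫ L c (mg a b x h []) := by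
  have h0 : a + b + c = x + c := by omega
  have key := congrArg (fun f => f (vec h0 (𝟙 (⟨wd [a, b, c]⟩ : PWeb k))))
    ((ladderTriple (k := k) (z := [a, b, c]) (n := x + c)).crossing_mul_E b)
  simp only [Module.End.mul_apply, extendByZero_natCast] at key
  change opX₁ _ _ _ (opX₂ _ _ _ (opE₁ _ _ _ _ _)) = opE₂ _ _ _ _ (opX₁ _ _ _ (opX₂ _ _ _ _)) at key
  rw [opE₁_vec (a' := x) (b' := 0) h0 _ h (add_zero b) (by omega),
    opX₂_vec (a := x) (b := 0) (c := c) _ (by omega), opX₁_vec (c := 0) _ (by omega), opX₂_vec h0 (by omega),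
    opX₁_vec _ (by omega), opE₂_vec (b' := x) (c' := 0) _ _ h (add_zero b) (by omega)] at key
  have key' := vec_injective _ key
  simp only [Category.id_comp, Category.assoc] at key'
  refine Eq.trans ?_ (key'.trans ?_)
  · exact (congrArg₂ (· ≫ ·) (rL_merge [c] h) (comp_eq_right (x := [x, c]) (y := [c, x]) (Xt x c [])
      (L_eq_id x (Xt_zero_left c [])))).symm
  · exact congrArg (fun f => L a (Xt b c []) ≫ Xt a c [b] ≫ L c f) (rL_merge [] h)

/-- A split is the rung `F^(b)` into an empty strand, so `F_mul_crossing` is applied to the labels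
`(c, x, 0)`. -/
theorem Xt_sp {a b x : ℕ} (h : a + b = x) (c : ℕ) :
    (Xt c x [] ≫ sp a b x h [c] : LHom k _ _) =
      L c (sp a b x h []) ≫ Xt c a [b] ≫ L a (Xt c b []) := by
  have h0 : c + x + 0 = c + x := rfl
  have key := congrArg (fun f => f (vec h0 (𝟙 (⟨wd [c, x, 0]⟩ : PWeb k))))
    ((ladderTriple (k := k) (z := [c, x, 0]) (n := c + x)).F_mul_crossing b)
  simp only [Module.End.mul_apply, extendByZero_natCast] at key
  change opF₁ _ _ _ _ (opX₂ _ _ _ (opX₁ _ _ _ _)) = opX₂ _ _ _ (opX₁ _ _ _ (opF₂ _ _ _ _ _)) at key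
  rw [opX₁_vec h0 (by omega), opX₂_vec _ (by omega), opF₁_vec (a' := a) (b' := b) _ _ h (add_zero b) (by omega),
    opF₂_vec (b' := a) (c' := b) h0 _ h (add_zero b) (by omega), opX₁_vec _ (by omega),
    opX₂_vec _ (by omega)] at key
  have key' := vec_injective _ key
  simp only [Category.id_comp, Category.assoc] at key'
  refine Eq.trans ?_ (key'.trans ?_)
  · exact congrArg₂ (· ≫ ·) rfl ((comp_eq_right (x := [x, c]) (y := [a, b, c])
      _ (L_eq_id x (Xt_zero_right c []))).trans (rR_split [c] h)).symm
  · exact congrArg (fun f => L c f ≫ Xt c a [b] ≫ L a (Xt c b [])) (rR_split [] h)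

end PWeb

namespace PWeb

variable {k : Type u} [CommRing k] [Invertible (2 : k)]

/-! ### Naturality of the crossings for the cap -/

section

variable (t : List ℕ)

theorem capB_left {d e : ℕ} (h : 1 + d = e) :
    (capB 1 e 0 d t : LHom k (1 :: e :: t) (d :: t)) = L 1 (sp 1 d e h t) ≫ cp (d :: t) := by
  refine (capB_eq t (zero_add 1) h).trans ((comp_eq_right (x := 1 :: e :: t) (y := d :: t) _
    (sp_zero_left (zero_add 1) (e :: t))).trans ?_)
  exact congrArg₂ (· ≫ ·) (L_nil _) (L_nil _)

/-- The antenna term in the relation between rungs and caps. -/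
def antTerm : ∀ n b d : ℕ, n + b = d + 1 → ∀ t : List ℕ, LHom k ((n + 1) :: b :: t) (d :: t)
  | 0, _, _, _, _ => 0
  | r + 1, b, d, h, t => sp r 2 (r + 2) rfl (b :: t) ≫ L r (an (b :: t)) ≫ mg r b d (by omega) t

/-- This is the relation of caps and rungs when the left strand `n + 1` is used up completely, so
that the rung after the cap is a merge. For `n = 0` there is no rung and both sides are the same
cap. -/
theorem rung_cap_slide {n b d e : ℕ} (hd : n + b = d) (he : n + (b + 1) = e) (he' : 1 + d = e)
    (hb : 1 + b = b + 1) :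
    (sp 1 n (n + 1) (add_comm 1 n) ((b + 1) :: t) ≫ L 1 (mg n (b + 1) e he t) ≫
        L 1 (sp 1 d e he' t) ≫ cp (d :: t) : LHom k _ _) =
      sp n 1 (n + 1) rfl ((b + 1) :: t) ≫ L n (L 1 (sp 1 b (b + 1) hb t) ≫ cp (b :: t)) ≫
        mg n b d hd t + (2 : k) • antTerm n (b + 1) d (by omega) t := by
  cases n with
  | zero =>
    obtain rfl : b = d := by omega
    obtain rfl : b + 1 = e := by omega
    have h1 : (antTerm 0 (b + 1) b (by omega) t : LHom k _ _) = 0 := rfl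
    rw [h1, smul_zero, add_zero]
    refine (comp_eq_right (x := 1 :: (b + 1) :: t) (y := b :: t) _
      (sp_zero_right (add_zero 1) ((b + 1) :: t))).trans ?_
    refine (comp_eq_right (x := 1 :: (b + 1) :: t) (y := b :: t) _
      (L_eq_id 1 (mg_zero_left _ _))).trans ?_
    refine Eq.symm ((comp_eq_right (x := 1 :: (b + 1) :: t) (y := b :: t) _
      (sp_zero_left (zero_add 1) ((b + 1) :: t))).trans ?_)
    exact (comp_eq_left (x := 1 :: (b + 1) :: t) (y := b :: t) _
      (mg_zero_left (zero_add b) t)).trans (L_nil _)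
  | succ r =>
    have key := rR_capB (k := k) t (a := r + 2) (b := b + 1) (r := r) (c := 0) (d := d) (a₁ := 1)
      (b₁ := e) (a₂ := r + 1) (b₂ := b) (a₃ := r) (by omega) (by omega) rfl (by omega) rfl rfl rfl
    have key1 : (sp 1 (r + 1) (r + 2) (add_comm 1 (r + 1)) ((b + 1) :: t) ≫
        L 1 (mg (r + 1) (b + 1) e he t)) ≫ L 1 (sp 1 d e he' t) ≫ cp (d :: t) =
        (sp (r + 1) 1 (r + 2) rfl ((b + 1) :: t) ≫
          L (r + 1) (L 1 (sp 1 b (b + 1) hb t)) ≫ L (r + 1) (cp (b :: t))) ≫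
        mg (r + 1) b d hd t + (2 : k) • ((sp r 2 (r + 2) rfl ((b + 1) :: t) ≫
          L r (an ((b + 1) :: t))) ≫ mg r (b + 1) d (by omega) t) :=
      (congrArg₂ (· ≫ ·) (rR_eq t _ _) (capB_left t he')).symm.trans (key.trans
        (congrArg₂ (· + ·) (congrArg₂ (· ≫ ·) (capB_eq t _ _) (rR_merge t _))
          (congrArg ((2 : k) • ·) (congrArg₂ (· ≫ ·) (antR_eq t _) (rR_merge t _)))))
    rw [antTerm]
    simp only [L_comp, Category.assoc] at key1 ⊢
    exact key1

theorem rung_cap_slide_one {n e : ℕ} (he : n + 1 = e) (he' : 1 + n = e) :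
    (sp 1 n (n + 1) (add_comm 1 n) (1 :: t) ≫ L 1 (mg n 1 e he t) ≫ L 1 (sp 1 n e he' t) ≫
        cp (n :: t) : LHom k _ _) =
      sp n 1 (n + 1) rfl (1 :: t) ≫ L n (cp t) + (2 : k) • antTerm n 1 n rfl t := by
  refine (rung_cap_slide t (add_zero n) he he' (add_zero 1)).trans
    (congrArg (· + _) (congrArg (_ ≫ ·) ?_))
  refine (comp_eq_left (x := n :: 1 :: 1 :: t) (y := n :: t) _ (mg_zero_right (add_zero n) t)).trans ?_
  exact congrArg (L n) (comp_eq_right (x := 1 :: 1 :: t) (y := t) (cp t)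
    (L_eq_id 1 (sp_zero_right (add_zero 1) t)))

theorem antTerm_one (t : List ℕ) : (antTerm 1 1 1 rfl t : LHom k _ _) = an (1 :: t) :=
  (comp_eq_right (x := 2 :: 1 :: t) (y := 1 :: t) _ (sp_zero_left (zero_add 2) (1 :: t))).trans
    ((comp_eq_left (x := 2 :: 1 :: t) (y := 1 :: t) _ (mg_zero_left (zero_add 1) t)).trans (L_nil _))

theorem two_smul_cancel {x y : List ℕ} {f g : LHom k x y} (h : (2 : k) • f = (2 : k) • g) : f = g := by
  have := congrArg ((⅟2 : k) • ·) h
  simpa only [smul_smul, invOf_mul_self, one_smul] using this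

theorem sp_cp_eq (h : 1 + 1 = 2) : (sp 1 1 2 h t ≫ cp t : LHom k _ _) = (2 : k) • an t := by
  rw [antenna_eq t h, smul_smul, mul_invOf_self, one_smul]

theorem sp_sp_cp {n m p : ℕ} (h1 : 1 + n = m) (h2 : 1 + m = p) (h3 : 2 + n = p) :
    (sp 1 m p h2 t ≫ L 1 (sp 1 n m h1 t) ≫ cp (n :: t) : LHom k _ _) =
      (2 : k) • (sp 2 n p h3 t ≫ an (n :: t)) := by
  rw [← Category.assoc, ← sp_assoc t (show 1 + 1 = 2 from rfl) h3 h1 h2, Category.assoc, sp_cp_eq,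
    Linear.comp_smul]

/-- An antenna may be emitted to either side of a strand. -/
theorem antenna_left_eq_right (n : ℕ) (h : 2 + n = n + 2) :
    (sp n 2 (n + 2) rfl t ≫ L n (an t) : LHom k _ _) = sp 2 n (n + 2) h t ≫ an (n :: t) := by
  have key := rR_capB (k := k) t (a := n + 2) (b := 0) (r := n) (c := 0) (d := n) (a₁ := 1)
    (b₁ := n + 1) (a₂ := n + 1) (b₂ := 0) (a₃ := n) (by omega) (by omega) rfl rfl rfl rfl rfl
  -- With an empty right strand the cap term is zero. What remains equates a cap of two ends split
  -- off on the left with twice the antenna on the right.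
  rw [capB_eq_zero t (a := n + 2) (by omega), Limits.zero_comp, zero_add] at key
  refine two_smul_cancel ?_
  rw [← sp_sp_cp t (add_comm 1 n) (by omega) h]
  refine Eq.symm (Eq.trans ?_ (key.trans (congrArg ((2 : k) • ·) ?_)))
  · have e1 : (rR (n + 1) (n + 2) 0 1 (n + 1) t : LHom k ((n + 2) :: t) (1 :: (n + 1) :: t)) =
        sp 1 (n + 1) (n + 2) (by omega) t := rR_split t _
    exact (congrArg₂ (· ≫ ·) e1 (capB_left t (add_comm 1 n))).symm
  · exact (comp_eq_left (x := (n + 2) :: t) (y := n :: t) _ ((rR_split t (zero_add n)).trans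
      (sp_zero_left (zero_add n) t))).trans (antR_eq t rfl)

/-- The rung back has label `s - n`, so only `s = n` and `s = n + 1` contribute. The first ladder is
a single rung, the second a merge followed by a split. -/
theorem Xt_succ_one (n : ℕ) (h : 1 + (n + 1) = n + 2) (h' : 1 + n = n + 1) :
    (Xt (n + 1) 1 t : LHom k _ _) =
      mg (n + 1) 1 (n + 2) rfl t ≫ sp 1 (n + 1) (n + 2) h t -
        sp 1 n (n + 1) h' (1 :: t) ≫ L 1 (mg n 1 (n + 1) rfl t) := by
  have h1 : ∀ r x y, r = 1 → x = 0 → y = n + 2 →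
      (rR (n + 1) (n + 1) 1 x y t ≫ rL r x y 1 (n + 1) t : LHom k _ _) =
        mg (n + 1) 1 (n + 2) rfl t ≫ sp 1 (n + 1) (n + 2) h t := by
    rintro _ _ _ rfl rfl rfl
    exact congrArg₂ (· ≫ ·) (rR_merge t rfl) (rL_split t h)
  have h2 : ∀ r x y, r = 0 → x = 1 → y = n + 1 →
      (rR n (n + 1) 1 x y t ≫ rL r x y 1 (n + 1) t : LHom k _ _) =
        sp 1 n (n + 1) h' (1 :: t) ≫ L 1 (mg n 1 (n + 1) rfl t) := by
    rintro _ _ _ rfl rfl rfl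
    rw [rL_zero, Category.comp_id, rR_eq t h' rfl]
  have hsign : intSign ((n + 1 : ℕ) : ℤ) * intSign (n : ℤ) = -1 := by
    rw [← intSign_sub]; simp [intSign]
  rw [Xt_eq, Finset.sum_range_succ, Finset.sum_range_succ, Finset.sum_eq_zero]
  · rw [h1 _ _ _ (by omega) (by omega) (by omega), h2 _ _ _ (by omega) (by omega) (by omega),
      intSign_mul_self, one_smul, zero_add, hsign, neg_one_smul, neg_add_eq_sub]
  · intro s hs
    rw [rL_eq_zero t (by simp at hs; omega), Limits.comp_zero, smul_zero]

end

/-- The braid group argument for the naturality of the cap. -/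
theorem eq_of_braid {C : Type*} [Category C] [Preadditive C] [Linear k C] {X Y : C} {S S' : X ⟶ X}
    {K K' : X ⟶ Y} (hS' : S' ≫ S' = 𝟙 X)
    (braid : S' ≫ S ≫ S' ≫ S ≫ S' = S) (hK : S ≫ K = K) (hK' : S' ≫ K' = K')
    (h₁ : S' ≫ K + S ≫ S' ≫ K = K' + S ≫ K') (h₂ : S ≫ K' + S' ≫ S ≫ K' = K + S' ≫ K) :
    S ≫ K' = S' ≫ K := by
  -- In the application `S`, `S'` are the crossings of the first two and of the last two of three
  -- strands `1`, and `K`, `K'` are the caps on these pairs. The braid relation and `S ≫ K = K` make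
  -- `S ≫ S' ≫ K` invariant under `S'`.
  have b : S' ≫ S ≫ S' ≫ K = S ≫ S' ≫ K := by
    have h := congrArg (fun f => S' ≫ f ≫ S' ≫ K) braid
    simp only [Category.assoc, reassoc_of% hS', hK] at h
    exact h.symm
  -- Composing `h₁` with `S'` gives a third linear relation. Combined with `h₁` and `h₂` it leaves
  -- twice the claim, and `2` is invertible.
  have h₃ := congrArg (fun f => S' ≫ f) h₁
  simp only [Preadditive.comp_add, reassoc_of% hS', hK', b] at h₃
  have h : (2 : k) • (S ≫ K') = (2 : k) • (S' ≫ K) := by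
    rw [two_smul, two_smul]
    have e1 : K + S ≫ S' ≫ K = K' + S' ≫ S ≫ K' := h₃
    have e2 : S ≫ K' + S' ≫ S ≫ K' + (K + S ≫ S' ≫ K) + (K' + S ≫ K') =
      K + S' ≫ K + (K' + S' ≫ S ≫ K') + (S' ≫ K + S ≫ S' ≫ K) := by rw [h₁, h₂, e1]
    rw [← sub_eq_zero] at e2 ⊢
    rw [← e2]; abel
  have := congrArg ((⅟2 : k) • ·) h
  simpa only [smul_smul, invOf_mul_self, one_smul] using this

/-- For two strands `1` the second ladder in `Xt_succ_one` is the identity. -/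
theorem mg_sp_eq (t : List ℕ) (h : 1 + 1 = 2) :
    (mg 1 1 2 h t ≫ sp 1 1 2 h t : LHom k _ _) = 𝟙 _ + Xt 1 1 t := by
  have h0 := Xt_succ_one (k := k) t 0 rfl rfl
  have h1 : (sp 1 0 1 rfl (1 :: t) ≫ L 1 (mg 0 1 1 rfl t) : LHom k (1 :: 1 :: t) (1 :: 1 :: t)) =
      𝟙 _ :=
    (comp_eq_right (x := 1 :: 1 :: t) (y := 1 :: 1 :: t) _ (sp_zero_right rfl (1 :: t))).trans
      (L_eq_id 1 (mg_zero_left rfl t))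
  have h2 : (Xt 1 1 t : LHom k (1 :: 1 :: t) (1 :: 1 :: t)) =
      mg 1 1 2 h t ≫ sp 1 1 2 h t - 𝟙 _ := h0.trans (congrArg (_ - ·) h1)
  rw [h2, add_sub_cancel]

theorem mg_sp_comp (t x : List ℕ) (h : 1 + 1 = 2) (f : LHom k (1 :: 1 :: t) x) :
    mg 1 1 2 h t ≫ sp 1 1 2 h t ≫ f = f + Xt 1 1 t ≫ f := by
  rw [← Category.assoc, mg_sp_eq, Preadditive.add_comp, Category.id_comp]

theorem L_mg_sp_comp (a : ℕ) (t x : List ℕ) (h : 1 + 1 = 2) (f : LHom k (a :: 1 :: 1 :: t) x) :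
    L a (mg 1 1 2 h t) ≫ L a (sp 1 1 2 h t) ≫ f = f + L a (Xt 1 1 t) ≫ f := by
  rw [← Category.assoc, ← L_comp, mg_sp_eq, L_add, L_id, Preadditive.add_comp, Category.id_comp]

/-- The crossing is `merge ≫ split - 1`. By the two antenna relations `merge ≫ split ≫ cap` is twice
the cap, so one cap is left. -/
theorem Xt_one_cap (t : List ℕ) : (Xt 1 1 t ≫ cp t : LHom k _ _) = cp t := by
  have h := mg_sp_eq (k := k) t rfl
  rw [← sub_eq_iff_eq_add'] at h
  rw [← h, Preadditive.sub_comp, Category.assoc, sp_cp_eq, Linear.comp_smul, mg_antenna,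
    Category.id_comp, two_smul, add_sub_cancel_right]

/-- The linear relations needed by `eq_of_braid` come from the two relations of caps and rungs, on
the labels `(2, 1)` and `(1, 2)`, by composing with a merge and replacing `merge ≫ split` by `1`
plus a crossing. -/
theorem Xt_cap_one_one :
    (Xt 1 1 [1] ≫ L 1 (cp []) : LHom k [1, 1, 1] [1]) = L 1 (Xt 1 1 []) ≫ cp [1] := by
  have hS' : (L 1 (Xt 1 1 []) ≫ L 1 (Xt 1 1 []) : LHom k [1, 1, 1] [1, 1, 1]) = 𝟙 _ := by
    rw [← L_comp]
    exact L_eq_id 1 (Xt_comp_Xt 1 1 0)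
  refine eq_of_braid (k := k) hS' ?_ (Xt_one_cap [1]) ?_ ?_ ?_
  · have h1 := mg_Xt (k := k) (show 1 + 1 = 2 from rfl) 1
    have h2 := Xt_sp (k := k) (show 1 + 1 = 2 from rfl) 1
    have h3 := Xt_comp_Xt (k := k) 2 1 0
    have h4 : (Xt 2 1 [] ≫ Xt 1 2 [] : LHom k [2, 1] [2, 1]) = 𝟙 _ := h3
    -- Crossing `(2, 1)` and back is trivial, so this is `merge ≫ split = 1 + S`. Naturality for the
    -- merge and the split expresses the same web as `1 + S' S S' S S'`, which is the braid
    -- relation.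
    have h5 : (mg 1 1 2 rfl [1] ≫ Xt 2 1 []) ≫ (Xt 1 2 [] ≫ sp 1 1 2 rfl [1]) =
        𝟙 (⟨wd [1, 1, 1]⟩ : PWeb k) + Xt 1 1 [1] := by
      rw [Category.assoc, ← Category.assoc (Xt 2 1 []), h4, Category.id_comp, mg_sp_eq]
    rw [h1, h2, Category.assoc, Category.assoc, ← Category.assoc (L 1 (mg 1 1 2 _ [])), ← L_comp,
      mg_sp_eq, L_add, L_id, Preadditive.add_comp, Category.id_comp, Preadditive.comp_add,
      Preadditive.comp_add, ← Category.assoc (Xt 1 1 [1]), Xt_comp_Xt, Category.id_comp, hS'] at h5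
    exact add_left_cancel h5
  · rw [← L_comp, Xt_one_cap]
  · have h0 : (sp 1 1 2 rfl [1] ≫ L 1 (mg 1 1 2 rfl []) ≫ L 1 (sp 1 1 2 rfl []) ≫ cp [1] :
        LHom k [2, 1] [1]) = sp 1 1 2 rfl [1] ≫ L 1 (cp []) + (2 : k) • an [1] :=
      (rung_cap_slide_one [] rfl rfl).trans (congrArg (_ + (2 : k) • ·) (antTerm_one []))
    have h1 := congrArg (mg 1 1 2 rfl [1] ≫ ·) h0
    simp only [Preadditive.comp_add, mg_sp_comp, L_mg_sp_comp, mg_antenna, two_smul,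
      Xt_one_cap] at h1
    rw [← sub_eq_zero] at h1 ⊢
    rw [← h1]; abel
  · have h1 := rL_capB (k := k) [] (a := 1) (b := 2) (r := 0) (c := 1) (d := 0) (a₁ := 2) (b₁ := 1)
      (a₂ := 0) (b₂ := 1) (b₃ := 0) rfl rfl rfl rfl rfl rfl rfl
    have h2 : (L 1 (sp 1 1 2 rfl []) ≫ mg 1 1 2 rfl [1] ≫ sp 1 1 2 rfl [1] ≫ L 1 (cp []) :
        LHom k [1, 2] [1]) = L 1 (sp 1 1 2 rfl []) ≫ cp [1] + (2 : k) • L 1 (an []) := by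
      refine Eq.trans ?_ (h1.trans ?_)
      · rw [← Category.assoc]
        have e : (capB 2 1 1 0 [] : LHom k [2, 1] [1]) = sp 1 1 2 rfl [1] ≫ L 1 (cp []) :=
          (capB_eq [] rfl rfl).trans (congrArg (_ ≫ ·) (comp_eq_right (x := [1, 1, 1]) (y := [1])
            (L 1 (cp [])) (L_eq_id 1 (L_eq_id 1 (sp_zero_right rfl [])))))
        exact (congrArg₂ (· ≫ ·) (rL_eq [] rfl rfl) e).symm
      · have e1 : (capB 1 2 0 1 [] ≫ rL 1 0 1 1 0 [] : LHom k [1, 2] [1]) =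
            L 1 (sp 1 1 2 rfl []) ≫ cp [1] :=
          (comp_eq_left (x := [1, 2]) (y := [1]) _ ((rL_merge [] (zero_add 1)).trans
            (mg_zero_left rfl []))).trans (capB_left [] rfl)
        have e2 : (antL 1 2 0 [] ≫ rL 0 1 0 1 0 [] : LHom k [1, 2] [1]) = L 1 (an []) :=
          (comp_eq_left (x := [1, 2]) (y := [1]) _ (rL_zero [])).trans ((antL_eq [] rfl).trans
            (comp_eq_right (x := [1, 2]) (y := [1]) _ (L_eq_id 1 (sp_zero_right rfl []))))
        exact congrArg₂ (· + ·) e1 (congrArg ((2 : k) • ·) e2)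
    have h3 := congrArg (L 1 (mg 1 1 2 rfl []) ≫ ·) h2
    simp only [Preadditive.comp_add, mg_sp_comp, L_mg_sp_comp, two_smul] at h3
    rw [← L_comp, Xt_one_cap, ← L_comp, mg_antenna] at h3
    rw [← sub_eq_zero] at h3 ⊢
    rw [← h3]; abel

end PWeb

/-! ### Naturality of the cap for a strand of arbitrary label. -/

namespace PWeb

variable {k : Type u} [CommRing k] [Invertible (2 : k)]

/-- In the rung swap for `r = s = 1` on `(n + 1, 1)` the inner `merge ≫ split` is `1` plus a
crossing. The `1` produces a digon with value `n + 1`, while the other side has `n` copies of the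
identity, so one copy remains. -/
theorem mg_sp_swap (n : ℕ) (t : List ℕ) :
    (mg (n + 1) 1 (n + 2) rfl t ≫ sp (n + 1) 1 (n + 2) rfl t : LHom k _ _) =
      𝟙 _ + sp n 1 (n + 1) rfl (1 :: t) ≫ L n (Xt 1 1 t) ≫ mg n 1 (n + 1) rfl (1 :: t) := by
  have key := rung_swap (k := k) t (a := n + 1) (b := 1) (a' := n) (b' := 2) 1 1 (n + 1) 1 rfl rfl rfl
    rfl
  rw [Nat.min_self, Finset.sum_range_succ, Finset.sum_range_one, Ring.choose_zero_right, one_smul,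
    Ring.choose_one_right, rL_zero, rR_zero, Category.comp_id,
    rR_eq t (show n + 1 = n + 1 from rfl) (show 1 + 1 = 2 from rfl),
    rL_eq t (show n + 1 = n + 1 from rfl) (show 1 + 1 = 2 from rfl), Category.assoc,
    ← Category.assoc (L n _), ← L_comp, mg_sp_eq, L_add, L_id, Preadditive.add_comp,
    Category.id_comp, Preadditive.comp_add, sp_mg] at key
  have e : (rL (1 - 0) (n + 1) 1 (n + 1 + (1 - 0)) (1 - (1 - 0)) t ≫
      rR (1 - 0) (n + 1 + (1 - 0)) (1 - (1 - 0)) (n + 1) 1 t : LHom k _ _) =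
      mg (n + 1) 1 (n + 2) rfl t ≫ sp (n + 1) 1 (n + 2) rfl t :=
    congrArg₂ (· ≫ ·) (rL_merge t rfl) (rR_split t rfl)
  rw [e] at key
  rw [Nat.choose_one_right] at key
  have c1 : (((n + 1 : ℕ) : ℤ) - ((1 : ℕ) : ℤ) + ((1 : ℕ) : ℤ) - ((1 : ℕ) : ℤ)) = (n : ℤ) := by
    push_cast; ring
  have c2 : (((n + 1 : ℕ) : ℤ)) = (n : ℤ) + 1 := by push_cast; ring
  rw [c1, c2, add_zsmul, one_zsmul] at key
  rw [← sub_eq_zero] at key ⊢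
  rw [← neg_eq_zero, ← key]
  abel

theorem antTerm_merge (n : ℕ) (h : n + 2 = n + 1 + 1) :
    (L (n + 1) (mg 1 1 2 rfl []) ≫ antTerm n 2 (n + 1) h [] : LHom k _ _) =
      antTerm n 1 n rfl [1] ≫ mg n 1 (n + 1) rfl [] := by
  cases n with
  | zero => exact Limits.comp_zero.trans Limits.zero_comp.symm
  | succ r =>
    rw [antTerm, antTerm]
    have h1 := sp_naturality (k := k) (show r + 2 = r + 2 from rfl) (mg 1 1 2 rfl [])
    have h2 := an_naturality (k := k) (mg_mem (show 1 + 1 = 2 from rfl) [])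
    have h3 := mg_assoc (k := k) [] (show r + 1 = r + 1 from rfl) (show r + 1 + 1 = r + 2 from rfl)
      (show 1 + 1 = 2 from rfl) rfl
    have h4 := congrArg (· ≫ L r (an [2]) ≫ mg r 2 (r + 2) rfl []) h1
    simp only [Category.assoc] at h4 ⊢
    rw [h3, ← Category.assoc (L r (an _)), ← L_comp, h2, L_comp, Category.assoc]
    exact h4.symm

/-- Naturality of the crossings for the cap. -/
theorem Xt_cap (c : ℕ) :
    (Xt c 1 [1] ≫ L 1 (Xt c 1 []) ≫ cp [c] : LHom k [c, 1, 1] [c]) = L c (cp []) := by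
  cases c with
  | zero =>
    refine (comp_eq_right (x := [1, 1]) (y := []) _ (Xt_zero_left (k := k) 1 [1])).trans ?_
    exact (comp_eq_right (x := [1, 1]) (y := []) (cp (k := k) [])
      (L_eq_id 1 (Xt_zero_left (k := k) 1 []))).trans
      (L_nil (cp (k := k) [])).symm
  | succ n =>
    -- Each crossing with `n + 1` is a `merge ≫ split` minus a rung, so the left-hand side of the
    -- claim expands into four webs; they are evaluated in `T1` to `T4`.
    have hr : (L 1 (Xt (n + 1) 1 []) ≫ cp [n + 1] : LHom k _ _) =
        L 1 (mg (n + 1) 1 (n + 2) rfl []) ≫ L 1 (sp 1 (n + 1) (n + 2) (by omega) []) ≫ cp [n + 1] -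
          L 1 (sp 1 n (n + 1) (by omega) [1]) ≫ cp [n, 1] ≫ mg n 1 (n + 1) rfl [] := by
      rw [Xt_succ_one (k := k) [] n (show 1 + (n + 1) = n + 2 by omega) (show 1 + n = n + 1 by omega),
        L_sub, L_comp, L_comp, Preadditive.sub_comp, Category.assoc, Category.assoc,
        cp_naturality (k := k) (mg_mem (show n + 1 = n + 1 from rfl) [])]
    have T1 : (sp 1 (n + 1) (n + 2) (by omega) [1] ≫
        L 1 (mg (n + 1) 1 (n + 2) rfl []) ≫ L 1 (sp 1 (n + 1) (n + 2) (by omega) []) ≫ cp [n + 1] :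
          LHom k _ _) = sp (n + 1) 1 (n + 2) rfl [1] ≫ L (n + 1) (cp []) +
          (2 : k) • (sp n 2 (n + 2) rfl [1] ≫ L n (an [1]) ≫ mg n 1 (n + 1) rfl []) :=
      rung_cap_slide_one (k := k) [] (n := n + 1) (e := n + 2) rfl (by omega)
    have T3 : (sp 1 (n + 1) (n + 2) (by omega) [1] ≫ L 1 (sp 1 n (n + 1) (by omega) [1]) ≫
        cp [n, 1] : LHom k _ _) = (2 : k) • (sp n 2 (n + 2) rfl [1] ≫ L n (an [1])) := by
      rw [antenna_left_eq_right [1] n (by omega)]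
      exact sp_sp_cp (k := k) [1] (n := n) (m := n + 1) (p := n + 2) (by omega) (by omega) (by omega)
    have T4 : (sp 1 n (n + 1) (by omega) [1, 1] ≫ L 1 (mg n 1 (n + 1) rfl [1]) ≫
        L 1 (sp 1 n (n + 1) (by omega) [1]) ≫ cp [n, 1] : LHom k _ _) =
          sp n 1 (n + 1) rfl [1, 1] ≫ L n (cp [1]) + (2 : k) • antTerm n 1 n rfl [1] :=
      rung_cap_slide_one (k := k) [1] (n := n) (e := n + 1) rfl (by omega)
    have T2 : (sp 1 n (n + 1) (by omega) [1, 1] ≫ L 1 (mg n 1 (n + 1) rfl [1]) ≫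
        L 1 (mg (n + 1) 1 (n + 2) rfl []) ≫ L 1 (sp 1 (n + 1) (n + 2) (by omega) []) ≫
          cp [n + 1] : LHom k _ _) =
        sp n 1 (n + 1) rfl [1, 1] ≫ L n (cp [1]) ≫ mg n 1 (n + 1) rfl [] +
          sp n 1 (n + 1) rfl [1, 1] ≫ L n (L 1 (Xt 1 1 []) ≫ cp [1]) ≫ mg n 1 (n + 1) rfl [] +
          (2 : k) • (antTerm n 1 n rfl [1] ≫ mg n 1 (n + 1) rfl []) := by
      have h1 := rung_cap_slide (k := k) [] (n := n) (b := 1) (d := n + 1) (e := n + 2) rfl rfl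
        (by omega) rfl
      have h2 := congrArg (L (n + 1) (mg 1 1 2 rfl []) ≫ ·) h1
      have h3 := mg_assoc (k := k) [] (show n + 1 = n + 1 from rfl) (show n + 1 + 1 = n + 2 from rfl)
        (show 1 + 1 = 2 from rfl) rfl
      have h4 := sp_naturality (k := k) (show n + 1 = n + 1 from rfl) (mg 1 1 2 rfl [])
      have h5 := sp_naturality (k := k) (show 1 + n = n + 1 by omega) (mg 1 1 2 rfl [])
      have h6 := antTerm_merge (k := k) n rfl
      rw [← Category.assoc (L 1 (mg n 1 _ _ _)), ← L_comp, h3, L_comp, Category.assoc,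
        ← Category.assoc (sp 1 n _ _ _), h5, Category.assoc]
      refine h2.trans ?_
      rw [Preadditive.comp_add, Linear.comp_smul, h6, ← Category.assoc, ← h4, Category.assoc,
        ← Category.assoc (L n _), ← L_comp, ← Category.assoc (L 1 _), ← L_comp, mg_sp_eq, L_add, L_id,
        Preadditive.add_comp, Category.id_comp, L_add, Preadditive.add_comp, Preadditive.comp_add]
    -- The main term of `T1`, after the merge, is the desired cap plus a web in which two strands
    -- `1` cross before the cap. The case of three strands `1` moves that crossing to the other
    -- side, where it cancels against `T2`.
    have h7 := mg_sp_swap (k := k) n [1]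
    have h8 := congrArg (· ≫ L (n + 1) (cp [])) h7
    have h9 := mg_naturality (k := k) (show n + 1 = n + 1 from rfl) (cp [])
    simp only [Preadditive.add_comp, Category.assoc, Category.id_comp] at h8
    rw [h9, ← Category.assoc (L n (Xt _ _ _)), ← L_comp, Xt_cap_one_one] at h8
    -- The antenna terms of `T1` and `T3` cancel, as do those of `T2` and `T4`.
    rw [hr, Xt_succ_one [1] n (by omega) (by omega), Preadditive.sub_comp, Preadditive.comp_sub,
      Preadditive.comp_sub]
    simp only [Category.assoc]
    rw [T1, T2, reassoc_of% T3, reassoc_of% T4]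
    rw [Preadditive.comp_add, h8]
    simp only [Preadditive.add_comp, Linear.smul_comp, Linear.comp_smul, Category.assoc]
    abel

end PWeb

namespace PWeb

variable {k : Type u} [CommRing k] [Invertible (2 : k)]

/-! ### Crossings of words followed by further strands -/

section

variable {b b' b'' c c' : List ℕ+}

/-- Add the strands of a word on the left. -/
def lw (X : List ℕ+) (f : (⟨b⟩ : PWeb k) ⟶ ⟨b'⟩) : (⟨X ++ b⟩ : PWeb k) ⟶ ⟨X ++ b'⟩ :=
  tens (𝟙 (⟨X⟩ : PWeb k)) f

/-- Add one strand on the left. -/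
def lc (a : ℕ+) (f : (⟨b⟩ : PWeb k) ⟶ ⟨b'⟩) : (⟨a :: b⟩ : PWeb k) ⟶ ⟨a :: b'⟩ :=
  tens (𝟙 (⟨[a]⟩ : PWeb k)) f

/-- Add the strands of a word on the right. -/
def rt (f : (⟨b⟩ : PWeb k) ⟶ ⟨b'⟩) (t : List ℕ+) : (⟨b ++ t⟩ : PWeb k) ⟶ ⟨b' ++ t⟩ :=
  tens f (𝟙 (⟨t⟩ : PWeb k))

theorem lw_comp (X : List ℕ+) (f : (⟨b⟩ : PWeb k) ⟶ ⟨b'⟩) (g : (⟨b'⟩ : PWeb k) ⟶ ⟨b''⟩) :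
    lw X (f ≫ g) = lw X f ≫ lw X g := tens_id_comp X f g

theorem lc_comp (a : ℕ+) (f : (⟨b⟩ : PWeb k) ⟶ ⟨b'⟩) (g : (⟨b'⟩ : PWeb k) ⟶ ⟨b''⟩) :
    lc a (f ≫ g) = lc a f ≫ lc a g := tens_id_comp [a] f g

theorem rt_comp (t : List ℕ+) (f : (⟨b⟩ : PWeb k) ⟶ ⟨b'⟩) (g : (⟨b'⟩ : PWeb k) ⟶ ⟨b''⟩) :
    rt (f ≫ g) t = rt f t ≫ rt g t := tens_comp_id t f g

theorem lw_id (X b : List ℕ+) : lw X (𝟙 (⟨b⟩ : PWeb k)) = 𝟙 _ := tens_id_id X b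

theorem lc_id (a : ℕ+) (b : List ℕ+) : lc a (𝟙 (⟨b⟩ : PWeb k)) = 𝟙 _ := tens_id_id [a] b

theorem rt_id (b t : List ℕ+) : rt (𝟙 (⟨b⟩ : PWeb k)) t = 𝟙 _ := tens_id_id b t

theorem lw_lw_heq (X Y : List ℕ+) (f : (⟨b⟩ : PWeb k) ⟶ ⟨b'⟩) : lw (X ++ Y) f ≍ lw X (lw Y f) := by
  rw [lw, ← tens_id_id X Y]
  exact tens_assoc_heq _ _ f

theorem lw_cons (a : ℕ+) (X : List ℕ+) (f : (⟨b⟩ : PWeb k) ⟶ ⟨b'⟩) :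
    (lw (a :: X) f : (⟨a :: (X ++ b)⟩ : PWeb k) ⟶ ⟨a :: (X ++ b')⟩) = lc a (lw X f) :=
  eq_of_heq (lw_lw_heq [a] X f)

theorem lw_nil (f : (⟨b⟩ : PWeb k) ⟶ ⟨b'⟩) : lw [] f = f := unit_tens f

theorem rt_rt_heq (f : (⟨b⟩ : PWeb k) ⟶ ⟨b'⟩) (s t : List ℕ+) : rt f (s ++ t) ≍ rt (rt f s) t := by
  rw [rt, ← tens_id_id s t]
  exact (tens_assoc_heq f _ _).symm

theorem rt_nil_heq (f : (⟨b⟩ : PWeb k) ⟶ ⟨b'⟩) : rt f [] ≍ f := tens_unit_heq f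

theorem rt_lw_heq (X t : List ℕ+) (f : (⟨b⟩ : PWeb k) ⟶ ⟨b'⟩) : rt (lw X f) t ≍ lw X (rt f t) :=
  tens_assoc_heq _ f _

theorem rt_lc (a : ℕ+) (t : List ℕ+) (f : (⟨b⟩ : PWeb k) ⟶ ⟨b'⟩) : rt (lc a f) t = lc a (rt f t) :=
  eq_of_heq (tens_assoc_heq _ f _)

theorem lw_heq {X X' : List ℕ+} {f : (⟨b⟩ : PWeb k) ⟶ ⟨b'⟩} {g : (⟨c⟩ : PWeb k) ⟶ ⟨c'⟩}
    (hX : X = X') (hb : b = c) (hb' : b' = c') (h : f ≍ g) : lw X f ≍ lw X' g :=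
  tens_heq hX hX hb hb' (id_heq hX) h

theorem lc_heq (a : ℕ+) {f : (⟨b⟩ : PWeb k) ⟶ ⟨b'⟩} {g : (⟨c⟩ : PWeb k) ⟶ ⟨c'⟩}
    (hb : b = c) (hb' : b' = c') (h : f ≍ g) : lc a f ≍ lc a g :=
  tens_heq rfl rfl hb hb' HEq.rfl h

theorem rt_heq {f : (⟨b⟩ : PWeb k) ⟶ ⟨b'⟩} {g : (⟨c⟩ : PWeb k) ⟶ ⟨c'⟩} {t t' : List ℕ+}
    (hb : b = c) (hb' : b' = c') (ht : t = t') (h : f ≍ g) : rt f t ≍ rt g t' :=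
  tens_heq hb hb' ht ht h (id_heq ht)

theorem lc_mem (a : ℕ+) {f : (⟨b⟩ : PWeb k) ⟶ ⟨b'⟩} {p : ZMod 2}
    (hf : f ∈ parity (⟨b⟩ : PWeb k) ⟨b'⟩ p) : lc a f ∈ parity (⟨a :: b⟩ : PWeb k) ⟨a :: b'⟩ p := by
  have := tens_mem (id_mem_parity (k := k) [a]) hf
  rwa [zero_add] at this

/-- An even morphism commutes with every morphism on disjoint strands. -/
theorem rt_comp_lw {f : (⟨b⟩ : PWeb k) ⟶ ⟨b'⟩} (g : (⟨c⟩ : PWeb k) ⟶ ⟨c'⟩)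
    (hf : f ∈ parity (⟨b⟩ : PWeb k) ⟨b'⟩ 0) : rt f c ≫ lw b' g = lw b g ≫ rt f c' :=
  (tens_id_comp_id_tens g hf).trans (id_tens_comp_tens_id f g).symm

theorem rt_comp_lw' (f : (⟨b⟩ : PWeb k) ⟶ ⟨b'⟩) {g : (⟨c⟩ : PWeb k) ⟶ ⟨c'⟩}
    (hg : g ∈ parity (⟨c⟩ : PWeb k) ⟨c'⟩ 0) : rt f c ≫ lw b' g = lw b g ≫ rt f c' :=
  (tens_id_comp_id_tens' f hg).trans (id_tens_comp_tens_id f g).symm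

end

theorem sum_mem_parity {a b : List ℕ+} {ι : Type*} (s : Finset ι)
    (f : ι → ((⟨a⟩ : PWeb k) ⟶ ⟨b⟩)) (p : ZMod 2)
    (h : ∀ i ∈ s, f i ∈ parity (⟨a⟩ : PWeb k) ⟨b⟩ p) : ∑ i ∈ s, f i ∈ parity (⟨a⟩ : PWeb k) ⟨b⟩ p :=
  Submodule.sum_mem _ h

theorem hasParity_cast {k : Type*} {a a' b b' : List ℕ+} (ha : a = a') (hb : b = b') {f : PreWeb k a b}
    {p : ZMod 2} (h : f.HasParity p) : (f.cast ha hb).HasParity p := by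
  subst ha hb; exact h

theorem rungRight_hasParity {k : Type*} (s a b c d : ℕ) :
    (PreWeb.rungRight s a b c d : PreWeb k _ _).HasParity 0 := by
  unfold PreWeb.rungRight
  split_ifs with h
  · exact .comp (p := 0) (q := 0) (hasParity_cast _ _ (.tensor (p := 0) (q := 0) (.split _ _) (.id _)))
      (hasParity_cast _ _ (.tensor (p := 0) (q := 0) (.id _) (.merge _ _)))
  · exact .zero _ _ _

theorem rungLeft_hasParity {k : Type*} (s a b c d : ℕ) :
    (PreWeb.rungLeft s a b c d : PreWeb k _ _).HasParity 0 := by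
  unfold PreWeb.rungLeft
  split_ifs with h
  · exact .comp (p := 0) (q := 0) (hasParity_cast _ _ (.tensor (p := 0) (q := 0) (.id _) (.split _ _)))
      (hasParity_cast _ _ (.tensor (p := 0) (q := 0) (.merge _ _) (.id _)))
  · exact .zero _ _ _

theorem strandCrossing_mem (a b : ℕ) :
    strandCrossing a b ∈ parity (⟨strand a ++ strand b⟩ : PWeb k) ⟨strand b ++ strand a⟩ 0 :=
  sum_mem_parity _ _ _ fun _ _ => Submodule.smul_mem _ _
    (comp_mem_even (ofPreWeb_mem (rungRight_hasParity _ _ _ _ _))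
      (ofPreWeb_mem (rungLeft_hasParity _ _ _ _ _)))

theorem pairCrossing_mem (a b : ℕ+) :
    pairCrossing a b ∈ parity (⟨[a, b]⟩ : PWeb k) ⟨[b, a]⟩ 0 :=
  comp_mem_even (b := strand a ++ strand b) (eqToHom_mem _)
    (comp_mem_even (strandCrossing_mem _ _) (eqToHom_mem _))

theorem pairCrossing_heq (a b : ℕ+) :
    (pairCrossing a b : (⟨[a, b]⟩ : PWeb k) ⟶ ⟨[b, a]⟩) ≍ (strandCrossing a b : PairHom k a b b a) := by
  rw [pairCrossing, eqToHom_comp_heq_iff, comp_eqToHom_heq_iff]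

theorem strandCrossing_comp (a b : ℕ) :
    (strandCrossing a b ≫ strandCrossing b a : PairHom k a b a b) = 𝟙 _ := by
  have e : ∀ a b : ℕ, (Xt a b [] : LHom k _ _) ≍ (strandCrossing a b : PairHom k a b b a) :=
    fun a b => (pr_heq _ _).trans (tens_unit_heq _)
  have h : ∀ a b : ℕ, wd [a, b] = strand a ++ strand b := fun a b => by simp [wd]
  refine eq_of_heq ((comp_heq (h a b) (h b a) (h a b) (e a b) (e b a)).symm.trans ?_)
  exact (heq_of_eq (Xt_comp_Xt a b 0)).trans (id_heq (h a b))

theorem pairCrossing_comp (a b : ℕ+) :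
    (pairCrossing a b ≫ pairCrossing b a : (⟨[a, b]⟩ : PWeb k) ⟶ ⟨[a, b]⟩) = 𝟙 _ := by
  have h : ∀ a b : ℕ+, [a, b] = strand a ++ strand b := fun a b => by rw [strand_coe, strand_coe]; rfl
  refine eq_of_heq ((comp_heq (h a b) (h b a) (h a b) (pairCrossing_heq a b)
    (pairCrossing_heq b a)).trans ?_)
  exact (heq_of_eq (strandCrossing_comp _ _)).trans (id_heq (h a b)).symm

/-- The crossing of the first two strands. -/
def xw (a c : ℕ+) (t : List ℕ+) : (⟨a :: c :: t⟩ : PWeb k) ⟶ ⟨c :: a :: t⟩ := rt (pairCrossing a c) t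

/-- The first strand crosses the strands of `b`. -/
def crossOneTail (a : ℕ+) : ∀ b t : List ℕ+, (⟨a :: (b ++ t)⟩ : PWeb k) ⟶ ⟨b ++ (a :: t)⟩
  | [], _ => 𝟙 _
  | c :: b, t => xw a c (b ++ t) ≫ lc c (crossOneTail a b t)

/-- The strands of `a` cross the strands of `b`, with the strands of `t` on the right. -/
def crossTail : ∀ a b t : List ℕ+, (⟨a ++ (b ++ t)⟩ : PWeb k) ⟶ ⟨b ++ (a ++ t)⟩
  | [], _, _ => 𝟙 _
  | a :: as, b, t => lc a (crossTail as b t) ≫ crossOneTail a b (as ++ t)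

theorem crossOneTail_cons (a c : ℕ+) (b t : List ℕ+) :
    (crossOneTail a (c :: b) t : (⟨a :: c :: (b ++ t)⟩ : PWeb k) ⟶ ⟨c :: (b ++ a :: t)⟩) =
      xw a c (b ++ t) ≫ lc c (crossOneTail a b t) := rfl

theorem crossTail_cons (a : ℕ+) (as b t : List ℕ+) :
    (crossTail (a :: as) b t : (⟨a :: (as ++ (b ++ t))⟩ : PWeb k) ⟶ ⟨b ++ a :: (as ++ t)⟩) =
      lc a (crossTail as b t) ≫ crossOneTail a b (as ++ t) := rfl

theorem crossTail_singleton_left (a : ℕ+) (b t : List ℕ+) :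
    (crossTail [a] b t : (⟨a :: (b ++ t)⟩ : PWeb k) ⟶ ⟨b ++ a :: t⟩) = crossOneTail a b t := by
  refine (crossTail_cons a [] b t).trans ?_
  exact (congrArg (· ≫ crossOneTail a b t) (lc_id a (b ++ t))).trans (Category.id_comp _)

theorem crossOneTail_singleton (a c : ℕ+) (t : List ℕ+) :
    (crossOneTail a [c] t : (⟨a :: c :: t⟩ : PWeb k) ⟶ ⟨c :: a :: t⟩) = xw a c t := by
  refine (crossOneTail_cons a c [] t).trans ?_
  exact (congrArg (xw a c t ≫ ·) (lc_id c (a :: t))).trans (Category.comp_id _)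

theorem xw_mem (a c : ℕ+) (t : List ℕ+) :
    xw a c t ∈ parity (⟨a :: c :: t⟩ : PWeb k) ⟨c :: a :: t⟩ 0 :=
  tens_mem (pairCrossing_mem a c) (id_mem_parity t)

theorem crossOneTail_mem (a : ℕ+) (b t : List ℕ+) :
    crossOneTail a b t ∈ parity (⟨a :: (b ++ t)⟩ : PWeb k) ⟨b ++ (a :: t)⟩ 0 := by
  induction b with
  | nil => exact id_mem_parity _
  | cons c b ih => exact comp_mem_even (xw_mem a c _) (lc_mem c ih)

theorem crossTail_mem (a b t : List ℕ+) :
    crossTail a b t ∈ parity (⟨a ++ (b ++ t)⟩ : PWeb k) ⟨b ++ (a ++ t)⟩ 0 := by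
  induction a with
  | nil => exact id_mem_parity _
  | cons c a ih => exact comp_mem_even (lc_mem c ih) (crossOneTail_mem c b _)

section

variable {t t' : List ℕ+} (g : (⟨t⟩ : PWeb k) ⟶ ⟨t'⟩)

theorem xw_naturality (a c : ℕ+) : xw a c t ≫ lc c (lc a g) = lc a (lc c g) ≫ xw a c t' := by
  have e : ∀ a c : ℕ+, lc c (lc a g) = lw [c, a] g := fun a c => eq_of_heq (lw_lw_heq [c] [a] g).symm
  rw [e, e]
  exact rt_comp_lw g (pairCrossing_mem a c)

theorem crossOneTail_naturality (a : ℕ+) (b : List ℕ+) :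
    crossOneTail a b t ≫ lw b (lc a g) = lc a (lw b g) ≫ crossOneTail a b t' := by
  induction b with
  | nil =>
    refine (Category.id_comp _).trans ((lw_nil _).trans ?_)
    exact ((congrArg (lc a) (lw_nil g)).symm).trans (Category.comp_id _).symm
  | cons c b ih =>
    refine (congrArg₂ (· ≫ ·) (crossOneTail_cons a c b t) (lw_cons c b (lc a g))).trans
      (Eq.trans ?_ (congrArg₂ (· ≫ ·) (congrArg (lc a) (lw_cons c b g))
        (crossOneTail_cons a c b t')).symm)
    rw [Category.assoc, ← lc_comp, ih, lc_comp, ← Category.assoc, xw_naturality, Category.assoc]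

theorem crossTail_naturality (a b : List ℕ+) :
    crossTail a b t ≫ lw b (lw a g) = lw a (lw b g) ≫ crossTail a b t' := by
  induction a with
  | nil =>
    refine (Category.id_comp _).trans ((congrArg (lw b) (lw_nil g)).trans ?_)
    exact ((lw_nil _).symm).trans (Category.comp_id _).symm
  | cons c a ih =>
    refine (congrArg₂ (· ≫ ·) (crossTail_cons c a b t) (congrArg (lw b) (lw_cons c a g))).trans
      (Eq.trans ?_ (congrArg₂ (· ≫ ·) (lw_cons c a (lw b g)) (crossTail_cons c a b t')).symm)
    rw [Category.assoc, crossOneTail_naturality, ← Category.assoc, ← lc_comp, ih, lc_comp,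
      Category.assoc]

end

/-! ### The hexagon identities -/

theorem crossOneTail_append (a : ℕ+) (b b' t : List ℕ+) :
    (crossOneTail a (b ++ b') t : (⟨a :: ((b ++ b') ++ t)⟩ : PWeb k) ⟶ _) ≍
      (crossOneTail a b (b' ++ t) ≫ lw b (crossOneTail a b' t) : (⟨a :: (b ++ (b' ++ t))⟩ : PWeb k) ⟶ _) := by
  induction b with
  | nil => exact heq_of_eq (((Category.id_comp _).trans (lw_nil _)).symm)
  | cons c b ih =>
    refine (heq_of_eq (crossOneTail_cons a c (b ++ b') t)).trans (HEq.trans ?_ (heq_of_eq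
      (congrArg₂ (· ≫ ·) (crossOneTail_cons a c b (b' ++ t)) (lw_cons c b (crossOneTail a b' t))).symm))
    rw [Category.assoc, ← lc_comp]
    exact comp_heq (by simp) (by simp) (by simp) (rt_heq rfl rfl (by simp) HEq.rfl)
      (lc_heq c (by simp) (by simp) ih)

theorem crossTail_append_left (a a' b t : List ℕ+) :
    (crossTail (a ++ a') b t : (⟨(a ++ a') ++ (b ++ t)⟩ : PWeb k) ⟶ _) ≍
      (lw a (crossTail a' b t) ≫ crossTail a b (a' ++ t) : (⟨a ++ (a' ++ (b ++ t))⟩ : PWeb k) ⟶ _) := by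
  induction a with
  | nil => exact heq_of_eq (((Category.comp_id _).trans (lw_nil _)).symm)
  | cons c a ih =>
    refine (heq_of_eq (crossTail_cons c (a ++ a') b t)).trans (HEq.trans ?_ (heq_of_eq
      (congrArg₂ (· ≫ ·) (lw_cons c a (crossTail a' b t)) (crossTail_cons c a b (a' ++ t))).symm))
    rw [← Category.assoc, ← lc_comp]
    exact comp_heq (by simp) (by simp) (by simp) (lc_heq c (by simp) (by simp) ih)
      (by rw [List.append_assoc])

/-- The two sides perform the same crossings in different orders. The crossings of the first strand
`c` with `b` and those of the remaining strands with `b'` involve disjoint strands, and naturality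
in the tail interchanges them. -/
theorem crossTail_append_right (a b b' t : List ℕ+) :
    (crossTail a (b ++ b') t : (⟨a ++ ((b ++ b') ++ t)⟩ : PWeb k) ⟶ _) ≍
      (crossTail a b (b' ++ t) ≫ lw b (crossTail a b' t) : (⟨a ++ (b ++ (b' ++ t))⟩ : PWeb k) ⟶ _) := by
  induction a with
  | nil =>
    refine HEq.trans (b := 𝟙 (⟨b ++ (b' ++ t)⟩ : PWeb k)) (id_heq (List.append_assoc _ _ _))
      (heq_of_eq ?_)
    exact ((Category.id_comp _).trans (lw_id _ _)).symm
  | cons c a ih =>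
    refine (heq_of_eq (crossTail_cons c a (b ++ b') t)).trans (HEq.trans ?_ (heq_of_eq
      (congrArg₂ (· ≫ ·) (crossTail_cons c a b (b' ++ t))
        (congrArg (lw b) (crossTail_cons c a b' t))).symm))
    rw [lw_comp, Category.assoc, ← Category.assoc (crossOneTail _ _ _), crossOneTail_naturality,
      Category.assoc, ← Category.assoc, ← lc_comp]
    exact comp_heq (by simp) (by simp) (by simp) (lc_heq c (by simp) (by simp) ih)
      (crossOneTail_append c b b' (a ++ t))

theorem crossTail_cons_right (a : List ℕ+) (c : ℕ+) (b t : List ℕ+) :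
    (crossTail a (c :: b) t : (⟨a ++ c :: (b ++ t)⟩ : PWeb k) ⟶ ⟨c :: (b ++ (a ++ t))⟩) =
      crossTail a [c] (b ++ t) ≫ lc c (crossTail a b t) :=
  eq_of_heq (crossTail_append_right a [c] b t)

theorem xw_comp_xw (a c : ℕ+) (t : List ℕ+) :
    (xw a c t ≫ xw c a t : (⟨a :: c :: t⟩ : PWeb k) ⟶ _) = 𝟙 _ := by
  refine (rt_comp t (pairCrossing a c) (pairCrossing c a)).symm.trans ?_
  rw [pairCrossing_comp]
  exact rt_id _ _

theorem crossOneTail_comp (a : ℕ+) (b t : List ℕ+) :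
    crossOneTail a b t ≫ (crossTail b [a] t : (⟨b ++ (a :: t)⟩ : PWeb k) ⟶ ⟨a :: (b ++ t)⟩) =
      𝟙 _ := by
  induction b with
  | nil => exact Category.id_comp _
  | cons c b ih =>
    refine (congrArg₂ (· ≫ ·) (crossOneTail_cons a c b t) (crossTail_cons c b [a] t)).trans ?_
    rw [Category.assoc]
    refine (congrArg (xw a c (b ++ t) ≫ ·) (Eq.trans ?_ (Category.id_comp _))).trans
      (xw_comp_xw a c (b ++ t))
    refine (Category.assoc _ _ _).symm.trans (congrArg₂ (· ≫ ·) ?_ (crossOneTail_singleton c a (b ++ t)))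
    exact (lc_comp _ _ _).symm.trans ((congrArg (lc c) ih).trans (lc_id _ _))

theorem crossTail_nil_right (a t : List ℕ+) :
    (crossTail a [] t : (⟨a ++ t⟩ : PWeb k) ⟶ ⟨a ++ t⟩) = 𝟙 _ := by
  induction a with
  | nil => rfl
  | cons c a ih =>
    exact (crossTail_cons c a [] t).trans ((congrArg (· ≫ _) ((congrArg (lc c) ih).trans
      (lc_id _ _))).trans (Category.id_comp _))

theorem crossTail_comp (a b t : List ℕ+) :
    crossTail a b t ≫ crossTail b a t = 𝟙 (⟨a ++ (b ++ t)⟩ : PWeb k) := by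
  induction a with
  | nil =>
    exact (Category.id_comp _).trans (crossTail_nil_right b t)
  | cons c a ih =>
    refine (congrArg₂ (· ≫ ·) (crossTail_cons c a b t) (crossTail_cons_right b c a t)).trans ?_
    rw [Category.assoc]
    refine (congrArg (lc c (crossTail a b t) ≫ ·) (Eq.trans (Category.assoc _ _ _).symm
      ((congrArg (· ≫ lc c (crossTail b a t)) (crossOneTail_comp c b (a ++ t))).trans
        (Category.id_comp _)))).trans ?_
    exact (lc_comp _ _ _).symm.trans ((congrArg (lc c) ih).trans (lc_id _ _))

theorem rt_crossOne_heq (a : ℕ+) (b t : List ℕ+) :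
    rt (crossOne (k := k) a b) t ≍ (crossOneTail a b t : (⟨a :: (b ++ t)⟩ : PWeb k) ⟶ _) := by
  induction b with
  | nil => exact heq_of_eq (rt_id [a] t)
  | cons c b ih =>
    refine HEq.trans (heq_of_eq (rt_comp t (xw a c b) (lc c (crossOne a b)))) ?_
    exact comp_heq rfl rfl (by simp) (rt_rt_heq _ b t).symm
      ((heq_of_eq (rt_lc c t (crossOne a b))).trans (lc_heq c rfl (by simp) ih))

theorem crossWords_cons (c : ℕ+) (a b : List ℕ+) :
    (crossWords (c :: a) b : (⟨c :: (a ++ b)⟩ : PWeb k) ⟶ ⟨b ++ c :: a⟩) =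
      lc c (crossWords a b) ≫ (rt (crossOne c b) a : (⟨c :: (b ++ a)⟩ : PWeb k) ⟶ _) ≫
        eqToHom (congrArg PWeb.mk (List.append_assoc b [c] a)) := rfl

/-- The crossings with spectator strands `t` are those of the definition tensored with an identity.
The bracketing `a ++ (b ++ t)` lets `crossTail` be defined recursively without transports. -/
theorem rt_crossWords_heq (a b t : List ℕ+) :
    rt (crossWords (k := k) a b) t ≍ (crossTail a b t : (⟨a ++ (b ++ t)⟩ : PWeb k) ⟶ _) := by
  induction a with
  | nil =>
    have h : (crossWords [] b : (⟨b⟩ : PWeb k) ⟶ ⟨b ++ []⟩) ≍ 𝟙 (⟨b⟩ : PWeb k) := by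
      rw [crossWords]; exact eqToHom_heq_id_dom _ _ _
    exact (rt_heq rfl (List.append_nil b) rfl h).trans (heq_of_eq (rt_id b t))
  | cons c a ih =>
    have e : (crossWords (c :: a) b : (⟨c :: (a ++ b)⟩ : PWeb k) ⟶ _) ≍
        (lc c (crossWords a b) ≫ rt (crossOne c b) a : (⟨c :: (a ++ b)⟩ : PWeb k) ⟶ _) := by
      rw [crossWords_cons, ← Category.assoc, comp_eqToHom_heq_iff]
    refine (rt_heq rfl (by simp) rfl e).trans ?_
    refine (heq_of_eq (rt_comp t (lc c (crossWords a b)) (rt (crossOne c b) a))).trans ?_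
    exact comp_heq (by simp) (by simp) (by simp)
      ((heq_of_eq (rt_lc c t _)).trans (lc_heq c (by simp) (by simp) ih))
      ((rt_rt_heq _ a t).symm.trans (rt_crossOne_heq c b (a ++ t)))

theorem crossWords_heq (a b : List ℕ+) :
    (crossWords a b : (⟨a ++ b⟩ : PWeb k) ⟶ _) ≍ (crossTail a b [] : (⟨a ++ (b ++ [])⟩ : PWeb k) ⟶ _) :=
  (rt_nil_heq _).symm.trans (rt_crossWords_heq a b [])

end PWeb

namespace PWeb

variable {k : Type u} [CommRing k] [Invertible (2 : k)]

/-! ### Naturality of the crossings -/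

/-- The strands of `a` cross one strand `c`. -/
def crossStrand (a : List ℕ+) (c : ℕ+) (t : List ℕ+) :
    (⟨a ++ c :: t⟩ : PWeb k) ⟶ ⟨c :: (a ++ t)⟩ := crossTail a [c] t

theorem crossStrand_mem (a : List ℕ+) (c : ℕ+) (t : List ℕ+) :
    crossStrand a c t ∈ parity (⟨a ++ c :: t⟩ : PWeb k) ⟨c :: (a ++ t)⟩ 0 := crossTail_mem a [c] t

theorem crossStrand_naturality {t t' : List ℕ+} (g : (⟨t⟩ : PWeb k) ⟶ ⟨t'⟩) (a : List ℕ+) (c : ℕ+) :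
    crossStrand a c t ≫ lc c (lw a g) = lw a (lc c g) ≫ crossStrand a c t' :=
  crossTail_naturality g a [c]

theorem crossStrand_append_heq (a b : List ℕ+) (c : ℕ+) (t : List ℕ+) :
    (crossStrand (a ++ b) c t : (⟨(a ++ b) ++ c :: t⟩ : PWeb k) ⟶ _) ≍
      (lw a (crossStrand b c t) ≫ crossStrand a c (b ++ t) : (⟨a ++ (b ++ c :: t)⟩ : PWeb k) ⟶ _) :=
  crossTail_append_left a b [c] t

theorem rt_crossStrand_heq (a : List ℕ+) (c : ℕ+) (t : List ℕ+) :
    rt (crossStrand (k := k) a c []) t ≍ (crossStrand a c t : (⟨a ++ c :: t⟩ : PWeb k) ⟶ _) :=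
  (rt_heq (by simp) (by simp) rfl (crossWords_heq a [c]).symm).trans (rt_crossWords_heq a [c] t)

/-- The crossings are natural for `f` on the left. -/
def CrossNatural {a a' : List ℕ+} (f : (⟨a⟩ : PWeb k) ⟶ ⟨a'⟩) : Prop :=
  ∀ (c : ℕ+) (t : List ℕ+),
    rt f (c :: t) ≫ crossStrand a' c t = crossStrand a c t ≫ lc c (rt f t)

section

variable {a a' a'' b b' : List ℕ+}

theorem crossNatural_of_nil {f : (⟨a⟩ : PWeb k) ⟶ ⟨a'⟩}
    (h : ∀ c : ℕ+, rt f [c] ≫ crossStrand a' c [] = crossStrand a c [] ≫ lc c (rt f [])) :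
    CrossNatural f := by
  intro c t
  have key := congrArg (rt · t) (h c)
  simp only [rt_comp] at key
  refine eq_of_heq (HEq.trans ?_ ((heq_of_eq key).trans ?_))
  · exact comp_heq (by simp) (by simp) (by simp) (rt_rt_heq f [c] t) (rt_crossStrand_heq a' c t).symm
  · exact comp_heq (by simp) (by simp) (by simp) (rt_crossStrand_heq a c t)
      ((heq_of_eq (rt_lc c t _)).trans (lc_heq c (by simp) (by simp) (rt_rt_heq f [] t).symm))

theorem CrossNatural.comp {f : (⟨a⟩ : PWeb k) ⟶ ⟨a'⟩} {g : (⟨a'⟩ : PWeb k) ⟶ ⟨a''⟩}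
    (hf : CrossNatural f) (hg : CrossNatural g) : CrossNatural (f ≫ g) := by
  intro c t
  rw [rt_comp, rt_comp, lc_comp, Category.assoc, hg, ← Category.assoc, hf, Category.assoc]

theorem crossNatural_id (a : List ℕ+) : CrossNatural (𝟙 (⟨a⟩ : PWeb k)) := by
  intro c t
  rw [rt_id, rt_id, lc_id, Category.comp_id, Category.id_comp]

theorem crossNatural_zero : CrossNatural (0 : (⟨a⟩ : PWeb k) ⟶ ⟨a'⟩) := by
  intro c t
  have h : ∀ t, rt (0 : (⟨a⟩ : PWeb k) ⟶ ⟨a'⟩) t = 0 := fun t => tens_zero_left _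
  have h' : lc c (0 : (⟨a ++ t⟩ : PWeb k) ⟶ ⟨a' ++ t⟩) = 0 := tens_zero_right _
  rw [h, h, h', Limits.comp_zero, Limits.zero_comp]

theorem CrossNatural.add {f g : (⟨a⟩ : PWeb k) ⟶ ⟨a'⟩} (hf : CrossNatural f)
    (hg : CrossNatural g) : CrossNatural (f + g) := by
  intro c t
  have h : ∀ t, rt (f + g) t = rt f t + rt g t := fun t => tens_add_left _ _ _
  have h' : lc c (rt f t + rt g t) = lc c (rt f t) + lc c (rt g t) := tens_add_right _ _ _
  rw [h, h, h', Preadditive.add_comp, Preadditive.comp_add, hf, hg]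

theorem CrossNatural.smul (x : k) {f : (⟨a⟩ : PWeb k) ⟶ ⟨a'⟩} (hf : CrossNatural f) :
    CrossNatural (x • f) := by
  intro c t
  have h : ∀ t, rt (x • f) t = x • rt f t := fun t => tens_smul_left _ _ _
  have h' : lc c (x • rt f t) = x • lc c (rt f t) := tens_smul_right _ _ _
  rw [h, h, h', Linear.smul_comp, Linear.comp_smul, hf]

/-- The strands of `f` cross `c` first, where the hypothesis applies. Then the strands of `b` cross
`c`, and `f` lies in the tail of that crossing. -/
theorem CrossNatural.lw {f : (⟨a⟩ : PWeb k) ⟶ ⟨a'⟩} (hf : CrossNatural f) (b : List ℕ+) :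
    CrossNatural (lw b f) := by
  intro c t
  have key : PWeb.lw b (rt f (c :: t)) ≫ PWeb.lw b (crossStrand a' c t) ≫ crossStrand b c (a' ++ t) =
      (PWeb.lw b (crossStrand a c t) ≫ crossStrand b c (a ++ t)) ≫ lc c (PWeb.lw b (rt f t)) := by
    rw [← Category.assoc, ← lw_comp, hf, lw_comp, Category.assoc, Category.assoc,
      crossStrand_naturality]
  refine eq_of_heq (HEq.trans ?_ ((heq_of_eq key).trans ?_))
  · exact comp_heq (by simp) (by simp) (by simp) (rt_lw_heq b (c :: t) f)
      (crossStrand_append_heq b a' c t)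
  · exact comp_heq (by simp) (by simp) (by simp) (crossStrand_append_heq b a c t).symm
      (lc_heq c (by simp) (by simp) (rt_lw_heq b t f).symm)

/-- The strands of `b` cross `c` first; this crossing is even and passes `f` without a sign. -/
theorem CrossNatural.rt {f : (⟨a⟩ : PWeb k) ⟶ ⟨a'⟩} (hf : CrossNatural f) (b : List ℕ+) :
    CrossNatural (rt f b) := by
  intro c t
  have key : PWeb.rt f (b ++ c :: t) ≫ PWeb.lw a' (crossStrand b c t) ≫ crossStrand a' c (b ++ t) =
      (PWeb.lw a (crossStrand b c t) ≫ crossStrand a c (b ++ t)) ≫ lc c (PWeb.rt f (b ++ t)) := by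
    rw [← Category.assoc, rt_comp_lw' f (crossStrand_mem b c t), Category.assoc, hf, Category.assoc]
  refine eq_of_heq (HEq.trans ?_ ((heq_of_eq key).trans ?_))
  · exact comp_heq (by simp) (by simp) (by simp) (rt_rt_heq f b (c :: t)).symm
      (crossStrand_append_heq a' b c t)
  · exact comp_heq (by simp) (by simp) (by simp) (crossStrand_append_heq a b c t).symm
      (lc_heq c (by simp) (by simp) (rt_rt_heq f b t))

theorem CrossNatural.tens {f : (⟨a⟩ : PWeb k) ⟶ ⟨a'⟩} {g : (⟨b⟩ : PWeb k) ⟶ ⟨b'⟩}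
    (hf : CrossNatural f) (hg : CrossNatural g) : CrossNatural (tens f g) := by
  rw [← id_tens_comp_tens_id]
  exact (hg.lw a).comp (hf.rt b')

end

theorem crossStrand_strand (a n : ℕ) (t : List ℕ) :
    (crossStrand (strand a) n.succPNat (wd t) : LHom k (a :: (n + 1) :: t) ((n + 1) :: a :: t)) =
      Xt a (n + 1) t := by
  cases a with
  | zero => exact (Xt_zero_left (k := k) (n + 1) t).symm
  | succ m =>
    refine (crossTail_singleton_left m.succPNat [n.succPNat] (wd t)).trans
      ((crossOneTail_singleton m.succPNat n.succPNat (wd t)).trans (eq_of_heq ?_))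
    exact (rt_heq rfl rfl rfl (pairCrossing_heq m.succPNat n.succPNat)).trans (pr_heq _ t).symm

theorem crossStrand_strand_strand_heq (a b n : ℕ) (t : List ℕ) :
    (crossStrand (strand a ++ strand b) n.succPNat (wd t) : (⟨_⟩ : PWeb k) ⟶ ⟨_⟩) ≍
      (L a (Xt b (n + 1) t) ≫ Xt a (n + 1) (b :: t) : LHom k _ _) :=
  (crossStrand_append_heq (strand a) (strand b) n.succPNat (wd t)).trans (heq_of_eq
    (congrArg₂ (· ≫ ·) (congrArg
      (fun f : LHom k (b :: (n + 1) :: t) ((n + 1) :: b :: t) => L a f) (crossStrand_strand b n t)) (crossStrand_strand a n (b :: t))))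

theorem crossNatural_merge (a b : ℕ) : CrossNatural (ofPreWeb (.merge a b : PreWeb k _ _)) := by
  refine crossNatural_of_nil fun c => ?_
  obtain ⟨n, rfl⟩ : ∃ n : ℕ, c = n.succPNat := ⟨c.natPred, (PNat.succPNat_natPred c).symm⟩
  have key := mg_Xt (k := k) (rfl : a + b = a + b) (n + 1)
  rw [← Category.assoc] at key
  refine eq_of_heq (HEq.trans ?_ ((heq_of_eq key).trans ?_))
  · exact comp_heq (by simp [wd, strand]) rfl rfl (mg_heq rfl [n + 1]).symm
      (heq_of_eq (crossStrand_strand (a + b) n []))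
  · exact comp_heq (by simp [wd, strand]) (by simp [wd, strand]) rfl
      (crossStrand_strand_strand_heq a b n []).symm
      (lc_heq _ (by simp [wd]) rfl (mg_heq rfl []))

theorem crossNatural_split (a b : ℕ) : CrossNatural (ofPreWeb (.split a b : PreWeb k _ _)) := by
  refine crossNatural_of_nil fun c => ?_
  obtain ⟨n, rfl⟩ : ∃ n : ℕ, c = n.succPNat := ⟨c.natPred, (PNat.succPNat_natPred c).symm⟩
  -- `Xt_sp` has the additional strand on the left. Composing with the inverse crossings on both
  -- ends puts it on the right.
  have key : sp a b (a + b) rfl [n + 1] ≫ L a (Xt b (n + 1) []) ≫ Xt a (n + 1) [b] =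
      (Xt (a + b) (n + 1) [] ≫ L (n + 1) (sp a b (a + b) rfl []) : LHom k _ _) := by
    have h1 := Xt_sp (k := k) (rfl : a + b = a + b) (n + 1)
    have h2 : (Xt (a + b) (n + 1) [] ≫ Xt (n + 1) (a + b) [] : LHom k [a + b, n + 1] _) = 𝟙 _ :=
      Xt_comp_Xt (a + b) (n + 1) 0
    have h3 : (Xt b (n + 1) [] ≫ Xt (n + 1) b [] : LHom k [b, n + 1] _) = 𝟙 _ :=
      Xt_comp_Xt b (n + 1) 0
    have h3' : (Xt (n + 1) b [] ≫ Xt b (n + 1) [] : LHom k [n + 1, b] _) = 𝟙 _ :=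
      Xt_comp_Xt (n + 1) b 0
    rw [← Category.id_comp (sp a b (a + b) rfl [n + 1]), ← h2, Category.assoc, Category.assoc,
      ← Category.assoc (Xt (n + 1) (a + b) []), h1, Category.assoc, Category.assoc,
      ← Category.assoc (L a _), ← L_comp, h3', L_id, Category.id_comp, Xt_comp_Xt, Category.comp_id]
  refine eq_of_heq (HEq.trans ?_ ((heq_of_eq key).trans ?_))
  · exact comp_heq rfl (by simp [wd, strand]) (by simp [wd, strand]) (sp_heq rfl [n + 1]).symm
      (crossStrand_strand_strand_heq a b n [])
  · exact comp_heq rfl rfl (by simp [wd, strand])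
      (heq_of_eq (crossStrand_strand (a + b) n []).symm)
      (lc_heq _ rfl (by simp [wd]) (sp_heq rfl []))

/-- `Xt_cap` with both crossings moved to the other side. -/
theorem cp_eq_cross (c : ℕ) :
    cp [c] = (L 1 (Xt 1 c []) ≫ Xt 1 c [1] ≫ L c (cp []) : LHom k [1, 1, c] [c]) := by
  have h : (Xt 1 c [] ≫ Xt c 1 [] : LHom k [1, c] _) = 𝟙 _ := Xt_comp_Xt 1 c 0
  rw [← Xt_cap, ← Category.assoc (Xt 1 c [1]), Xt_comp_Xt, Category.id_comp, ← Category.assoc,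
    ← L_comp, h, L_id, Category.id_comp]

theorem crossNatural_cap : CrossNatural (ofPreWeb (.cap : PreWeb k _ _)) := by
  refine crossNatural_of_nil fun c => ?_
  obtain ⟨n, rfl⟩ : ∃ n : ℕ, c = n.succPNat := ⟨c.natPred, (PNat.succPNat_natPred c).symm⟩
  have key := cp_eq_cross (k := k) (n + 1)
  rw [← Category.assoc] at key
  refine eq_of_heq (HEq.trans ?_ ((heq_of_eq key).trans ?_))
  · exact heq_of_eq (Category.comp_id _)
  · exact comp_heq rfl rfl rfl (crossStrand_strand_strand_heq 1 1 n []).symm HEq.rfl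

/-! ### Naturality for the cup by straightening. -/

/-- The cup on the left of the other strands. -/
def cu (t : List ℕ) : LHom k t (1 :: 1 :: t) := tens (ofPreWeb .cup) (𝟙 (⟨wd t⟩ : PWeb k))

theorem cu_cp (t : List ℕ) : (cu (1 :: t) ≫ L 1 (cp t) : LHom k (1 :: t) (1 :: t)) = 𝟙 _ := by
  have h := ofPreWeb_rel (.straighten_left : PreWeb.WebRel k _ _)
  have h' := congrArg (tens · (𝟙 (⟨wd t⟩ : PWeb k))) h
  refine eq_of_heq (HEq.trans ?_ ((heq_of_eq h').trans (heq_of_eq (tens_id_id _ _))))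
  refine HEq.trans ?_ (heq_of_eq (ofPreWeb_comp_tens _ _ _).symm)
  exact comp_heq rfl rfl rfl ((tail_cons_heq _ 1 t).trans (tens_cast_heq rfl rfl _ _).symm)
    (tens_assoc_heq _ _ _).symm

theorem L_cu_cp (t : List ℕ) :
    (L 1 (cu t) ≫ cp (1 :: t) : LHom k (1 :: t) (1 :: t)) = -𝟙 _ := by
  have h := ofPreWeb_rel (.straighten_right : PreWeb.WebRel k _ _)
  have h' := congrArg (tens · (𝟙 (⟨wd t⟩ : PWeb k))) h
  rw [ofPreWeb_smul, tens_smul_left, neg_one_smul] at h'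
  rw [← neg_eq_iff_eq_neg]
  refine Eq.trans (congrArg Neg.neg ?_) (h'.trans (tens_id_id _ _))
  refine eq_of_heq (HEq.trans ?_ (heq_of_eq (ofPreWeb_comp_tens _ _ _).symm))
  exact comp_heq rfl rfl rfl ((tens_assoc_heq _ _ _).symm.trans (tens_cast_heq rfl rfl _ _).symm)
    (tail_cons_heq _ 1 t)

theorem cu_mem (t : List ℕ) : cu t ∈ parity (⟨wd t⟩ : PWeb k) ⟨wd (1 :: 1 :: t)⟩ 1 := by
  have := tens_mem (ofPreWeb_mem (k := k) .cup) (id_mem_parity (wd t))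
  rwa [add_zero] at this

/-- The sign comes from the interchange of the cup with the odd morphism `g`. -/
theorem cu_naturality {t t' : List ℕ} {g : LHom k t t'}
    (hg : g ∈ parity (⟨wd t⟩ : PWeb k) ⟨wd t'⟩ 1) : cu t ≫ L 1 (L 1 g) = -(g ≫ cu t') := by
  have h1 : L 1 (L 1 g) = tens (𝟙 (⟨strand 1 ++ strand 1⟩ : PWeb k)) g := by
    rw [← tens_id_id]
    exact eq_of_heq (tens_assoc_heq _ _ g).symm
  have h2 : g ≫ cu t' = tens (ofPreWeb .cup) g :=
    (congrArg (· ≫ cu t') (unit_tens g).symm).trans (id_tens_comp_tens_id _ _)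
  rw [h1, h2]
  refine (tens_comp_tens (p := 1) (q := 1) _ _ _ _ (ofPreWeb_mem .cup) hg).trans ?_
  rw [Category.comp_id, Category.id_comp]
  rw [show koszulSign k 1 1 = -1 by simp [koszulSign, ZMod.val_one], neg_one_smul]
  rfl

/-- An odd morphism that creates two strands `1` is determined by its composition with a cap. -/
theorem eq_of_L_comp_cp {t : List ℕ} {f g : LHom k t (1 :: 1 :: t)}
    (hf : f ∈ parity (⟨wd t⟩ : PWeb k) ⟨wd (1 :: 1 :: t)⟩ 1)
    (hg : g ∈ parity (⟨wd t⟩ : PWeb k) ⟨wd (1 :: 1 :: t)⟩ 1)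
    (h : L 1 f ≫ cp (1 :: t) = L 1 g ≫ cp (1 :: t)) : f = g := by
  -- A cup bends the capped strand back and straightening recovers `f`; the sign comes from moving
  -- the odd cup past the odd `f`.
  have key : ∀ f : LHom k t (1 :: 1 :: t), f ∈ parity (⟨wd t⟩ : PWeb k) ⟨wd (1 :: 1 :: t)⟩ 1 →
      cu t ≫ L 1 (L 1 f ≫ cp (1 :: t)) = -f := by
    intro f hf
    rw [L_comp, ← Category.assoc, cu_naturality hf, Preadditive.neg_comp, Category.assoc, cu_cp,
      Category.comp_id]
  rw [← neg_inj, ← key f hf, ← key g hg, h]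

theorem Xt_mem (a b : ℕ) (t : List ℕ) :
    Xt a b t ∈ parity (⟨wd (a :: b :: t)⟩ : PWeb k) ⟨wd (b :: a :: t)⟩ 0 :=
  comp_mem_even (eqToHom_mem _) (comp_mem_even
    (tens_mem (strandCrossing_mem a b) (id_mem_parity _)) (eqToHom_mem _))

theorem crossNatural_cup : CrossNatural (ofPreWeb (.cup : PreWeb k _ _)) := by
  refine crossNatural_of_nil fun c => ?_
  obtain ⟨n, rfl⟩ : ∃ n : ℕ, c = n.succPNat := ⟨c.natPred, (PNat.succPNat_natPred c).symm⟩
  have key : cu [n + 1] ≫ L 1 (Xt 1 (n + 1) []) ≫ Xt 1 (n + 1) [1] =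
      (L (n + 1) (cu []) : LHom k [n + 1] [n + 1, 1, 1]) := by
    -- Naturality of the cap past the strand `n + 1`, with one of the two crossings moved to the
    -- other side.
    have slide : (L 1 (Xt (n + 1) 1 [1]) ≫ cp [n + 1, 1] : LHom k [1, n + 1, 1, 1] [n + 1, 1]) =
        Xt 1 (n + 1) [1, 1] ≫ L (n + 1) (cp [1]) := by
      have h : cp [n + 1, 1] = ((L 1 (Xt 1 (n + 1) [1]) ≫ Xt 1 (n + 1) [1, 1]) ≫
          L (n + 1) (cp [1]) : LHom k [1, 1, n + 1, 1] [n + 1, 1]) := by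
        refine (Category.comp_id _).symm.trans
          ((crossNatural_cap (k := k) n.succPNat (wd [1])).trans (eq_of_heq ?_))
        exact comp_heq rfl rfl rfl (crossStrand_strand_strand_heq 1 1 n [1]) HEq.rfl
      rw [h, Category.assoc, ← Category.assoc (L 1 _), ← L_comp, Xt_comp_Xt, L_id, Category.id_comp]
    generalize n + 1 = c at slide ⊢
    have i1 : (Xt 1 c [] ≫ Xt c 1 [] : LHom k [1, c] _) = 𝟙 _ := Xt_comp_Xt 1 c 0
    have i2 : (Xt c 1 [] ≫ Xt 1 c [] : LHom k [c, 1] _) = 𝟙 _ := Xt_comp_Xt c 1 0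
    have h1 : cu [c] = (L c (cu []) ≫ Xt c 1 [1] ≫ L 1 (Xt c 1 []) : LHom k [c] [1, 1, c]) := by
      -- Both sides are odd, so they may be compared after adding a cap. The left side straightens
      -- to `-1`; on the right the cap is pulled through the strand `c` and the same straightening
      -- appears beside it.
      refine eq_of_L_comp_cp (cu_mem _) ?_ ?_
      · have := StrictMonoidalSupercategory.comp_mem (k := k) (C := PWeb k) (L_mem c (cu_mem (k := k) []))
          (comp_mem_even (Xt_mem c 1 [1]) (L_mem 1 (Xt_mem (k := k) c 1 [])))
        rwa [add_zero] at this
      · have e := pr_naturality (k := k) (strandCrossing_mem 1 c) (cu (k := k) [])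
        have e' : Xt 1 c [] ≫ L c (L 1 (cu [])) = L 1 (L c (cu [])) ≫ (Xt 1 c [1, 1] : LHom k _ _) := e
        rw [L_cu_cp, L_comp, L_comp, Category.assoc, Category.assoc, ← cp_naturality (Xt_mem c 1 []),
          ← Category.assoc (L 1 (Xt c 1 [1])), slide, Category.assoc, ← Category.assoc (L 1 _), ← e',
          Category.assoc, ← Category.assoc (L c _), ← L_comp, L_cu_cp, L_neg, L_id,
          Preadditive.neg_comp, Preadditive.comp_neg, Category.id_comp, i1]
    rw [h1, Category.assoc, Category.assoc, ← Category.assoc (L 1 _), ← L_comp, i2, L_id,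
      Category.id_comp, Xt_comp_Xt, Category.comp_id]
  refine eq_of_heq (HEq.trans ?_ ((heq_of_eq key).trans ?_))
  · exact comp_heq rfl rfl rfl HEq.rfl (crossStrand_strand_strand_heq 1 1 n [])
  · exact heq_of_eq (Category.id_comp _).symm

theorem crossNatural_ofPreWeb {a b : List ℕ+} (f : PreWeb k a b) : CrossNatural (ofPreWeb f) := by
  induction f with
  | id a => exact crossNatural_id a
  | comp f g hf hg => exact hf.comp hg
  | tensor f g hf hg => exact hf.tens hg
  | split a b => exact crossNatural_split a b
  | merge a b => exact crossNatural_merge a b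
  | cap => exact crossNatural_cap
  | cup => exact crossNatural_cup
  | zero a b => exact crossNatural_zero
  | add f g hf hg => exact hf.add hg
  | smul x f hf => exact hf.smul x

/-! ### Naturality, symmetry and hexagons for arbitrary words. -/

section

variable {a a' : List ℕ+}

theorem crossNatural (f : (⟨a⟩ : PWeb k) ⟶ ⟨a'⟩) : CrossNatural f := by
  obtain ⟨f, rfl⟩ := Hom.exists_rep f
  exact crossNatural_ofPreWeb f

theorem rt_comp_crossTail (f : (⟨a⟩ : PWeb k) ⟶ ⟨a'⟩) (b t : List ℕ+) :
    rt f (b ++ t) ≫ crossTail a' b t = crossTail a b t ≫ lw b (rt f t) := by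
  induction b with
  | nil =>
    refine (congrArg (rt f t ≫ ·) (crossTail_nil_right a' t)).trans ((Category.comp_id _).trans ?_)
    exact (Eq.trans (congrArg (· ≫ lw [] (rt f t)) (crossTail_nil_right a t))
      ((Category.id_comp _).trans (lw_nil _))).symm
  | cons c b ih =>
    have key : rt f (c :: (b ++ t)) ≫ crossStrand a' c (b ++ t) ≫ lc c (crossTail a' b t) =
        (crossStrand a c (b ++ t) ≫ lc c (crossTail a b t)) ≫ lc c (lw b (rt f t)) := by
      rw [← Category.assoc, crossNatural f, Category.assoc, ← lc_comp, ih, lc_comp, Category.assoc]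
    refine (congrArg (rt f (c :: (b ++ t)) ≫ ·) (crossTail_cons_right a' c b t)).trans (key.trans ?_)
    exact (congrArg₂ (· ≫ ·) (crossTail_cons_right a c b t) (lw_cons c b (rt f t))).symm

theorem rt_comp_crossWords (f : (⟨a⟩ : PWeb k) ⟶ ⟨a'⟩) (b : List ℕ+) :
    rt f b ≫ crossWords a' b = crossWords a b ≫ lw b f := by
  refine eq_of_heq (HEq.trans ?_ ((heq_of_eq (rt_comp_crossTail f b [])).trans ?_))
  · exact comp_heq (by simp) (by simp) (by simp) (rt_heq rfl rfl (by simp) HEq.rfl)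
      (crossWords_heq a' b)
  · exact comp_heq (by simp) (by simp) (by simp) (crossWords_heq a b).symm
      (lw_heq rfl (by simp) (by simp) (rt_nil_heq f))

theorem crossWords_comp (a b : List ℕ+) :
    (crossWords a b ≫ crossWords b a : (⟨a ++ b⟩ : PWeb k) ⟶ _) = 𝟙 _ := by
  refine eq_of_heq ((comp_heq (by simp) (by simp) (by simp) (crossWords_heq a b)
    (crossWords_heq b a)).trans ((heq_of_eq (crossTail_comp a b [])).trans (id_heq (by simp))))

/-- Naturality in the second factor is naturality in the first one for the reverse crossing, which
is the inverse. -/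
theorem lw_comp_crossWords (f : (⟨a⟩ : PWeb k) ⟶ ⟨a'⟩) (b : List ℕ+) :
    lw b f ≫ crossWords b a' = crossWords b a ≫ rt f b := by
  rw [← Category.comp_id (crossWords b a ≫ rt f b), ← crossWords_comp a' b, Category.assoc,
    ← Category.assoc (rt f b), rt_comp_crossWords, Category.assoc, ← Category.assoc,
    crossWords_comp, Category.id_comp]

theorem crossWords_mem (a b : List ℕ+) :
    crossWords a b ∈ parity (⟨a ++ b⟩ : PWeb k) ⟨b ++ a⟩ 0 := by
  have key : ∀ {x x' y y' : List ℕ+} {f : (⟨x⟩ : PWeb k) ⟶ ⟨y⟩} {g : (⟨x'⟩ : PWeb k) ⟶ ⟨y'⟩},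
      x = x' → y = y' → f ≍ g → g ∈ parity (⟨x'⟩ : PWeb k) ⟨y'⟩ 0 →
        f ∈ parity (⟨x⟩ : PWeb k) ⟨y⟩ 0 := by
    rintro _ _ _ _ _ _ rfl rfl ⟨⟩ h
    exact h
  exact key (by simp) (by simp) (crossWords_heq a b) (crossTail_mem a b [])

theorem crossWords_append_right (a b c : List ℕ+) :
    (crossWords a (b ++ c) : (⟨a ++ (b ++ c)⟩ : PWeb k) ⟶ ⟨(b ++ c) ++ a⟩) =
      eqToHom (by rw [List.append_assoc]) ≫ rt (crossWords a b) c ≫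
        eqToHom (by rw [List.append_assoc]) ≫ lw b (crossWords a c) ≫
          eqToHom (by rw [List.append_assoc]) := by
  refine eq_of_heq ((crossWords_heq a (b ++ c)).trans ((crossTail_append_right a b c []).trans ?_))
  rw [heq_eqToHom_comp_iff, ← Category.assoc, ← Category.assoc, heq_comp_eqToHom_iff]
  refine comp_heq (by simp) (by simp) (by simp) ?_ ?_
  · rw [heq_comp_eqToHom_iff]
    exact HEq.trans (by rw [List.append_nil]) (rt_crossWords_heq a b c).symm
  · exact lw_heq rfl (by simp) (by simp) (crossWords_heq a c).symm

theorem crossWords_append_left (a b c : List ℕ+) :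
    (crossWords (a ++ b) c : (⟨(a ++ b) ++ c⟩ : PWeb k) ⟶ ⟨c ++ (a ++ b)⟩) =
      eqToHom (by rw [List.append_assoc]) ≫ lw a (crossWords b c) ≫
        eqToHom (by rw [List.append_assoc]) ≫ rt (crossWords a c) b ≫
          eqToHom (by rw [List.append_assoc]) := by
  refine eq_of_heq ((crossWords_heq (a ++ b) c).trans ((crossTail_append_left a b c []).trans ?_))
  rw [heq_eqToHom_comp_iff, ← Category.assoc, ← Category.assoc, heq_comp_eqToHom_iff]
  refine comp_heq (by simp) (by simp) (by simp) ?_ ?_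
  · rw [heq_comp_eqToHom_iff]
    exact lw_heq rfl (by simp) (by simp) (crossWords_heq b c).symm
  · exact HEq.trans (by rw [List.append_nil]) (rt_crossWords_heq a c b).symm

theorem koszulSign_comm {R : Type*} [CommRing R] (p q : ZMod 2) :
    koszulSign R p q = koszulSign R q p := by
  rw [koszulSign, koszulSign, mul_comm]

/-- Writing `f ⊗ g` as first `g`, then `f` costs no sign, and each morphism slides through the
crossing on its own. Afterwards `g` is on the left and still acts first; rewriting this as `g ⊗ f`
is the one place where the interchange produces a sign. -/
theorem tens_comp_crossWords {b b' : List ℕ+} {p q : ZMod 2} {f : (⟨a⟩ : PWeb k) ⟶ ⟨a'⟩}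
    {g : (⟨b⟩ : PWeb k) ⟶ ⟨b'⟩} (hf : f ∈ parity (⟨a⟩ : PWeb k) ⟨a'⟩ p)
    (hg : g ∈ parity (⟨b⟩ : PWeb k) ⟨b'⟩ q) :
    tens f g ≫ crossWords a' b' = koszulSign k p q • (crossWords a b ≫ tens g f) := by
  have h : rt g a ≫ lw b' f = koszulSign k q p • tens g f := by
    refine (tens_comp_tens g (𝟙 _) (𝟙 _) f hg hf).trans ?_
    rw [Category.comp_id, Category.id_comp]
  have h' : lw a g ≫ rt f b' = tens f g := id_tens_comp_tens_id f g
  rw [← h', Category.assoc, rt_comp_crossWords, ← Category.assoc, lw_comp_crossWords, Category.assoc,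
    h, Linear.comp_smul, koszulSign_comm]

end

end PWeb

/-- The crossing morphisms are a symmetric braiding on the supercategory of type P webs over an
integral domain in which `2` is invertible. -/
theorem corollaryC (k : Type u) [CommRing k] [IsDomain k] [Invertible (2 : k)] :
    IsSymmetricBraiding k (PWeb k) (fun a b => PWeb.crossing a b) where
  even X Y := PWeb.crossWords_mem X.word Y.word
  naturality _ _ hf hg := PWeb.tens_comp_crossWords hf hg
  hexagon_right X Y Z := PWeb.crossWords_append_right X.word Y.word Z.word
  hexagon_left X Y Z := PWeb.crossWords_append_left X.word Y.word Z.word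
  symmetric X Y := PWeb.crossWords_comp X.word Y.word
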